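/- Let $T,\Lambda,\alpha>0$ and let $(\Omega,\mathcal F,(\mathcal F_t)_{t\in[0,T]},\mathbb P)$ be a filtered probability space whose filtration is right-continuous and complete ($\mathcal F_0$ contains all $\mathbb P$-null sets), with $\mathcal F=\mathcal F_T$; nothing else is assumed on $\mathcal F_0$. Let $S=(S_t)_{t\in[0,T]}$ be an adapted process with right-continuous paths with left limits (RCLL), not necessarily a semimartingale, such that $\mathbb E_{\mathbb P}[\exp(a\sup_{0\le t\le T}S_t^2)]<\infty$ for some $a>0$. For $\Phi_0\in\mathbb R$ let $\mathcal A_{\Phi_0}$ be the set of optional processes $\phi=(\phi_t)_{t\in[0,T]}$ with $\int_0^T\phi_t^2\,dt<\infty$ and $\Phi_0+\int_0^T\phi_t\,dt=0$ almost surely, and set $$V_T^{\Phi_0,\phi}:=-\Phi_0S_0-\int_0^T\phi_tS_t\,dt-\frac\Lambda2\int_0^T\phi_t^2\,dt .$$ Let $\mathcal Q$ be the set of probability measures $\mathbb Q\sim\mathbb P$ with $\mathbb E_{\mathbb Q}[\log\frac{d\mathbb Q}{d\mathbb P}]<\infty$. For $\mathbb Q\in\mathcal Q$ let $\mathcal M^{\mathbb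 Q}_{[0,T)}$ be the set of (RCLL) $\mathbb Q$-martingales $M=(M_t)_{0\le t<T}$ with $\mathbb E_{\mathbb Q}[\int_0^TM_t^2\,dt]<\infty$. **Theorem.** For every $\Phi_0\in\mathbb R$, $$\max_{\phi\in\mathcal A_{\Phi_0}}\left\{-\frac1\alpha\log\mathbb E_{\mathbb P}\left[e^{-\alpha V_T^{\Phi_0,\phi}}\right]\right\}=\inf_{\mathbb Q\in\mathcal Q}\ \inf_{M\in\mathcal M^{\mathbb Q}_{[0,T)}}\mathbb E_{\mathbb Q}\left[\frac1\alpha\log\frac{d\mathbb Q}{d\mathbb P}+\Phi_0(M_0-S_0)+\frac1{2\Lambda}\int_0^T|M_t-S_t|^2\,dt\right],$$ where the maximum is attained (the left-hand expression is $-\infty$ when $\mathbb E_{\mathbb P}[e^{-\alpha V_T^{\Phi_0,\phi}}]=\infty$), and the random variable on the right is $\mathbb Q$-integrable for all $\mathbb Q\in\mathcal Q$, $M\in\mathcal M^{\mathbb Q}_{[0,T)}$. Moreover, the dual problem on the right-hand side has a unique minimizer $(\hat{\mathbb Q},\hat M)$, $\hat{\mathbb Q}\in\mathcal Q$, $\hat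 M\in\mathcal M^{\hat{\mathbb Q}}_{[0,T)}$ ($\hat M$ being unique up to indistinguishability), and the process $$\hat\phi_t:=\frac{\hat M_t-S_t}{\Lambda},\quad t\in[0,T),\qquad \hat\phi_T:=0,$$ belongs to $\mathcal A_{\Phi_0}$ and is the unique ($dt\otimes\mathbb P$-a.e.) maximizer of $\mathbb E_{\mathbb P}[-\exp(-\alpha V_T^{\Phi_0,\phi})]$ over $\phi\in\mathcal A_{\Phi_0}$. -/

import Mathlib

open MeasureTheory Set Filter Topology

noncomputable section

namespace AlmgrenChriss

variable {Ω : Type*} {m : MeasurableSpace Ω} {T : ℝ}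

/-- The initial time, as an element of `[0, T]`. -/
def zeroIcc (hT : 0 < T) : Icc (0 : ℝ) T := ⟨0, left_mem_Icc.2 hT.le⟩

/-- The terminal time, as an element of `[0, T]`. -/
def lastIcc (hT : 0 < T) : Icc (0 : ℝ) T := ⟨T, right_mem_Icc.2 hT.le⟩

/-- The initial time, as an element of `[0, T)`. -/
def zeroIco (hT : 0 < T) : Ico (0 : ℝ) T := ⟨0, left_mem_Ico.2 hT⟩

/-- The inclusion of `[0, T)` in `[0, T]`. -/
def toIcc (t : Ico (0 : ℝ) T) : Icc (0 : ℝ) T := ⟨t, Ico_subset_Icc_self t.2⟩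

/-- Lebesgue measure `dt` on a set of times, as a measure on the subtype. -/
def leb (s : Set ℝ) : Measure s := Measure.comap ((↑) : s → ℝ) volume

/-- Right continuity with left limits, for a path whose time set is `[0, T]` or `[0, T)`. At the
smallest time there is no condition from the left, at a largest time none from the right. -/
def IsRCLL {ι : Type*} [TopologicalSpace ι] [Preorder ι] (f : ι → ℝ) : Prop :=
  ∀ t, ContinuousWithinAt f (Ici t) t ∧ ∃ l : ℝ, Tendsto f (𝓝[<] t) (𝓝 l)

/-- The usual conditions: the filtration is right-continuous, and `𝓕 0` contains every subset of a
`P`-null set (so that `P` is complete). -/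
structure UsualConditions (P : Measure Ω) (hT : 0 < T) (𝓕 : Filtration (Icc (0 : ℝ) T) m) :
    Prop where
  rightContinuous : 𝓕.IsRightContinuous
  complete : ∀ s : Set Ω, P s = 0 → MeasurableSet[𝓕 (zeroIcc hT)] s

/-- The optional σ-algebra on `[0, T] × Ω`: the one generated by the adapted RCLL processes. -/
abbrev optionalSigma (𝓕 : Filtration (Icc (0 : ℝ) T) m) : MeasurableSpace (Icc (0 : ℝ) T × Ω) :=
  ⨆ X ∈ {X : Icc (0 : ℝ) T → Ω → ℝ | Adapted 𝓕 X ∧ ∀ ω, IsRCLL fun t ↦ X t ω},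
    MeasurableSpace.comap (fun p : Icc (0 : ℝ) T × Ω ↦ X p.1 p.2) inferInstance

/-- A process on `[0, T]` is optional. -/
def IsOptional (𝓕 : Filtration (Icc (0 : ℝ) T) m) (φ : Icc (0 : ℝ) T → Ω → ℝ) : Prop :=
  Measurable[optionalSigma 𝓕] fun p : Icc (0 : ℝ) T × Ω ↦ φ p.1 p.2

/-- The class `𝒜_{Φ₀}` of admissible strategies (turnover rates): the position starts at `Φ₀` and is
liquidated at time `T`. -/
structure IsAdmissible (P : Measure Ω) (𝓕 : Filtration (Icc (0 : ℝ) T) m) (Φ₀ : ℝ)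
    (φ : Icc (0 : ℝ) T → Ω → ℝ) : Prop where
  optional : IsOptional 𝓕 φ
  sq_integrable : ∀ᵐ ω ∂P, Integrable (fun t ↦ φ t ω ^ 2) (leb (Icc 0 T))
  liquidation : ∀ᵐ ω ∂P, Φ₀ + ∫ t, φ t ω ∂leb (Icc 0 T) = 0

/-- The profits and losses
`V_T = - Φ₀ S₀ - ∫₀ᵀ φ_t S_t dt - (Λ / 2) ∫₀ᵀ φ_t² dt`, defined pathwise. -/
def pnl (hT : 0 < T) (S : Icc (0 : ℝ) T → Ω → ℝ) (Λ Φ₀ : ℝ) (φ : Icc (0 : ℝ) T → Ω → ℝ)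
    (ω : Ω) : ℝ :=
  -Φ₀ * S (zeroIcc hT) ω - (∫ t, φ t ω * S t ω ∂leb (Icc 0 T))
    - Λ / 2 * ∫ t, φ t ω ^ 2 ∂leb (Icc 0 T)

/-- `E_P[exp(- α V_T)] ∈ [0, ∞]`. -/
def expLoss (P : Measure Ω) (hT : 0 < T) (S : Icc (0 : ℝ) T → Ω → ℝ) (Λ α Φ₀ : ℝ)
    (φ : Icc (0 : ℝ) T → Ω → ℝ) : ENNReal :=
  ∫⁻ ω, ENNReal.ofReal (Real.exp (-α * pnl hT S Λ Φ₀ φ ω)) ∂P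

/-- The expected utility `E_P[- exp(- α V_T)]`, with value `- ∞` if the expectation diverges. -/
def expectedUtility (P : Measure Ω) (hT : 0 < T) (S : Icc (0 : ℝ) T → Ω → ℝ) (Λ α Φ₀ : ℝ)
    (φ : Icc (0 : ℝ) T → Ω → ℝ) : EReal :=
  -((expLoss P hT S Λ α Φ₀ φ : ENNReal) : EReal)

/-- The certainty equivalent `- (1 / α) log E_P[exp(- α V_T)]`, with value `- ∞` if the expectation
diverges. -/
def certaintyEquivalent (P : Measure Ω) (hT : 0 < T) (S : Icc (0 : ℝ) T → Ω → ℝ) (Λ α Φ₀ : ℝ)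
    (φ : Icc (0 : ℝ) T → Ω → ℝ) : EReal :=
  ((-(1 / α) : ℝ) : EReal) * ENNReal.log (expLoss P hT S Λ α Φ₀ φ)

/-- `φ` is an optimal portfolio: it maximizes the expected utility over the admissible class. -/
def IsOptimal (P : Measure Ω) (hT : 0 < T) (𝓕 : Filtration (Icc (0 : ℝ) T) m)
    (S : Icc (0 : ℝ) T → Ω → ℝ) (Λ α Φ₀ : ℝ) (φ : Icc (0 : ℝ) T → Ω → ℝ) : Prop :=
  IsAdmissible P 𝓕 Φ₀ φ ∧ ∀ ψ, IsAdmissible P 𝓕 Φ₀ ψ →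
    expectedUtility P hT S Λ α Φ₀ ψ ≤ expectedUtility P hT S Λ α Φ₀ φ

/-- The probability measures `Q` equivalent to `P` with finite entropy `E_Q[log (dQ/dP)] < ∞`. The
negative part of `log (dQ/dP)` is always `Q`-integrable, so finiteness means integrability. -/
structure FiniteEntropy (P Q : Measure Ω) : Prop where
  prob : IsProbabilityMeasure Q
  ac : Q ≪ P
  ac' : P ≪ Q
  entropy : Integrable (llr Q P) Q

/-- The restriction of a filtration from `[0, T]` to `[0, T)`. -/
def restrictIco (𝓕 : Filtration (Icc (0 : ℝ) T) m) : Filtration (Ico (0 : ℝ) T) m where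
  seq t := 𝓕 (toIcc t)
  mono' _ _ h := 𝓕.mono h
  le' t := 𝓕.le (toIcc t)

/-- The class of (RCLL) `Q`-martingales on `[0, T)` with `E_Q[∫₀ᵀ M_t² dt] < ∞`. -/
structure IsDualMartingale (𝓕 : Filtration (Icc (0 : ℝ) T) m) (Q : Measure Ω)
    (M : Ico (0 : ℝ) T → Ω → ℝ) : Prop where
  martingale : Martingale M (restrictIco 𝓕) Q
  rcll : ∀ ω, IsRCLL fun t ↦ M t ω
  sq_integrable : ∫⁻ ω, (∫⁻ t, ENNReal.ofReal (M t ω ^ 2) ∂leb (Ico 0 T)) ∂Q < ⊤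

/-- The random variable
`(1/α) log (dQ/dP) + Φ₀ (M₀ - S₀) + (1/(2Λ)) ∫₀ᵀ |M_t - S_t|² dt`. -/
def dualIntegrand (P : Measure Ω) (hT : 0 < T) (S : Icc (0 : ℝ) T → Ω → ℝ) (Λ α Φ₀ : ℝ)
    (Q : Measure Ω) (M : Ico (0 : ℝ) T → Ω → ℝ) (ω : Ω) : ℝ :=
  1 / α * llr Q P ω + Φ₀ * (M (zeroIco hT) ω - S (zeroIcc hT) ω)
    + 1 / (2 * Λ) * ∫ t, |M t ω - S (toIcc t) ω| ^ 2 ∂leb (Ico 0 T)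

/-- The dual target functional, the `Q`-expectation of `dualIntegrand`. -/
def dualObjective (P : Measure Ω) (hT : 0 < T) (S : Icc (0 : ℝ) T → Ω → ℝ) (Λ α Φ₀ : ℝ)
    (Q : Measure Ω) (M : Ico (0 : ℝ) T → Ω → ℝ) : ℝ :=
  ∫ ω, dualIntegrand P hT S Λ α Φ₀ Q M ω ∂Q

/-- The pair `(Q, M)` is a minimizer of the dual problem. -/
def IsDualMinimizer (P : Measure Ω) (hT : 0 < T) (𝓕 : Filtration (Icc (0 : ℝ) T) m)
    (S : Icc (0 : ℝ) T → Ω → ℝ) (Λ α Φ₀ : ℝ) (Q : Measure Ω) (M : Ico (0 : ℝ) T → Ω → ℝ) : Prop :=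
  (FiniteEntropy P Q ∧ IsDualMartingale 𝓕 Q M) ∧
    ∀ (Q' : Measure Ω) (M' : Ico (0 : ℝ) T → Ω → ℝ), FiniteEntropy P Q' → IsDualMartingale 𝓕 Q' M' →
      dualObjective P hT S Λ α Φ₀ Q M ≤ dualObjective P hT S Λ α Φ₀ Q' M'

open Classical in
/-- The process `(M_t - S_t) / Λ` for `t ∈ [0, T)`, set to `0` at time `T`. -/
def portfolioOf (S : Icc (0 : ℝ) T → Ω → ℝ) (Λ : ℝ) (M : Ico (0 : ℝ) T → Ω → ℝ)
    (t : Icc (0 : ℝ) T) (ω : Ω) : ℝ :=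
  if h : (t : ℝ) < T then (M ⟨t, t.2.1, h⟩ ω - S t ω) / Λ else 0

end AlmgrenChriss

end

open AlmgrenChriss

/-!
The theorem is a convex duality with an explicit duality gap. For an admissible strategy `ψ` and a
dual pair `(Q, M)`, a martingale pairs with a strategy through the initial position only,
`E_Q[∫ ψ_t M_t dt] = - Φ₀ E_Q[M₀]`, so that completing the square gives
`J(Q, M) = H(Q | P) / α + E_Q[V_T(ψ)] + (1 / (2 Λ)) E_Q[∫ (M_t - S_t - Λ ψ_t)² dt]`
for the dual functional `J` (`dualObjective_eq_add_gap`). With the entropy inequality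
`E_Q[Y] ≤ H(Q | P) + log E_P[e^Y]` this is weak duality (`weak_duality`). Equality forces both
`Q = P.tilted (- α V_T(ψ))` and `M = S + Λ ψ`, which is the uniqueness of the dual minimizer
(`eq_of_dualObjective_le`).

There is no gap at the optimal strategy. The loss `exp(- α V_T)` is so strictly convex in the
strategy that a minimizing sequence which approaches the infimum geometrically fast converges
`dt`-a.e. along almost every path and is dominated there; by Fatou's lemma its limit `φ` is a
minimizer
(`exists_isMinimal`), and the same convexity makes it unique (`ae_eq_of_isMinimal`). Comparing `φ`
with a bounded strategy shows that `Q = P.tilted (- α V_T(φ))` has finite entropy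
(`finiteEntropy_of_isMinimal`), and perturbing `φ` by bounded round trips `η`, with `∫ η_t dt = 0`,
shows that `E_Q[∫ η_t (S_t + Λ φ_t) dt] = 0` (`integral_mul_eq_zero_of_isMinimal`).

A square-integrable optional process `Y` which is orthogonal to all round trips is a martingale
on `[0, T)` up to modification: the conditional expectations of the future means
`(T - t)⁻¹ ∫_{[t, T]} Y_u du` form a martingale, by testing with round trips that shift a position
from `[s, T]` to `[t, T]`; the right-continuous version of this martingale equals `Y` almost
everywhere, by testing with round trips that follow a strategy until `t` and unwind it at constant
speed afterwards (`OrthogonalToRoundTrips.exists_isDualMartingale`). The right-continuous version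
exists because the expected number of displacements by `ε` along dyadic times is bounded by
`ε⁻²` times a second moment (`integral_displacement_le`, `exists_rcll_version`). Applied to
`Y = S + Λ φ`, this provides the dual martingale (`exists_dual_optimizer`).
-/

namespace AlmgrenChriss

/-! ### Time, paths and optional processes -/

variable {Ω : Type*} {m : MeasurableSpace Ω} {T : ℝ}

instance : IsFiniteMeasure (leb (Icc (0 : ℝ) T)) :=
  ⟨by
    rw [leb, comap_subtype_coe_apply measurableSet_Icc, image_univ, Subtype.range_coe]
    exact measure_Icc_lt_top⟩

instance : IsFiniteMeasure (leb (Ico (0 : ℝ) T)) :=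
  ⟨by
    rw [leb, comap_subtype_coe_apply measurableSet_Ico, image_univ, Subtype.range_coe]
    exact measure_Ico_lt_top⟩

lemma leb_Icc_apply (s : Set (Icc (0 : ℝ) T)) :
    (leb (Icc (0 : ℝ) T)) s = volume (Subtype.val '' s) :=
  comap_subtype_coe_apply measurableSet_Icc _ _

lemma isOpenEmbedding_toIcc :
    IsOpenEmbedding (toIcc : Ico (0 : ℝ) T → Icc (0 : ℝ) T) := by
  refine ⟨IsEmbedding.inclusion Ico_subset_Icc_self, ?_⟩
  have : range (toIcc : Ico (0 : ℝ) T → Icc (0 : ℝ) T) = {t : Icc (0 : ℝ) T | (t : ℝ) < T} := by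
    ext t; constructor
    · rintro ⟨s, rfl⟩; exact s.2.2
    · intro h; exact ⟨⟨t, t.2.1, h⟩, rfl⟩
  rw [this]
  exact isOpen_lt continuous_subtype_val continuous_const

lemma measurableEmbedding_toIcc : MeasurableEmbedding (toIcc : Ico (0 : ℝ) T → Icc (0 : ℝ) T) :=
  isOpenEmbedding_toIcc.measurableEmbedding

lemma leb_last (hT : 0 < T) : leb (Icc (0 : ℝ) T) ({lastIcc hT} : Set (Icc (0 : ℝ) T)) = 0 := by
  rw [leb_Icc_apply]; simp

lemma ae_lt_last (hT : 0 < T) : ∀ᵐ t : Icc (0 : ℝ) T ∂leb (Icc (0 : ℝ) T), (t : ℝ) < T := by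
  filter_upwards [compl_mem_ae_iff.2 (leb_last hT)] with t ht
  refine lt_of_le_of_ne t.2.2 fun h ↦ ht (Subtype.ext h)

lemma leb_Ici (t : Icc (0 : ℝ) T) : leb (Icc (0 : ℝ) T) (Ici t) = ENNReal.ofReal (T - t) := by
  rw [leb_Icc_apply]
  have : Subtype.val '' Ici t = Icc (t : ℝ) T := by
    ext x; constructor
    · rintro ⟨y, hy, rfl⟩; exact ⟨hy, y.2.2⟩
    · intro hx; exact ⟨⟨x, t.2.1.trans hx.1, hx.2⟩, hx.1, rfl⟩
  rw [this, Real.volume_Icc]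

lemma measurePreserving_toIcc :
    MeasurePreserving (toIcc : Ico (0 : ℝ) T → Icc (0 : ℝ) T) (leb (Ico 0 T)) (leb (Icc 0 T)) := by
  refine ⟨measurableEmbedding_toIcc.measurable, ?_⟩
  ext s hs
  rw [Measure.map_apply measurableEmbedding_toIcc.measurable hs, leb_Icc_apply, leb,
    comap_subtype_coe_apply measurableSet_Ico]
  have : Subtype.val '' (toIcc ⁻¹' s : Set (Ico (0 : ℝ) T)) = Subtype.val '' s \ {T} := by
    ext x; constructor
    · rintro ⟨y, hy, rfl⟩; exact ⟨⟨toIcc y, hy, rfl⟩, fun h ↦ (y.2.2.ne h)⟩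
    · rintro ⟨⟨y, hy, rfl⟩, hx⟩
      exact ⟨⟨y, y.2.1, lt_of_le_of_ne y.2.2 hx⟩, hy, rfl⟩
  rw [this, measure_sdiff_null (by simp)]

/-- A path with right and left limits on a compact interval is bounded. -/
lemma IsRCLL.exists_bound {f : Icc (0 : ℝ) T → ℝ} (hf : IsRCLL f) : ∃ C, ∀ t, |f t| ≤ C := by
  have h : ∀ t ∈ (univ : Set (Icc (0 : ℝ) T)), ∃ s ∈ 𝓝[univ] t, ∃ C, ∀ u ∈ s, |f u| ≤ C := by
    intro t _
    obtain ⟨h1, l, h2⟩ := hf t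
    have h1' : Tendsto f (𝓝[≥] t) (𝓝 (f t)) := h1
    have e1 := h1'.abs.eventually (eventually_le_nhds (lt_add_one |f t|))
    have e2 := h2.abs.eventually (eventually_le_nhds (lt_add_one |l|))
    rw [nhdsWithin_univ, ← nhdsLT_sup_nhdsGE t]
    refine ⟨{u | |f u| ≤ max (|f t| + 1) (|l| + 1)}, ?_, _, fun u hu ↦ hu⟩
    refine mem_sup.2 ⟨?_, ?_⟩
    · filter_upwards [e2] with u hu using hu.trans (le_max_right _ _)
    · filter_upwards [e1] with u hu using hu.trans (le_max_left _ _)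
  have := isCompact_univ.induction_on (p := fun s : Set (Icc (0 : ℝ) T) ↦ ∃ C, ∀ u ∈ s, |f u| ≤ C)
    ⟨0, by simp⟩ (fun s t hst ⟨C, hC⟩ ↦ ⟨C, fun u hu ↦ hC u (hst hu)⟩)
    (fun s t ⟨C, hC⟩ ⟨D, hD⟩ ↦ ⟨max C D, fun u hu ↦ hu.elim
      (fun h ↦ (hC u h).trans (le_max_left _ _)) (fun h ↦ (hD u h).trans (le_max_right _ _))⟩) h
  obtain ⟨C, hC⟩ := this
  exact ⟨C, fun t ↦ hC t (mem_univ t)⟩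

/-- A process with right-continuous paths is jointly measurable, since it is the pointwise limit of
its samples along the dyadic grids, taken at the next grid point to the right. -/
lemma measurable_uncurry_of_rightContinuous {Ω : Type*} {m' : MeasurableSpace Ω} (hT : 0 ≤ T)
    {X : Icc (0 : ℝ) T → Ω → ℝ} (hX : ∀ t, Measurable (X t))
    (hr : ∀ ω t, ContinuousWithinAt (fun t ↦ X t ω) (Ici t) t) :
    Measurable fun p : Icc (0 : ℝ) T × Ω ↦ X p.1 p.2 := by
  let d : ℕ → Icc (0 : ℝ) T → Icc (0 : ℝ) T := fun n t ↦
    projIcc 0 T hT ((⌊(t : ℝ) * 2 ^ n⌋₊ + 1 : ℝ) / 2 ^ n)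
  have hd : ∀ n, Measurable fun p : Icc (0 : ℝ) T × Ω ↦ X (d n p.1) p.2 := by
    intro n
    have h1 : Measurable fun q : ℕ × Ω ↦ X (projIcc 0 T hT ((q.1 + 1 : ℝ) / 2 ^ n)) q.2 :=
      measurable_from_prod_countable_right fun k ↦ hX (projIcc 0 T hT ((k + 1 : ℝ) / 2 ^ n))
    have h2 : Measurable fun p : Icc (0 : ℝ) T × Ω ↦ (⌊(p.1 : ℝ) * 2 ^ n⌋₊, p.2) :=
      (Nat.measurable_floor.comp ((measurable_subtype_coe.comp measurable_fst).mul_const _)).prodMk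
        measurable_snd
    simpa only [Function.comp_def] using h1.comp h2
  refine measurable_of_tendsto_metrizable hd (tendsto_pi_nhds.2 fun p ↦ ?_)
  have hlim : Tendsto (fun n : ℕ ↦ (⌊(p.1 : ℝ) * 2 ^ n⌋₊ + 1 : ℝ) / 2 ^ n) atTop (𝓝 (p.1 : ℝ)) := by
    have hp : Tendsto (fun n : ℕ ↦ (p.1 : ℝ) + (1 / 2 : ℝ) ^ n) atTop (𝓝 ((p.1 : ℝ) + 0)) :=
      tendsto_const_nhds.add (tendsto_pow_atTop_nhds_zero_of_lt_one (by norm_num) (by norm_num))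
    rw [add_zero] at hp
    refine tendsto_of_tendsto_of_tendsto_of_le_of_le tendsto_const_nhds hp (fun n ↦ ?_) fun n ↦ ?_
    · rw [le_div_iff₀ (by positivity)]
      exact (Nat.lt_floor_add_one _).le
    · simp only
      rw [div_le_iff₀ (by positivity), add_mul, ← mul_pow]
      have := Nat.floor_le (a := (p.1 : ℝ) * 2 ^ n) (mul_nonneg p.1.2.1 (by positivity))
      norm_num
      linarith
  have hle : ∀ n, p.1 ≤ d n p.1 := fun n ↦ by
    have h1 : p.1 = projIcc 0 T hT (p.1 : ℝ) := (projIcc_val hT p.1).symm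
    conv_lhs => rw [h1]
    refine monotone_projIcc hT ?_
    rw [le_div_iff₀ (by positivity)]
    exact (Nat.lt_floor_add_one _).le
  have hc : Tendsto (fun n ↦ d n p.1) atTop (𝓝 p.1) := by
    have := ((continuous_projIcc (h := hT)).tendsto (p.1 : ℝ)).comp hlim
    rwa [projIcc_val] at this
  exact (hr p.2 p.1).tendsto.comp (tendsto_nhdsWithin_iff.2 ⟨hc, Eventually.of_forall hle⟩)

variable {𝓕 : Filtration (Icc (0 : ℝ) T) m}

lemma measurable_to_optionalSigma {β : Type*} {mβ : MeasurableSpace β} {g : β → Icc (0 : ℝ) T × Ω}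
    (h : ∀ X : Icc (0 : ℝ) T → Ω → ℝ, Adapted 𝓕 X → (∀ ω, IsRCLL fun t ↦ X t ω) →
      Measurable fun b ↦ X (g b).1 (g b).2) : Measurable[mβ, optionalSigma 𝓕] g := by
  rw [measurable_iff_comap_le, MeasurableSpace.comap_iSup]
  refine iSup_le fun X ↦ ?_
  rw [MeasurableSpace.comap_iSup]
  refine iSup_le fun hX ↦ ?_
  rw [MeasurableSpace.comap_comp]
  exact measurable_iff_comap_le.1 (h X hX.1 hX.2)

lemma IsOptional.of_rcll {X : Icc (0 : ℝ) T → Ω → ℝ} (hX : Adapted 𝓕 X)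
    (hr : ∀ ω, IsRCLL fun t ↦ X t ω) : IsOptional 𝓕 X := by
  rw [IsOptional, measurable_iff_comap_le]
  exact le_iSup₂_of_le X ⟨hX, hr⟩ le_rfl

lemma IsOptional.adapted {φ : Icc (0 : ℝ) T → Ω → ℝ} (hφ : IsOptional 𝓕 φ) (t : Icc (0 : ℝ) T) :
    Measurable[𝓕 t] (φ t) :=
  Measurable.comp (f := fun ω ↦ (t, ω)) hφ
    (measurable_to_optionalSigma (mβ := 𝓕 t) fun _ hX _ ↦ hX t)

/-- Optional processes are progressively measurable, stated through the stopped time `s ∧ t`. -/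
lemma IsOptional.progressive {φ : Icc (0 : ℝ) T → Ω → ℝ} (hφ : IsOptional 𝓕 φ)
    (t : Icc (0 : ℝ) T) :
    Measurable[Prod.instMeasurableSpace (m₂ := 𝓕 t)]
      fun p : Icc (0 : ℝ) T × Ω ↦ φ (min p.1 t) p.2 := by
  refine Measurable.comp
    (f := fun p : Icc (0 : ℝ) T × Ω ↦ (min p.1 t, p.2)) hφ
    (measurable_to_optionalSigma (mβ := Prod.instMeasurableSpace (m₂ := 𝓕 t)) fun X hX hr ↦ ?_)
  refine measurable_uncurry_of_rightContinuous (m' := 𝓕 t) (t.2.1.trans t.2.2)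
    (X := fun s ω ↦ X (min s t) ω) (fun s ↦ (hX _).mono (𝓕.mono (min_le_right _ _)) le_rfl)
    fun ω s ↦ ?_
  exact ContinuousWithinAt.comp (g := fun u ↦ X u ω) (f := fun u ↦ min u t) (hr ω _).1
    (by fun_prop) fun u hu ↦ min_le_min_right t hu

lemma IsOptional.measurable (hT : 0 < T) {φ : Icc (0 : ℝ) T → Ω → ℝ} (hφ : IsOptional 𝓕 φ) :
    Measurable fun p : Icc (0 : ℝ) T × Ω ↦ φ p.1 p.2 := by
  have h := hφ.progressive (lastIcc hT)
  have e : (fun p : Icc (0 : ℝ) T × Ω ↦ φ (min p.1 (lastIcc hT)) p.2) = fun p ↦ φ p.1 p.2 := by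
    ext p; rw [min_eq_left]; exact p.1.2.2
  rw [e] at h
  exact h.mono (sup_le_sup le_rfl (MeasurableSpace.comap_mono (𝓕.le _))) le_rfl

/-- The process `g · 1_{[s, T]}` is optional if `g` is known at time `s`. -/
lemma isOptional_indicator_Ici (s : Icc (0 : ℝ) T) {g : Ω → ℝ} (hg : Measurable[𝓕 s] g) :
    IsOptional 𝓕 fun t ω ↦ if s ≤ t then g ω else 0 := by
  refine IsOptional.of_rcll (fun t ↦ ?_) fun ω t ↦ ⟨?_, ?_⟩
  · by_cases h : s ≤ t
    · simpa [h] using hg.mono (𝓕.mono h) le_rfl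
    · simp [h]
  · by_cases h : s ≤ t
    · refine (continuousWithinAt_const (b := g ω)).congr (fun u hu ↦ ?_) (by simp [h])
      simp [h.trans hu]
    · refine ContinuousAt.continuousWithinAt ((continuousAt_const (y := (0 : ℝ))).congr ?_)
      filter_upwards [Iio_mem_nhds (not_le.1 h)] with u hu
      simp [not_le.2 (show u < s from hu)]
  · by_cases h : t ≤ s
    · refine ⟨0, tendsto_const_nhds.congr' ?_⟩
      filter_upwards [self_mem_nhdsWithin] with u hu
      simp [not_le.2 (lt_of_lt_of_le hu h)]
    · refine ⟨g ω, tendsto_const_nhds.congr' ?_⟩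
      filter_upwards [nhdsWithin_le_nhds (Ioi_mem_nhds (not_le.1 h))] with u hu
      simp [le_of_lt (show s < u from hu)]

open Classical in
/-- A process on `[0, T)`, extended by `0` to `[0, T]`. -/
noncomputable def extendZero (M : Ico (0 : ℝ) T → Ω → ℝ) (t : Icc (0 : ℝ) T) (ω : Ω) : ℝ :=
  if h : (t : ℝ) < T then M ⟨t, t.2.1, h⟩ ω else 0

@[simp] lemma extendZero_toIcc (M : Ico (0 : ℝ) T → Ω → ℝ) (t : Ico (0 : ℝ) T) (ω : Ω) :
    extendZero M (toIcc t) ω = M t ω := by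
  have : ((toIcc t : Icc (0 : ℝ) T) : ℝ) < T := t.2.2
  simp only [extendZero, this, dite_true]; rfl

lemma extendZero_of_lt (M : Ico (0 : ℝ) T → Ω → ℝ) (t : Icc (0 : ℝ) T) (h : (t : ℝ) < T) (ω : Ω) :
    extendZero M t ω = M ⟨t, t.2.1, h⟩ ω := by
  simp [extendZero, h]

lemma map_toIcc_nhdsWithin (t : Ico (0 : ℝ) T) (s : Set (Icc (0 : ℝ) T)) :
    map toIcc (𝓝[toIcc ⁻¹' s] t) = 𝓝[s] (toIcc t) := by
  rw [isOpenEmbedding_toIcc.isEmbedding.map_nhdsWithin_eq, image_preimage_eq_inter_range,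
    nhdsWithin_inter_of_mem']
  exact nhdsWithin_le_nhds (isOpenEmbedding_toIcc.isOpen_range.mem_nhds (mem_range_self t))

/-- The extension by `0` of an adapted RCLL process on `[0, T)` is optional, although it need not
have a left limit at `T`: it is the limit of its truncations to `[0, c)`, `c < T`. -/
lemma isOptional_extendZero {M : Ico (0 : ℝ) T → Ω → ℝ}
    (hM : Adapted (restrictIco 𝓕) M) (hr : ∀ ω, IsRCLL fun t ↦ M t ω) :
    IsOptional 𝓕 (extendZero M) := by
  classical
  let c : ℕ → ℝ := fun n ↦ T - 1 / (n + 1)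
  let X : ℕ → Icc (0 : ℝ) T → Ω → ℝ := fun n t ω ↦ if (t : ℝ) < c n then extendZero M t ω else 0
  have hcT : ∀ n, c n < T := fun n ↦ by
    have : (0 : ℝ) < 1 / (n + 1) := by positivity
    simp only [c]; linarith
  have hX : ∀ n, IsOptional 𝓕 (X n) := by
    intro n
    refine IsOptional.of_rcll (fun t ↦ ?_) fun ω t ↦ ?_
    · by_cases h : (t : ℝ) < c n
      · have h' : (t : ℝ) < T := h.trans (hcT n)
        have := hM ⟨t, t.2.1, h'⟩
        have e : X n t = M ⟨t, t.2.1, h'⟩ := by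
          ext ω; simp [X, h, extendZero_of_lt M t h']
        rw [e]; exact this
      · have e : X n t = fun _ ↦ 0 := by ext ω; simp [X, h]
        rw [e]; exact measurable_const
    · by_cases ht : (t : ℝ) < T
      · obtain ⟨t, rfl⟩ : ∃ t' : Ico (0 : ℝ) T, toIcc t' = t := ⟨⟨t, t.2.1, ht⟩, rfl⟩
        obtain ⟨h1, l, h2⟩ := hr ω t
        have h1' : Tendsto (fun s ↦ extendZero M s ω) (𝓝[≥] (toIcc t)) (𝓝 (M t ω)) := by
          rw [← map_toIcc_nhdsWithin, tendsto_map'_iff]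
          simp only [Function.comp_def, extendZero_toIcc]
          exact h1.tendsto
        have h2' : Tendsto (fun s ↦ extendZero M s ω) (𝓝[<] (toIcc t)) (𝓝 l) := by
          rw [← map_toIcc_nhdsWithin, tendsto_map'_iff]
          simp only [Function.comp_def, extendZero_toIcc]
          exact h2
        constructor
        · by_cases h : ((toIcc t : Icc (0 : ℝ) T) : ℝ) < c n
          · have : X n (toIcc t) ω = M t ω := by simp [X, h]
            change Tendsto _ _ (𝓝 (X n (toIcc t) ω))
            rw [this]
            refine h1'.congr' ?_
            filter_upwards [nhdsWithin_le_nhds ((isOpen_lt continuous_subtype_val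
              continuous_const).mem_nhds h)] with s hs
            simp [X, show (s : ℝ) < c n from hs]
          · refine (continuousWithinAt_const (b := (0 : ℝ))).congr (fun s hs ↦ ?_) ?_
            · have : ¬ (s : ℝ) < c n := fun h' ↦ h (lt_of_le_of_lt (by exact hs) h')
              simp [X, this]
            · simp [X, h]
        · by_cases h : ((toIcc t : Icc (0 : ℝ) T) : ℝ) ≤ c n
          · refine ⟨l, h2'.congr' ?_⟩
            filter_upwards [self_mem_nhdsWithin] with s hs
            have : (s : ℝ) < c n := lt_of_lt_of_le (by exact hs) h
            simp [X, this]
          · refine ⟨0, tendsto_const_nhds.congr' ?_⟩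
            filter_upwards [nhdsWithin_le_nhds ((isOpen_lt continuous_const
              continuous_subtype_val).mem_nhds (not_le.1 h))] with s hs
            have : ¬ (s : ℝ) < c n := not_lt.2 (le_of_lt (by exact hs))
            simp [X, this]
      · have hev : ∀ᶠ s in 𝓝 t, X n s ω = 0 := by
          filter_upwards [(isOpen_lt continuous_const continuous_subtype_val).mem_nhds
            (show c n < t from (hcT n).trans_le (not_lt.1 ht))] with s hs
          have : ¬ (s : ℝ) < c n := not_lt.2 (le_of_lt (by exact hs))
          simp [X, this]
        refine ⟨ContinuousAt.continuousWithinAt (continuousAt_const.congr (EventuallyEq.symm hev)),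
          0, tendsto_const_nhds.congr' ?_⟩
        filter_upwards [nhdsWithin_le_nhds hev] with s hs using hs.symm
  refine @measurable_of_tendsto_metrizable _ _ (optionalSigma 𝓕) _ _ _ _
    (fun n p ↦ X n p.1 p.2) _ hX (tendsto_pi_nhds.2 fun p ↦ ?_)
  by_cases ht : (p.1 : ℝ) < T
  · have hc : Tendsto c atTop (𝓝 (T - 0)) :=
      tendsto_const_nhds.sub tendsto_one_div_add_atTop_nhds_zero_nat
    rw [sub_zero] at hc
    refine tendsto_const_nhds.congr' ?_
    filter_upwards [hc.eventually (eventually_gt_nhds ht)] with n hn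
    simp [X, hn]
  · refine tendsto_const_nhds.congr fun n ↦ ?_
    have : ¬ (p.1 : ℝ) < c n := fun h ↦ ht (h.trans (hcT n))
    simp [X, this, extendZero, ht]

end AlmgrenChriss

namespace AlmgrenChriss

/-! ### Relative entropy and exponential moments -/

variable {Ω : Type*} {m : MeasurableSpace Ω} {T : ℝ} {P Q : Measure Ω}

section Entropy

lemma le_llr_add_exp (Y : Ω → ℝ) (ω : Ω) :
    Y ω ≤ llr Q P ω + (Real.exp (Y ω - llr Q P ω) - 1) := by
  have := Real.add_one_le_exp (Y ω - llr Q P ω)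
  linarith

variable [IsProbabilityMeasure P] {Y : Ω → ℝ}

lemma FiniteEntropy.integrable_exp_sub_llr (hQ : FiniteEntropy P Q)
    (hY : Integrable (fun ω ↦ Real.exp (Y ω)) P) :
    Integrable (fun ω ↦ Real.exp (Y ω - llr Q P ω)) Q ∧
      ∫ ω, Real.exp (Y ω - llr Q P ω) ∂Q = ∫ ω, Real.exp (Y ω) ∂P := by
  have := hQ.prob
  have h : (fun ω ↦ (P.rnDeriv Q ω).toReal • Real.exp (Y ω))
      =ᵐ[Q] fun ω ↦ Real.exp (Y ω - llr Q P ω) := by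
    filter_upwards [exp_neg_llr hQ.ac] with ω hω
    rw [← hω, smul_eq_mul, ← Real.exp_add]
    ring_nf
  rw [← integrable_congr h, ← integral_congr_ae h]
  exact ⟨(integrable_rnDeriv_smul_iff hQ.ac').2 hY, integral_rnDeriv_smul hQ.ac'⟩

/-- By the Young inequality `y z ≤ z log z - z + e ^ y`, a random variable with a finite exponential
moment under `P` is integrable from above under any measure of finite entropy. -/
lemma FiniteEntropy.integrable_of_exp (hQ : FiniteEntropy P Q)
    (hY : Integrable (fun ω ↦ Real.exp (Y ω)) P) {Z : Ω → ℝ} (hZ : Integrable Z Q)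
    (hZY : ∀ᵐ ω ∂Q, Z ω ≤ Y ω) : Integrable Y Q := by
  have := hQ.prob
  have hm : AEStronglyMeasurable Y Q :=
    ((Real.aemeasurable_of_aemeasurable_exp hY.1.aemeasurable).mono_ac hQ.ac).aestronglyMeasurable
  exact integrable_of_le_of_le hm hZY (ae_of_all _ (le_llr_add_exp Y)) hZ
    (hQ.entropy.add ((hQ.integrable_exp_sub_llr hY).1.sub (integrable_const _)))

lemma FiniteEntropy.integral_llr_add_exp (hQ : FiniteEntropy P Q)
    (hY : Integrable (fun ω ↦ Real.exp (Y ω)) P) :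
    Integrable (fun ω ↦ llr Q P ω + (Real.exp (Y ω - Real.log (∫ ω, Real.exp (Y ω) ∂P)
        - llr Q P ω) - 1)) Q ∧
      ∫ ω, (llr Q P ω + (Real.exp (Y ω - Real.log (∫ ω, Real.exp (Y ω) ∂P)
        - llr Q P ω) - 1)) ∂Q = ∫ ω, llr Q P ω ∂Q := by
  have := hQ.prob
  set c := ∫ ω, Real.exp (Y ω) ∂P with hc
  have hcpos : 0 < c := integral_exp_pos hY
  have hY' : Integrable (fun ω ↦ Real.exp (Y ω - Real.log c)) P := by
    simp_rw [Real.exp_sub]; exact hY.div_const _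
  have h2 : ∫ ω, Real.exp (Y ω - Real.log c) ∂P = 1 := by
    simp_rw [Real.exp_sub, Real.exp_log hcpos]
    rw [integral_div, ← hc, div_self hcpos.ne']
  obtain ⟨h1, h3⟩ := hQ.integrable_exp_sub_llr hY'
  have h4 : Integrable (fun ω ↦ Real.exp (Y ω - Real.log c - llr Q P ω) - 1) Q :=
    h1.sub (integrable_const 1)
  refine ⟨hQ.entropy.add h4, ?_⟩
  rw [integral_add hQ.entropy h4, integral_sub h1 (integrable_const 1), h3, h2]
  simp

/-- The Gibbs variational inequality. -/
lemma FiniteEntropy.integral_le (hQ : FiniteEntropy P Q)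
    (hY : Integrable (fun ω ↦ Real.exp (Y ω)) P) (hYQ : Integrable Y Q) :
    ∫ ω, Y ω ∂Q ≤ ∫ ω, llr Q P ω ∂Q + Real.log (∫ ω, Real.exp (Y ω) ∂P) := by
  have := hQ.prob
  set c := ∫ ω, Real.exp (Y ω) ∂P with hc
  obtain ⟨h1, h2⟩ := hQ.integral_llr_add_exp hY
  have h4 : Integrable (fun ω ↦ Y ω - Real.log c) Q := hYQ.sub (integrable_const _)
  have h3 := integral_mono h4 h1 (le_llr_add_exp (Q := Q) (P := P) fun ω ↦ Y ω - Real.log c)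
  rw [h2, integral_sub hYQ (integrable_const _)] at h3
  simp at h3
  linarith

/-- The equality case of the Gibbs variational inequality. -/
lemma FiniteEntropy.eq_tilted (hQ : FiniteEntropy P Q)
    (hY : Integrable (fun ω ↦ Real.exp (Y ω)) P) (hYQ : Integrable Y Q)
    (h : ∫ ω, llr Q P ω ∂Q + Real.log (∫ ω, Real.exp (Y ω) ∂P) ≤ ∫ ω, Y ω ∂Q) :
    Q = P.tilted Y := by
  have := hQ.prob
  obtain ⟨h1, h2⟩ := hQ.integral_llr_add_exp hY
  have hcpos : 0 < ∫ ω, Real.exp (Y ω) ∂P := integral_exp_pos hY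
  set c := ∫ ω, Real.exp (Y ω) ∂P with hc
  have h4 : Integrable (fun ω ↦ Y ω - Real.log c) Q := hYQ.sub (integrable_const _)
  let D : Ω → ℝ := fun ω ↦ llr Q P ω + (Real.exp (Y ω - Real.log c - llr Q P ω) - 1)
    - (Y ω - Real.log c)
  have hDi : Integrable D Q := h1.sub h4
  have hD0 : ∀ ω, 0 ≤ D ω := fun ω ↦
    sub_nonneg.2 (le_llr_add_exp (Q := Q) (P := P) (fun ω ↦ Y ω - Real.log c) ω)
  have hDint : ∫ ω, D ω ∂Q = 0 := by
    refine le_antisymm ?_ (integral_nonneg hD0)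
    have : ∫ ω, D ω ∂Q = ∫ ω, llr Q P ω ∂Q - (∫ ω, Y ω ∂Q - Real.log c) := by
      rw [← h2, integral_sub h1 h4, integral_sub hYQ (integrable_const _)]
      simp
    linarith
  have hD := (integral_eq_zero_iff_of_nonneg hD0 hDi).1 hDint
  have hllr : ∀ᵐ ω ∂Q, llr Q P ω = Y ω - Real.log c := by
    filter_upwards [hD] with ω hω
    by_contra hne
    have := Real.add_one_lt_exp (x := Y ω - Real.log c - llr Q P ω)
      (fun h ↦ hne (by linarith))
    simp only [D, Pi.zero_apply] at hω
    linarith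
  have hllrP := hQ.ac'.ae_le hllr
  rw [← Measure.withDensity_rnDeriv_eq Q P hQ.ac, Measure.tilted]
  refine withDensity_congr_ae ?_
  filter_upwards [hllrP, exp_llr_of_ac' Q P hQ.ac', Measure.rnDeriv_lt_top Q P] with ω h1 h2 h3
  rw [h1, Real.exp_sub, Real.exp_log hcpos] at h2
  rw [← hc, h2, ENNReal.ofReal_toReal h3.ne]

end Entropy

/-- `W` dominates `sup_t S_t²` and has a finite exponential moment of order `a`. -/
structure IsExpBound (P : Measure Ω) (S : Icc (0 : ℝ) T → Ω → ℝ) (W : Ω → ℝ) (a : ℝ) : Prop where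
  pos : 0 < a
  sq_le : ∀ t ω, S t ω ^ 2 ≤ W ω
  exp_integrable : Integrable (fun ω ↦ Real.exp (a * W ω)) P

namespace IsExpBound

variable {S : Icc (0 : ℝ) T → Ω → ℝ} {W : Ω → ℝ} {a : ℝ}

lemma nonneg (hT : 0 < T) (h : IsExpBound P S W a) (ω : Ω) : 0 ≤ W ω :=
  (sq_nonneg _).trans (h.sq_le (zeroIcc hT) ω)

lemma integrable [IsProbabilityMeasure P] (hT : 0 < T) (h : IsExpBound P S W a)
    (hQ : FiniteEntropy P Q) : Integrable W Q := by
  have h1 := hQ.integrable_of_exp h.exp_integrable (integrable_zero _ _ _)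
    (ae_of_all _ fun ω ↦ mul_nonneg h.pos.le (h.nonneg hT ω))
  refine (h1.const_mul a⁻¹).congr (ae_of_all _ fun ω ↦ ?_)
  simp [h.pos.ne']

/-- All exponential moments of `√W`, hence of `sup_t |S_t|`, are finite. -/
lemma integrable_exp_of_le [IsProbabilityMeasure P] (hT : 0 < T) (h : IsExpBound P S W a)
    {Y : Ω → ℝ} (hY : AEMeasurable Y P) {C : ℝ} (hC : ∀ᵐ ω ∂P, |Y ω| ≤ C * (1 + √(W ω))) :
    Integrable (fun ω ↦ Real.exp (Y ω)) P := by
  have ha := h.pos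
  refine (h.exp_integrable.const_mul (Real.exp (C + C ^ 2 / (4 * a)))).mono'
    hY.exp.aestronglyMeasurable ?_
  filter_upwards [hC] with ω hω
  rw [Real.norm_eq_abs, Real.abs_exp, ← Real.exp_add]
  refine Real.exp_le_exp.2 ((le_abs_self _).trans (hω.trans ?_))
  have h1 := Real.sq_sqrt (h.nonneg hT ω)
  have h2 : a * W ω - C * √(W ω) + C ^ 2 / (4 * a) = a * (√(W ω) - C / (2 * a)) ^ 2 := by
    nth_rewrite 1 [← h1]
    field_simp
    ring
  nlinarith [mul_nonneg ha.le (sq_nonneg (√(W ω) - C / (2 * a)))]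

end IsExpBound

/-- The supremum of `S²` is an exponential bound, as the paths of `S` are bounded. -/
lemma isExpBound_iSup {S : Icc (0 : ℝ) T → Ω → ℝ} {a : ℝ} (hS : ∀ ω, IsRCLL fun t ↦ S t ω)
    (ha : 0 < a) (h : Integrable (fun ω ↦ Real.exp (a * ⨆ t, S t ω ^ 2)) P) :
    IsExpBound P S (fun ω ↦ ⨆ t, S t ω ^ 2) a := by
  refine ⟨ha, fun t ω ↦ ?_, h⟩
  obtain ⟨C, hC⟩ := (hS ω).exists_bound
  refine le_ciSup (f := fun t ↦ S t ω ^ 2) ⟨C ^ 2, ?_⟩ t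
  rintro _ ⟨u, rfl⟩
  exact sq_le_sq.2 ((hC u).trans (le_abs_self C))

end AlmgrenChriss

namespace AlmgrenChriss

/-! ### Square-integrable martingales and their pairing with optional processes -/

variable {Ω : Type*} {m : MeasurableSpace Ω} {T : ℝ} {P Q : Measure Ω}

section General

variable {ι : Type*} [Preorder ι] {𝓖 : Filtration ι m} {ξ : ι → Ω → ℝ}

lemma memLp_martingale_of_le (hξ : Martingale ξ 𝓖 Q) {s t : ι} (hst : s ≤ t)
    (ht : MemLp (ξ t) 2 Q) : MemLp (ξ s) 2 Q :=
  (memLp_congr_ae (hξ.condExp_ae_eq hst)).1 (ht.condExp one_le_two)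

variable [IsFiniteMeasure Q]

lemma integral_mul_martingale (hξ : Martingale ξ 𝓖 Q) {s t : ι} (hst : s ≤ t) {g : Ω → ℝ}
    (hg : StronglyMeasurable[𝓖 s] g) (hi : Integrable (fun ω ↦ g ω * ξ t ω) Q) :
    ∫ ω, g ω * ξ t ω ∂Q = ∫ ω, g ω * ξ s ω ∂Q := by
  rw [← integral_condExp (𝓖.le s)]
  refine integral_congr_ae ?_
  filter_upwards [condExp_mul_of_stronglyMeasurable_left hg hi (hξ.integrable t),
    hξ.condExp_ae_eq hst] with ω h1 h2
  exact h1.trans (by rw [Pi.mul_apply, h2])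

lemma integral_sq_sub_martingale (hξ : Martingale ξ 𝓖 Q) {s t : ι} (hst : s ≤ t)
    (ht : MemLp (ξ t) 2 Q) :
    ∫ ω, (ξ t ω - ξ s ω) ^ 2 ∂Q = ∫ ω, ξ t ω ^ 2 ∂Q - ∫ ω, ξ s ω ^ 2 ∂Q := by
  have hs := memLp_martingale_of_le hξ hst ht
  have h1 : Integrable (fun ω ↦ ξ s ω * ξ t ω) Q := hs.integrable_mul ht
  have h2 := integral_mul_martingale hξ hst (hξ.stronglyMeasurable s) h1
  have e : ∀ ω, (ξ t ω - ξ s ω) ^ 2 = ξ t ω ^ 2 - 2 * (ξ s ω * ξ t ω) + ξ s ω ^ 2 := fun ω ↦ by ring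
  simp_rw [e]
  have h3 : Integrable (fun ω ↦ ξ t ω ^ 2 - 2 * (ξ s ω * ξ t ω)) Q :=
    ht.integrable_sq.sub (h1.const_mul 2)
  rw [integral_add h3 hs.integrable_sq, integral_sub ht.integrable_sq (h1.const_mul 2),
    integral_const_mul, h2]
  simp_rw [← sq]
  ring

lemma integral_sq_martingale_mono (hξ : Martingale ξ 𝓖 Q) {s t : ι} (hst : s ≤ t)
    (ht : MemLp (ξ t) 2 Q) : ∫ ω, ξ s ω ^ 2 ∂Q ≤ ∫ ω, ξ t ω ^ 2 ∂Q := by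
  have := integral_sq_sub_martingale hξ hst ht
  have h := integral_nonneg (μ := Q) (f := fun ω ↦ (ξ t ω - ξ s ω) ^ 2) fun ω ↦ sq_nonneg _
  linarith

end General

variable {𝓕 : Filtration (Icc (0 : ℝ) T) m}

/-- A sequence of times in `[0, T)` that increases to `T`. -/
noncomputable def approachLast (hT : 0 < T) (n : ℕ) : Ico (0 : ℝ) T :=
  ⟨T - T / (n + 1), by
    have : T / (n + 1 : ℝ) ≤ T := div_le_self hT.le (by simp)
    have h2 : 0 < T / (n + 1 : ℝ) := by positivity
    constructor <;> linarith⟩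

lemma monotone_approachLast (hT : 0 < T) : Monotone (approachLast hT) := by
  intro a b hab
  have : T / (b + 1 : ℝ) ≤ T / (a + 1 : ℝ) := by
    have : (a : ℝ) ≤ b := by exact_mod_cast hab
    gcongr
  exact Subtype.mk_le_mk.2 (by linarith)

lemma tendsto_approachLast (hT : 0 < T) :
    Tendsto (fun n ↦ (approachLast hT n : ℝ)) atTop (𝓝 T) := by
  have h := (tendsto_one_div_add_atTop_nhds_zero_nat (𝕜 := ℝ)).const_mul T
  have h2 : Tendsto (fun n : ℕ ↦ T - T * (1 / ((n : ℝ) + 1))) atTop (𝓝 (T - T * 0)) :=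
    tendsto_const_nhds.sub h
  simpa [approachLast, div_eq_mul_inv] using h2

lemma exists_lt_approachLast (hT : 0 < T) {t : ℝ} (ht : t < T) : ∃ n, t < approachLast hT n :=
  ((tendsto_approachLast hT).eventually (eventually_gt_nhds ht)).exists

/-- The integral over the time interval `[t, T]` tends to `0` as `t` tends to `T`. -/
lemma tendsto_setIntegral_Ici (hT : 0 < T) [IsFiniteMeasure Q] {G : Icc (0 : ℝ) T × Ω → ℝ}
    (hG : Integrable G ((leb (Icc 0 T)).prod Q)) :
    Tendsto (fun n ↦ ∫ p in Ici (toIcc (approachLast hT n)) ×ˢ univ, G p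
      ∂((leb (Icc 0 T)).prod Q)) atTop (𝓝 0) := by
  have h := tendsto_setIntegral_of_antitone (μ := (leb (Icc 0 T)).prod Q) (f := G)
    (s := fun n ↦ Ici (toIcc (approachLast hT n)) ×ˢ univ)
    (fun n ↦ measurableSet_Ici.prod MeasurableSet.univ)
    (fun a b hab ↦ prod_mono_left (Ici_subset_Ici.2 (monotone_approachLast hT hab)))
    ⟨0, hG.integrableOn⟩
  have e : (⋂ n, Ici (toIcc (approachLast hT n)) ×ˢ (univ : Set Ω))
      = ({lastIcc hT} : Set (Icc (0 : ℝ) T)) ×ˢ univ := by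
    ext p
    simp only [mem_iInter, mem_prod, mem_univ, and_true, mem_Ici, mem_singleton_iff]
    constructor
    · intro hp
      refine le_antisymm p.1.2.2 ?_
      exact le_of_tendsto' (x := atTop) (a := T) (b := (p.1 : ℝ))
        (tendsto_approachLast hT) (fun n ↦ hp n)
    · intro hp n
      rw [hp]
      exact (approachLast hT n).2.2.le
  rw [e, Measure.restrict_eq_zero.2, integral_zero_measure] at h
  · exact h
  · rw [Measure.prod_prod, leb_last, zero_mul]

lemma measurable_extendZero (hT : 0 < T) {M : Ico (0 : ℝ) T → Ω → ℝ}
    (hM : Adapted (restrictIco 𝓕) M) (hr : ∀ ω, IsRCLL fun t ↦ M t ω) :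
    Measurable fun p : Icc (0 : ℝ) T × Ω ↦ extendZero M p.1 p.2 :=
  (isOptional_extendZero hM hr).measurable hT

lemma integral_leb_Ico (f : Icc (0 : ℝ) T → ℝ) :
    ∫ t, f (toIcc t) ∂leb (Ico 0 T) = ∫ t, f t ∂leb (Icc 0 T) :=
  measurePreserving_toIcc.integral_comp measurableEmbedding_toIcc f

lemma lintegral_leb_Ico (f : Icc (0 : ℝ) T → ENNReal) :
    ∫⁻ t, f (toIcc t) ∂leb (Ico 0 T) = ∫⁻ t, f t ∂leb (Icc 0 T) :=
  measurePreserving_toIcc.lintegral_comp_emb measurableEmbedding_toIcc f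

section DualMartingale

variable {M : Ico (0 : ℝ) T → Ω → ℝ}

lemma IsDualMartingale.adapted (hM : IsDualMartingale 𝓕 Q M) : Adapted (restrictIco 𝓕) M :=
  fun t ↦ (hM.martingale.stronglyMeasurable t).measurable

lemma IsDualMartingale.isOptional (hM : IsDualMartingale 𝓕 Q M) : IsOptional 𝓕 (extendZero M) :=
  isOptional_extendZero hM.adapted hM.rcll

variable [IsFiniteMeasure Q]

lemma lintegral_sq_extendZero (hT : 0 < T) (hM : Adapted (restrictIco 𝓕) M)
    (hr : ∀ ω, IsRCLL fun t ↦ M t ω) :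
    ∫⁻ ω, (∫⁻ t, ENNReal.ofReal (M t ω ^ 2) ∂leb (Ico 0 T)) ∂Q
      = ∫⁻ p, ENNReal.ofReal (extendZero M p.1 p.2 ^ 2) ∂((leb (Icc 0 T)).prod Q) := by
  rw [lintegral_prod_symm' _ ((measurable_extendZero hT hM hr).pow_const 2).ennreal_ofReal]
  refine lintegral_congr fun ω ↦ ?_
  rw [← lintegral_leb_Ico]
  simp

lemma memLp_two_of_lintegral_sq {α : Type*} {mα : MeasurableSpace α} {μ : Measure α} {f : α → ℝ}
    (hf : AEStronglyMeasurable f μ) (h : ∫⁻ x, ENNReal.ofReal (f x ^ 2) ∂μ < ⊤) : MemLp f 2 μ := by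
  rw [memLp_two_iff_integrable_sq hf]
  refine ⟨hf.pow 2, ?_⟩
  rwa [hasFiniteIntegral_iff_ofReal (ae_of_all _ fun x ↦ sq_nonneg _)]

lemma IsDualMartingale.memLp_prod (hT : 0 < T) (hM : IsDualMartingale 𝓕 Q M) :
    MemLp (fun p : Icc (0 : ℝ) T × Ω ↦ extendZero M p.1 p.2) 2 ((leb (Icc 0 T)).prod Q) := by
  have h := hM.sq_integrable
  rw [lintegral_sq_extendZero hT hM.adapted hM.rcll] at h
  exact memLp_two_of_lintegral_sq (hM.isOptional.measurable hT).aestronglyMeasurable h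

lemma leb_Ioo_pos {t : Ico (0 : ℝ) T} : 0 < leb (Icc (0 : ℝ) T) (Ioi (toIcc t)) := by
  have h : leb (Icc (0 : ℝ) T) (Ici (toIcc t)) ≤ leb (Icc (0 : ℝ) T) (Ioi (toIcc t))
      + leb (Icc (0 : ℝ) T) {toIcc t} := by
    rw [← Ioi_union_left]; exact measure_union_le _ _
  have h0 : leb (Icc (0 : ℝ) T) ({toIcc t} : Set (Icc (0 : ℝ) T)) = 0 := by
    rw [leb_Icc_apply]; simp
  rw [h0, add_zero, leb_Ici] at h
  refine lt_of_lt_of_le ?_ h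
  simpa [toIcc] using t.2.2

lemma IsDualMartingale.memLp (hT : 0 < T) (hM : IsDualMartingale 𝓕 Q M) (t : Ico (0 : ℝ) T) :
    MemLp (M t) 2 Q := by
  have h1 := (hM.memLp_prod hT).integrable_sq.prod_right_ae
  have h2 : ∃ᵐ u ∂leb (Icc (0 : ℝ) T), u ∈ Ioi (toIcc t) :=
    frequently_ae_mem_iff.2 leb_Ioo_pos.ne'
  obtain ⟨u, hu, hui, huT⟩ := (h2.and_eventually (h1.and (ae_lt_last hT))).exists
  let u' : Ico (0 : ℝ) T := ⟨u, u.2.1, huT⟩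
  refine memLp_martingale_of_le hM.martingale (t := u') (le_of_lt hu) ?_
  rw [memLp_two_iff_integrable_sq (hM.martingale.integrable u').1]
  refine hui.congr (ae_of_all _ fun ω ↦ ?_)
  simp only [extendZero_of_lt M u huT, u']

end DualMartingale

/-- Up to a time `t`, an optional process `f` pairs with a martingale `N` as it pairs with the
final value `N_t`. -/
lemma integral_prod_mul_martingale [IsProbabilityMeasure Q] {N : Ico (0 : ℝ) T → Ω → ℝ}
    (hN : Martingale N (restrictIco 𝓕) Q) {f : Icc (0 : ℝ) T → Ω → ℝ} (hf : IsOptional 𝓕 f)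
    (t : Ico (0 : ℝ) T) (ht : MemLp (N t) 2 Q)
    (hf2 : MemLp (fun p : Icc (0 : ℝ) T × Ω ↦ f p.1 p.2) 2
      (((leb (Icc 0 T)).restrict (Iio (toIcc t))).prod Q))
    (hN2 : MemLp (fun p : Icc (0 : ℝ) T × Ω ↦ extendZero N p.1 p.2) 2
      (((leb (Icc 0 T)).restrict (Iio (toIcc t))).prod Q)) :
    ∫ p, f p.1 p.2 * extendZero N p.1 p.2 ∂(((leb (Icc 0 T)).restrict (Iio (toIcc t))).prod Q)
      = ∫ p, f p.1 p.2 * N t p.2 ∂(((leb (Icc 0 T)).restrict (Iio (toIcc t))).prod Q) := by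
  have h1 : Integrable (fun p : Icc (0 : ℝ) T × Ω ↦ f p.1 p.2 * extendZero N p.1 p.2)
    (((leb (Icc 0 T)).restrict (Iio (toIcc t))).prod Q) := hf2.integrable_mul hN2
  have h2 : Integrable (fun p : Icc (0 : ℝ) T × Ω ↦ f p.1 p.2 * N t p.2)
    (((leb (Icc 0 T)).restrict (Iio (toIcc t))).prod Q) :=
    hf2.integrable_mul (ht.comp_snd ((leb (Icc 0 T)).restrict (Iio (toIcc t))))
  rw [integral_prod _ h1, integral_prod _ h2]
  refine integral_congr_ae ?_
  filter_upwards [h2.prod_right_ae, ae_restrict_mem measurableSet_Iio] with u hu hut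
  have huT : (u : ℝ) < T := lt_of_lt_of_le hut (toIcc t).2.2
  have := integral_mul_martingale hN (s := ⟨u, u.2.1, huT⟩) (t := t) (le_of_lt hut)
    (g := f u) (hf.adapted u).stronglyMeasurable hu
  simp only [extendZero_of_lt N u huT]
  exact this.symm

lemma leb_real_Ici (t : Icc (0 : ℝ) T) : (leb (Icc (0 : ℝ) T)).real (Ici t) = T - t := by
  rw [Measure.real, leb_Ici, ENNReal.toReal_ofReal (sub_nonneg.2 t.2.2)]

lemma leb_real_univ (hT : 0 < T) : (leb (Icc (0 : ℝ) T)).real univ = T := by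
  have := leb_real_Ici (zeroIcc hT)
  rwa [show Ici (zeroIcc hT) = univ from eq_univ_of_forall fun t ↦ t.2.1,
    show ((zeroIcc hT : Icc (0 : ℝ) T) : ℝ) = 0 from rfl, sub_zero] at this

/-- Over `[t, T]`, the martingale frozen at time `t` is smaller in `L²` than the martingale. -/
lemma IsDualMartingale.setIntegral_frozen_le [IsProbabilityMeasure Q] (hT : 0 < T)
    {M : Ico (0 : ℝ) T → Ω → ℝ} (hM : IsDualMartingale 𝓕 Q M) (t : Ico (0 : ℝ) T) :
    ∫ p in Ici (toIcc t) ×ˢ univ, M t p.2 ^ 2 ∂((leb (Icc 0 T)).prod Q)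
      ≤ ∫ p in Ici (toIcc t) ×ˢ univ, extendZero M p.1 p.2 ^ 2 ∂((leb (Icc 0 T)).prod Q) := by
  have h1 : Integrable (fun p : Icc (0 : ℝ) T × Ω ↦ extendZero M p.1 p.2 ^ 2)
    ((leb (Icc 0 T)).prod Q) := (hM.memLp_prod hT).integrable_sq
  have h2 : Integrable (fun p : Icc (0 : ℝ) T × Ω ↦ M t p.2 ^ 2) ((leb (Icc 0 T)).prod Q) :=
    ((hM.memLp hT t).comp_snd (leb (Icc 0 T))).integrable_sq
  have e : ((leb (Icc (0 : ℝ) T)).prod Q).restrict (Ici (toIcc t) ×ˢ univ)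
      = ((leb (Icc (0 : ℝ) T)).restrict (Ici (toIcc t))).prod Q := by
    rw [← Measure.prod_restrict, Measure.restrict_univ]
  have h1' := h1.restrict (s := Ici (toIcc t) ×ˢ univ)
  have h2' := h2.restrict (s := Ici (toIcc t) ×ˢ univ)
  rw [e] at h1' h2' ⊢
  rw [integral_prod _ h1', integral_prod _ h2']
  refine integral_mono_ae h2'.integral_prod_left h1'.integral_prod_left ?_
  filter_upwards [ae_restrict_mem measurableSet_Ici, ae_restrict_of_ae (ae_lt_last hT)]
    with u hu huT
  simp only [extendZero_of_lt M u huT]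
  exact integral_sq_martingale_mono hM.martingale (t := ⟨u, u.2.1, huT⟩) hu (hM.memLp hT _)

/-- A strategy that liquidates `c` in total, paired with a dual martingale, gives `- c E M_0`:
before `t` the martingale may be replaced by `M_t`, and the remaining part is negligible since
`(T - t) E M_t² → 0`. -/
lemma IsDualMartingale.integral_mul_eq [IsProbabilityMeasure Q] (hT : 0 < T)
    {M : Ico (0 : ℝ) T → Ω → ℝ} (hM : IsDualMartingale 𝓕 Q M) {ψ : Icc (0 : ℝ) T → Ω → ℝ}
    (hψ : IsOptional 𝓕 ψ)
    (hψ2 : MemLp (fun p : Icc (0 : ℝ) T × Ω ↦ ψ p.1 p.2) 2 ((leb (Icc 0 T)).prod Q)) {c : ℝ}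
    (hc : ∀ᵐ ω ∂Q, ∫ t, ψ t ω ∂leb (Icc 0 T) = -c) :
    ∫ p, ψ p.1 p.2 * extendZero M p.1 p.2 ∂((leb (Icc 0 T)).prod Q)
      = -c * ∫ ω, M (zeroIco hT) ω ∂Q := by
  set ν := (leb (Icc (0 : ℝ) T)).prod Q with hν
  have hM2 := hM.memLp_prod hT
  have hi : Integrable (fun p : Icc (0 : ℝ) T × Ω ↦ ψ p.1 p.2 * extendZero M p.1 p.2) ν :=
    hψ2.integrable_mul hM2
  have hG : Integrable (fun p : Icc (0 : ℝ) T × Ω ↦ ψ p.1 p.2 ^ 2 + extendZero M p.1 p.2 ^ 2) ν :=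
    hψ2.integrable_sq.add hM2.integrable_sq
  have hlim := tendsto_setIntegral_Ici hT hG
  have key : ∀ t : Ico (0 : ℝ) T, |∫ p, ψ p.1 p.2 * extendZero M p.1 p.2 ∂ν
      - -c * ∫ ω, M (zeroIco hT) ω ∂Q|
      ≤ ∫ p in Ici (toIcc t) ×ˢ univ, (ψ p.1 p.2 ^ 2 + extendZero M p.1 p.2 ^ 2) ∂ν := by
    intro t
    have hMt := hM.memLp hT t
    have hMt2 : MemLp (fun p : Icc (0 : ℝ) T × Ω ↦ M t p.2) 2 ν := hMt.comp_snd (leb (Icc 0 T))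
    have hi2 : Integrable (fun p : Icc (0 : ℝ) T × Ω ↦ ψ p.1 p.2 * M t p.2) ν :=
      hψ2.integrable_mul hMt2
    have hmeas : MeasurableSet (Ici (toIcc t) ×ˢ (univ : Set Ω)) :=
      measurableSet_Ici.prod MeasurableSet.univ
    have hcompl : (Ici (toIcc t) ×ˢ (univ : Set Ω))ᶜ = Iio (toIcc t) ×ˢ univ := by
      ext p; simp
    have e : ν.restrict (Iio (toIcc t) ×ˢ univ)
        = ((leb (Icc (0 : ℝ) T)).restrict (Iio (toIcc t))).prod Q := by
      rw [← Measure.prod_restrict, Measure.restrict_univ]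
    have h1 := integral_prod_mul_martingale hM.martingale hψ t hMt (e ▸ hψ2.restrict _)
      (e ▸ hM2.restrict _)
    rw [← e] at h1
    have h2 := integral_add_compl hmeas hi
    have h3 := integral_add_compl hmeas hi2
    rw [hcompl] at h2 h3
    -- frozen at time `t`, the martingale only sees the total `∫ ψ dt = -c`
    have h4 : ∫ p, ψ p.1 p.2 * M t p.2 ∂ν = -c * ∫ ω, M (zeroIco hT) ω ∂Q := by
      rw [integral_prod_symm _ hi2]
      have h5 : ∫ ω, M (zeroIco hT) ω ∂Q = ∫ ω, M t ω ∂Q := by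
        have := hM.martingale.setIntegral_eq (i := zeroIco hT) (j := t) t.2.1
          (MeasurableSet.univ)
        simpa using this
      rw [h5, ← integral_const_mul]
      refine integral_congr_ae ?_
      filter_upwards [hc] with ω hω
      rw [← hω, integral_mul_const]
    have h6 : ∫ p, ψ p.1 p.2 * extendZero M p.1 p.2 ∂ν - -c * ∫ ω, M (zeroIco hT) ω ∂Q
        = ∫ p in Ici (toIcc t) ×ˢ univ, ψ p.1 p.2 * (extendZero M p.1 p.2 - M t p.2) ∂ν := by
      rw [← h4]
      simp_rw [mul_sub]
      rw [integral_sub hi.restrict hi2.restrict]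
      linarith
    rw [h6]
    -- `|ψ (M - M_t)| ≤ ψ² + M² / 2 + M_t² / 2`, and over `[t, T]` the last term is dominated by the
    -- one before it
    have hA : IntegrableOn (fun p : Icc (0 : ℝ) T × Ω ↦
        |ψ p.1 p.2 * (extendZero M p.1 p.2 - M t p.2)|) (Ici (toIcc t) ×ˢ univ) ν := by
      refine ((hi.sub hi2).abs.congr (ae_of_all _ fun p ↦ ?_)).restrict
      simp [mul_sub]
    have hB1 : IntegrableOn (fun p : Icc (0 : ℝ) T × Ω ↦
        (ψ p.1 p.2 ^ 2 + 1 / 2 * extendZero M p.1 p.2 ^ 2)) (Ici (toIcc t) ×ˢ univ) ν :=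
      (hψ2.integrable_sq.add (hM2.integrable_sq.const_mul _)).restrict
    have hB2 : IntegrableOn (fun p : Icc (0 : ℝ) T × Ω ↦
        1 / 2 * M t p.2 ^ 2) (Ici (toIcc t) ×ˢ univ) ν :=
      (hMt2.integrable_sq.const_mul _).restrict
    calc |∫ p in Ici (toIcc t) ×ˢ univ, ψ p.1 p.2 * (extendZero M p.1 p.2 - M t p.2) ∂ν|
        ≤ ∫ p in Ici (toIcc t) ×ˢ univ, |ψ p.1 p.2 * (extendZero M p.1 p.2 - M t p.2)| ∂ν :=
          abs_integral_le_integral_abs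
      _ ≤ ∫ p in Ici (toIcc t) ×ˢ univ, ((ψ p.1 p.2 ^ 2 + 1 / 2 * extendZero M p.1 p.2 ^ 2)
            + 1 / 2 * M t p.2 ^ 2) ∂ν := by
          refine integral_mono hA (hB1.add hB2) fun p ↦ ?_
          simp only
          rw [abs_le]
          constructor <;>
          nlinarith [sq_nonneg (ψ p.1 p.2 - extendZero M p.1 p.2),
            sq_nonneg (ψ p.1 p.2 + extendZero M p.1 p.2), sq_nonneg (ψ p.1 p.2 - M t p.2),
            sq_nonneg (ψ p.1 p.2 + M t p.2)]
      _ = ∫ p in Ici (toIcc t) ×ˢ univ, (ψ p.1 p.2 ^ 2 + 1 / 2 * extendZero M p.1 p.2 ^ 2) ∂ν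
            + 1 / 2 * ∫ p in Ici (toIcc t) ×ˢ univ, M t p.2 ^ 2 ∂ν := by
          rw [integral_add hB1 hB2, integral_const_mul]
      _ ≤ ∫ p in Ici (toIcc t) ×ˢ univ, (ψ p.1 p.2 ^ 2 + 1 / 2 * extendZero M p.1 p.2 ^ 2) ∂ν
            + 1 / 2 * ∫ p in Ici (toIcc t) ×ˢ univ, extendZero M p.1 p.2 ^ 2 ∂ν := by
          have := hM.setIntegral_frozen_le hT t
          linarith
      _ = ∫ p in Ici (toIcc t) ×ˢ univ, (ψ p.1 p.2 ^ 2 + extendZero M p.1 p.2 ^ 2) ∂ν := by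
          rw [← integral_const_mul, ← integral_add hB1 (hM2.integrable_sq.const_mul _).restrict]
          refine integral_congr_ae (ae_of_all _ fun p ↦ ?_)
          simp only
          ring
  have h0 := le_of_tendsto_of_tendsto tendsto_const_nhds hlim
    (Eventually.of_forall fun n ↦ key (approachLast hT n))
  exact sub_eq_zero.1 (abs_eq_zero.1 (le_antisymm h0 (abs_nonneg _)))

end AlmgrenChriss

namespace AlmgrenChriss

/-! ### The profits and losses, and weak duality -/

variable {Ω : Type*} {m : MeasurableSpace Ω} {T : ℝ} {P Q : Measure Ω}
  {𝓕 : Filtration (Icc (0 : ℝ) T) m} {S ψ : Icc (0 : ℝ) T → Ω → ℝ} {W : Ω → ℝ} {a : ℝ}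
  {Λ α Φ₀ : ℝ}

lemma IsOptional.measurable_path (hT : 0 < T) (hψ : IsOptional 𝓕 ψ) (ω : Ω) :
    Measurable fun t ↦ ψ t ω :=
  (hψ.measurable hT).comp measurable_prodMk_right

lemma IsOptional.memLp_path (hT : 0 < T) (hψ : IsOptional 𝓕 ψ) {ω : Ω}
    (h : Integrable (fun t ↦ ψ t ω ^ 2) (leb (Icc 0 T))) :
    MemLp (fun t ↦ ψ t ω) 2 (leb (Icc 0 T)) :=
  (memLp_two_iff_integrable_sq (hψ.measurable_path hT ω).aestronglyMeasurable).2 h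

lemma IsExpBound.memLp_path (hT : 0 < T) (hW : IsExpBound P S W a) (hS : IsOptional 𝓕 S) (ω : Ω) :
    MemLp (fun t ↦ S t ω) 2 (leb (Icc 0 T)) := by
  refine hS.memLp_path hT ((integrable_const (W ω)).mono'
    ((hS.measurable_path hT ω).pow_const 2).aestronglyMeasurable (ae_of_all _ fun t ↦ ?_))
  rw [Real.norm_eq_abs, abs_of_nonneg (sq_nonneg _)]
  exact hW.sq_le t ω

lemma IsExpBound.memLp_prod [IsProbabilityMeasure P] (hT : 0 < T) (hW : IsExpBound P S W a)
    (hS : IsOptional 𝓕 S) (hQ : FiniteEntropy P Q) :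
    MemLp (fun p : Icc (0 : ℝ) T × Ω ↦ S p.1 p.2) 2 ((leb (Icc 0 T)).prod Q) := by
  have := hQ.prob
  rw [memLp_two_iff_integrable_sq (hS.measurable hT).aestronglyMeasurable]
  refine ((hW.integrable hT hQ).comp_snd (leb (Icc (0 : ℝ) T))).mono'
    ((hS.measurable hT).pow_const 2).aestronglyMeasurable (ae_of_all _ fun p ↦ ?_)
  rw [Real.norm_eq_abs, abs_of_nonneg (sq_nonneg _)]
  exact hW.sq_le p.1 p.2

lemma IsExpBound.memLp [IsProbabilityMeasure P] (hT : 0 < T) (hW : IsExpBound P S W a)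
    (hS : IsOptional 𝓕 S) (hQ : FiniteEntropy P Q) (t : Icc (0 : ℝ) T) : MemLp (S t) 2 Q := by
  have := hQ.prob
  have hm : Measurable (S t) := (hS.adapted t).mono (𝓕.le t) le_rfl
  rw [memLp_two_iff_integrable_sq hm.aestronglyMeasurable]
  refine (hW.integrable hT hQ).mono' (hm.pow_const 2).aestronglyMeasurable (ae_of_all _ fun ω ↦ ?_)
  rw [Real.norm_eq_abs, abs_of_nonneg (sq_nonneg _)]
  exact hW.sq_le t ω

lemma measurable_integral_path (hT : 0 < T) (hψ : IsOptional 𝓕 ψ) :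
    Measurable fun ω ↦ ∫ t, ψ t ω ∂leb (Icc 0 T) :=
  (hψ.measurable hT).stronglyMeasurable.integral_prod_left'.measurable

lemma IsOptional.mul {φ : Icc (0 : ℝ) T → Ω → ℝ} (hφ : IsOptional 𝓕 φ) (hψ : IsOptional 𝓕 ψ) :
    IsOptional 𝓕 fun t ω ↦ φ t ω * ψ t ω :=
  Measurable.mul hφ hψ

lemma IsOptional.add {φ : Icc (0 : ℝ) T → Ω → ℝ} (hφ : IsOptional 𝓕 φ) (hψ : IsOptional 𝓕 ψ) :
    IsOptional 𝓕 fun t ω ↦ φ t ω + ψ t ω :=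
  Measurable.add hφ hψ

lemma IsOptional.sub {φ : Icc (0 : ℝ) T → Ω → ℝ} (hφ : IsOptional 𝓕 φ) (hψ : IsOptional 𝓕 ψ) :
    IsOptional 𝓕 fun t ω ↦ φ t ω - ψ t ω :=
  Measurable.sub hφ hψ

lemma IsOptional.const (c : ℝ) : IsOptional 𝓕 fun _ _ ↦ c :=
  measurable_const

lemma IsOptional.const_mul (hψ : IsOptional 𝓕 ψ) (c : ℝ) : IsOptional 𝓕 fun t ω ↦ c * ψ t ω :=
  (IsOptional.const c).mul hψ

lemma measurable_pnl (hT : 0 < T) (hS : IsOptional 𝓕 S) (hψ : IsOptional 𝓕 ψ) :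
    Measurable (pnl hT S Λ Φ₀ ψ) := by
  have h0 : Measurable (S (zeroIcc hT)) := (hS.adapted _).mono (𝓕.le _) le_rfl
  have h1 := measurable_integral_path hT (hψ.mul hS)
  have h2 : Measurable fun ω ↦ ∫ t, ψ t ω ^ 2 ∂leb (Icc 0 T) := by
    simpa only [sq] using measurable_integral_path hT (hψ.mul hψ)
  unfold pnl
  exact ((measurable_const.mul h0).sub h1).sub (measurable_const.mul h2)

/-- The losses dominate the squared `L²`-norm of the strategy, up to a multiple of `1 + sup S²`. -/
lemma le_neg_pnl (hT : 0 < T) (hW : IsExpBound P S W a) (hS : IsOptional 𝓕 S)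
    (hψ : IsOptional 𝓕 ψ) (hΛ : 0 < Λ) {ω : Ω}
    (h : Integrable (fun t ↦ ψ t ω ^ 2) (leb (Icc 0 T))) :
    Λ / 4 * ∫ t, ψ t ω ^ 2 ∂leb (Icc 0 T) - ((Φ₀ ^ 2 + W ω) / 2 + T * W ω / Λ)
      ≤ -pnl hT S Λ Φ₀ ψ ω := by
  have hψ2 := hψ.memLp_path hT h
  have hS2 := hW.memLp_path hT hS ω
  have hi : Integrable (fun t ↦ ψ t ω * S t ω) (leb (Icc 0 T)) := hψ2.integrable_mul hS2
  have h1 : -(Λ / 4) * ∫ t, ψ t ω ^ 2 ∂leb (Icc 0 T) - T * (W ω / Λ)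
      ≤ ∫ t, ψ t ω * S t ω ∂leb (Icc 0 T) := by
    have e : T * (W ω / Λ) = ∫ t, W ω / Λ ∂leb (Icc 0 T) := by
      rw [integral_const, leb_real_univ hT, smul_eq_mul]
    rw [e, ← integral_const_mul, ← integral_sub (h.const_mul _) (integrable_const _)]
    refine integral_mono ((h.const_mul _).sub (integrable_const _)) hi fun t ↦ ?_
    have hs := hW.sq_le t ω
    have h3 : S t ω ^ 2 / Λ ≤ W ω / Λ := div_le_div_of_nonneg_right hs hΛ.le
    have h4 : ψ t ω * S t ω + Λ / 4 * ψ t ω ^ 2 + S t ω ^ 2 / Λ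
        = (Λ * ψ t ω + 2 * S t ω) ^ 2 / (4 * Λ) := by
      field_simp; ring
    have h5 : 0 ≤ (Λ * ψ t ω + 2 * S t ω) ^ 2 / (4 * Λ) := by positivity
    simp only
    linarith
  have h0 := hW.sq_le (zeroIcc hT) ω
  unfold pnl
  have h6 : T * W ω / Λ = T * (W ω / Λ) := by ring
  nlinarith [sq_nonneg (Φ₀ + S (zeroIcc hT) ω)]

lemma integrable_exp_of_expLoss (hT : 0 < T) (hS : IsOptional 𝓕 S) (hψ : IsOptional 𝓕 ψ)
    (h : expLoss P hT S Λ α Φ₀ ψ ≠ ⊤) :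
    Integrable (fun ω ↦ Real.exp (-α * pnl hT S Λ Φ₀ ψ ω)) P := by
  refine ⟨((measurable_pnl hT hS hψ).const_mul _).exp.aestronglyMeasurable, ?_⟩
  rw [hasFiniteIntegral_iff_ofReal (ae_of_all _ fun ω ↦ (Real.exp_pos _).le)]
  exact h.lt_top

lemma expLoss_eq (hT : 0 < T)
    (h : Integrable (fun ω ↦ Real.exp (-α * pnl hT S Λ Φ₀ ψ ω)) P) :
    expLoss P hT S Λ α Φ₀ ψ = ENNReal.ofReal (∫ ω, Real.exp (-α * pnl hT S Λ Φ₀ ψ ω) ∂P) :=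
  (ofReal_integral_eq_lintegral_ofReal h (ae_of_all _ fun _ ↦ (Real.exp_pos _).le)).symm

lemma certaintyEquivalent_eq [IsProbabilityMeasure P] (hT : 0 < T)
    (h : Integrable (fun ω ↦ Real.exp (-α * pnl hT S Λ Φ₀ ψ ω)) P) :
    certaintyEquivalent P hT S Λ α Φ₀ ψ
      = ((-(1 / α) * Real.log (∫ ω, Real.exp (-α * pnl hT S Λ Φ₀ ψ ω) ∂P) : ℝ) : EReal) := by
  rw [certaintyEquivalent, expLoss_eq hT h, ENNReal.log_ofReal_of_pos (integral_exp_pos h),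
    EReal.coe_mul]

lemma certaintyEquivalent_of_top (hT : 0 < T) (hα : 0 < α)
    (h : expLoss P hT S Λ α Φ₀ ψ = ⊤) : certaintyEquivalent P hT S Λ α Φ₀ ψ = ⊥ := by
  rw [certaintyEquivalent, h, ENNReal.log_top]
  exact EReal.coe_mul_top_of_neg (by simpa using hα)

lemma dualIntegrand_eq (hT : 0 < T) (M : Ico (0 : ℝ) T → Ω → ℝ) (ω : Ω) :
    dualIntegrand P hT S Λ α Φ₀ Q M ω = 1 / α * llr Q P ω
      + Φ₀ * (M (zeroIco hT) ω - S (zeroIcc hT) ω)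
      + 1 / (2 * Λ) * ∫ t, (extendZero M t ω - S t ω) ^ 2 ∂leb (Icc 0 T) := by
  rw [dualIntegrand, ← integral_leb_Ico]
  simp

section Duality

variable [IsProbabilityMeasure P]

/-- A strategy whose loss has a `Q`-integrable positive part is in `L²(dt ⊗ Q)`. -/
lemma memLp_prod_of_integrable_pnl (hT : 0 < T) (hW : IsExpBound P S W a) (hS : IsOptional 𝓕 S)
    (hψ : IsAdmissible P 𝓕 Φ₀ ψ) (hΛ : 0 < Λ) (hQ : FiniteEntropy P Q) {B : Ω → ℝ}
    (hB : Integrable B Q) (hB' : ∀ᵐ ω ∂Q, -pnl hT S Λ Φ₀ ψ ω ≤ B ω) :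
    MemLp (fun p : Icc (0 : ℝ) T × Ω ↦ ψ p.1 p.2) 2 ((leb (Icc 0 T)).prod Q) := by
  have := hQ.prob
  have hm := hψ.optional.measurable hT
  refine memLp_two_of_lintegral_sq hm.aestronglyMeasurable ?_
  rw [lintegral_prod_symm' _ (hm.pow_const 2).ennreal_ofReal]
  have hWi := hW.integrable hT hQ
  have hG : Integrable (fun ω ↦ 4 / Λ * (B ω + ((Φ₀ ^ 2 + W ω) / 2 + T * W ω / Λ))) Q :=
    ((hB.add ((((integrable_const _).add hWi).div_const 2).add
      ((hWi.const_mul T).div_const Λ)))).const_mul _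
  refine lt_of_le_of_lt (lintegral_mono_ae ?_) hG.lintegral_lt_top
  filter_upwards [hQ.ac.ae_le hψ.sq_integrable, hB'] with ω h1 h2
  rw [← ofReal_integral_eq_lintegral_ofReal h1 (ae_of_all _ fun _ ↦ sq_nonneg _)]
  refine ENNReal.ofReal_le_ofReal ?_
  have h3 := le_neg_pnl (Φ₀ := Φ₀) hT hW hS hψ.optional hΛ h1
  rw [div_mul_eq_mul_div, le_div_iff₀ hΛ]
  nlinarith

lemma integrable_pnl_of_exp (hT : 0 < T) (hW : IsExpBound P S W a) (hS : IsOptional 𝓕 S)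
    (hψ : IsAdmissible P 𝓕 Φ₀ ψ) (hΛ : 0 < Λ) (hα : 0 < α) (hQ : FiniteEntropy P Q)
    (h : Integrable (fun ω ↦ Real.exp (-α * pnl hT S Λ Φ₀ ψ ω)) P) :
    Integrable (fun ω ↦ pnl hT S Λ Φ₀ ψ ω) Q := by
  have := hQ.prob
  have hWi := hW.integrable hT hQ
  have hZ : Integrable (fun ω ↦ -α * ((Φ₀ ^ 2 + W ω) / 2 + T * W ω / Λ)) Q :=
    ((((integrable_const _).add hWi).div_const 2).add ((hWi.const_mul T).div_const Λ)).const_mul _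
  have h1 := hQ.integrable_of_exp h hZ (by
    filter_upwards [hQ.ac.ae_le hψ.sq_integrable] with ω hω
    have h3 := le_neg_pnl (Φ₀ := Φ₀) hT hW hS hψ.optional hΛ hω
    have h4 : 0 ≤ ∫ t, ψ t ω ^ 2 ∂leb (Icc 0 T) := integral_nonneg fun _ ↦ sq_nonneg _
    have h5 : 0 ≤ Λ / 4 * ∫ t, ψ t ω ^ 2 ∂leb (Icc 0 T) := by positivity
    nlinarith)
  refine (h1.const_mul (-α⁻¹)).congr (ae_of_all _ fun ω ↦ ?_)
  field_simp

lemma integral_pnl (hT : 0 < T) (hW : IsExpBound P S W a) (hS : IsOptional 𝓕 S)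
    (hQ : FiniteEntropy P Q)
    (hψ2 : MemLp (fun p : Icc (0 : ℝ) T × Ω ↦ ψ p.1 p.2) 2 ((leb (Icc 0 T)).prod Q)) :
    ∫ ω, pnl hT S Λ Φ₀ ψ ω ∂Q = -Φ₀ * ∫ ω, S (zeroIcc hT) ω ∂Q
      - ∫ p, ψ p.1 p.2 * S p.1 p.2 ∂((leb (Icc 0 T)).prod Q)
      - Λ / 2 * ∫ p, ψ p.1 p.2 ^ 2 ∂((leb (Icc 0 T)).prod Q) := by
  have := hQ.prob
  have hi : Integrable (fun p : Icc (0 : ℝ) T × Ω ↦ ψ p.1 p.2 * S p.1 p.2)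
    ((leb (Icc 0 T)).prod Q) := hψ2.integrable_mul (hW.memLp_prod hT hS hQ)
  have h0 : Integrable (fun ω ↦ -Φ₀ * S (zeroIcc hT) ω) Q :=
    ((hW.memLp hT hS hQ _).integrable one_le_two).const_mul _
  have h1 : Integrable (fun ω ↦ ∫ t, ψ t ω * S t ω ∂leb (Icc 0 T)) Q := hi.integral_prod_right
  have h2 : Integrable (fun ω ↦ Λ / 2 * ∫ t, ψ t ω ^ 2 ∂leb (Icc 0 T)) Q :=
    hψ2.integrable_sq.integral_prod_right.const_mul _
  have h3 : Integrable (fun ω ↦ -Φ₀ * S (zeroIcc hT) ω - ∫ t, ψ t ω * S t ω ∂leb (Icc 0 T)) Q :=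
    h0.sub h1
  unfold pnl
  rw [integral_sub h3 h2, integral_sub h0 h1, integral_const_mul, integral_const_mul,
    integral_prod_symm _ hi, integral_prod_symm _ hψ2.integrable_sq]

variable {M : Ico (0 : ℝ) T → Ω → ℝ}

lemma memLp_sub_prod (hT : 0 < T) (hW : IsExpBound P S W a) (hS : IsOptional 𝓕 S)
    (hQ : FiniteEntropy P Q) (hM : IsDualMartingale 𝓕 Q M) :
    MemLp (fun p : Icc (0 : ℝ) T × Ω ↦ extendZero M p.1 p.2 - S p.1 p.2) 2
      ((leb (Icc 0 T)).prod Q) :=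
  have := hQ.prob
  (hM.memLp_prod hT).sub (hW.memLp_prod hT hS hQ)

lemma integrable_dual_parts (hT : 0 < T) (hW : IsExpBound P S W a) (hS : IsOptional 𝓕 S)
    (hQ : FiniteEntropy P Q) (hM : IsDualMartingale 𝓕 Q M) :
    Integrable (fun ω ↦ 1 / α * llr Q P ω + Φ₀ * (M (zeroIco hT) ω - S (zeroIcc hT) ω)) Q ∧
    Integrable (fun ω ↦ 1 / (2 * Λ) * ∫ t, (extendZero M t ω - S t ω) ^ 2 ∂leb (Icc 0 T)) Q := by
  have := hQ.prob
  exact ⟨(hQ.entropy.const_mul _).add (((hM.martingale.integrable _).sub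
      ((hW.memLp hT hS hQ _).integrable one_le_two)).const_mul _),
    (memLp_sub_prod hT hW hS hQ hM).integrable_sq.integral_prod_right.const_mul _⟩

lemma integrable_dualIntegrand (hT : 0 < T) (hW : IsExpBound P S W a) (hS : IsOptional 𝓕 S)
    (hQ : FiniteEntropy P Q) (hM : IsDualMartingale 𝓕 Q M) :
    Integrable (dualIntegrand P hT S Λ α Φ₀ Q M) Q := by
  obtain ⟨h1, h2⟩ := integrable_dual_parts (α := α) (Λ := Λ) (Φ₀ := Φ₀) hT hW hS hQ hM
  refine (h1.add h2).congr (ae_of_all _ fun ω ↦ ?_)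
  rw [dualIntegrand_eq]
  rfl

lemma integrable_sq_sub_Ico (hT : 0 < T) (hW : IsExpBound P S W a) (hS : IsOptional 𝓕 S)
    (hQ : FiniteEntropy P Q) (hM : IsDualMartingale 𝓕 Q M) :
    Integrable (fun p : Ico (0 : ℝ) T × Ω ↦ |M p.1 p.2 - S (toIcc p.1) p.2| ^ 2)
      ((leb (Ico 0 T)).prod Q) := by
  have := hQ.prob
  have h := (memLp_sub_prod hT hW hS hQ hM).integrable_sq
  have hp := (measurePreserving_toIcc (T := T)).prod (MeasurePreserving.id Q)
  refine ((hp.integrable_comp h.1).2 h).congr (ae_of_all _ fun p ↦ ?_)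
  simp

lemma dualObjective_eq (hT : 0 < T) (hW : IsExpBound P S W a) (hS : IsOptional 𝓕 S)
    (hQ : FiniteEntropy P Q) (hM : IsDualMartingale 𝓕 Q M) :
    dualObjective P hT S Λ α Φ₀ Q M = 1 / α * ∫ ω, llr Q P ω ∂Q
      + Φ₀ * (∫ ω, M (zeroIco hT) ω ∂Q - ∫ ω, S (zeroIcc hT) ω ∂Q)
      + 1 / (2 * Λ) * ∫ p, (extendZero M p.1 p.2 - S p.1 p.2) ^ 2 ∂((leb (Icc 0 T)).prod Q) := by
  have := hQ.prob
  obtain ⟨h1, h2⟩ := integrable_dual_parts (α := α) (Λ := Λ) (Φ₀ := Φ₀) hT hW hS hQ hM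
  have hM0 := hM.martingale.integrable (zeroIco hT)
  have hS0 := (hW.memLp hT hS hQ (zeroIcc hT)).integrable one_le_two
  have h3 : Integrable (fun ω ↦ Φ₀ * (M (zeroIco hT) ω - S (zeroIcc hT) ω)) Q :=
    (hM0.sub hS0).const_mul _
  rw [dualObjective]
  simp_rw [dualIntegrand_eq]
  rw [integral_add h1 h2, integral_add (hQ.entropy.const_mul _) h3, integral_const_mul,
    integral_const_mul, integral_const_mul, integral_sub hM0 hS0,
    integral_prod_symm _ (memLp_sub_prod hT hW hS hQ hM).integrable_sq]

/-- The duality gap: the dual functional exceeds the value `E_Q[V_T] + H(Q | P) / α` of a strategy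
by the squared distance of `M` to `S + Λ ψ`. -/
lemma dualObjective_eq_add_gap (hT : 0 < T) (hW : IsExpBound P S W a) (hS : IsOptional 𝓕 S)
    (hQ : FiniteEntropy P Q) (hM : IsDualMartingale 𝓕 Q M) (hΛ : 0 < Λ)
    (hψ : IsAdmissible P 𝓕 Φ₀ ψ)
    (hψ2 : MemLp (fun p : Icc (0 : ℝ) T × Ω ↦ ψ p.1 p.2) 2 ((leb (Icc 0 T)).prod Q)) :
    dualObjective P hT S Λ α Φ₀ Q M = 1 / α * ∫ ω, llr Q P ω ∂Q + ∫ ω, pnl hT S Λ Φ₀ ψ ω ∂Q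
      + 1 / (2 * Λ) * ∫ p, (extendZero M p.1 p.2 - S p.1 p.2 - Λ * ψ p.1 p.2) ^ 2
        ∂((leb (Icc 0 T)).prod Q) := by
  have := hQ.prob
  have hS2 := hW.memLp_prod hT hS hQ
  have hM2 := hM.memLp_prod hT
  have hd := (memLp_sub_prod hT hW hS hQ hM).integrable_sq
  have hψM : Integrable (fun p : Icc (0 : ℝ) T × Ω ↦ ψ p.1 p.2 * extendZero M p.1 p.2)
    ((leb (Icc 0 T)).prod Q) := hψ2.integrable_mul hM2
  have hψS : Integrable (fun p : Icc (0 : ℝ) T × Ω ↦ ψ p.1 p.2 * S p.1 p.2)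
    ((leb (Icc 0 T)).prod Q) := hψ2.integrable_mul hS2
  have hpair := hM.integral_mul_eq hT hψ.optional hψ2 (c := Φ₀) (by
    filter_upwards [hQ.ac.ae_le hψ.liquidation] with ω hω
    linarith)
  have e : ∀ p : Icc (0 : ℝ) T × Ω, (extendZero M p.1 p.2 - S p.1 p.2 - Λ * ψ p.1 p.2) ^ 2
      = (extendZero M p.1 p.2 - S p.1 p.2) ^ 2 - 2 * Λ * (ψ p.1 p.2 * extendZero M p.1 p.2)
        + 2 * Λ * (ψ p.1 p.2 * S p.1 p.2) + Λ ^ 2 * ψ p.1 p.2 ^ 2 := fun p ↦ by ring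
  have i1 : Integrable (fun p : Icc (0 : ℝ) T × Ω ↦ (extendZero M p.1 p.2 - S p.1 p.2) ^ 2
      - 2 * Λ * (ψ p.1 p.2 * extendZero M p.1 p.2)) ((leb (Icc 0 T)).prod Q) :=
    hd.sub (hψM.const_mul _)
  have i2 : Integrable (fun p : Icc (0 : ℝ) T × Ω ↦ (extendZero M p.1 p.2 - S p.1 p.2) ^ 2
      - 2 * Λ * (ψ p.1 p.2 * extendZero M p.1 p.2) + 2 * Λ * (ψ p.1 p.2 * S p.1 p.2))
      ((leb (Icc 0 T)).prod Q) := i1.add (hψS.const_mul _)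
  rw [dualObjective_eq hT hW hS hQ hM, integral_pnl hT hW hS hQ hψ2]
  simp_rw [e]
  rw [integral_add i2 (hψ2.integrable_sq.const_mul _), integral_add i1 (hψS.const_mul _),
    integral_sub hd (hψM.const_mul _), integral_const_mul, integral_const_mul, integral_const_mul,
    hpair]
  field_simp
  ring

/-- Weak duality, with the part of the duality gap that comes from `M ≠ S + Λ ψ`. -/
lemma weak_duality (hT : 0 < T) (hW : IsExpBound P S W a) (hS : IsOptional 𝓕 S)
    (hQ : FiniteEntropy P Q) (hM : IsDualMartingale 𝓕 Q M) (hΛ : 0 < Λ) (hα : 0 < α)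
    (hψ : IsAdmissible P 𝓕 Φ₀ ψ)
    (h : Integrable (fun ω ↦ Real.exp (-α * pnl hT S Λ Φ₀ ψ ω)) P) :
    -(1 / α) * Real.log (∫ ω, Real.exp (-α * pnl hT S Λ Φ₀ ψ ω) ∂P)
      + 1 / (2 * Λ) * ∫ p, (extendZero M p.1 p.2 - S p.1 p.2 - Λ * ψ p.1 p.2) ^ 2
        ∂((leb (Icc 0 T)).prod Q) ≤ dualObjective P hT S Λ α Φ₀ Q M := by
  have hi := integrable_pnl_of_exp hT hW hS hψ hΛ hα hQ h
  have hψ2 := memLp_prod_of_integrable_pnl hT hW hS hψ hΛ hQ hi.neg (ae_of_all _ fun _ ↦ le_rfl)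
  rw [dualObjective_eq_add_gap hT hW hS hQ hM hΛ hψ hψ2]
  have h1 := hQ.integral_le h (hi.const_mul (-α))
  rw [integral_const_mul] at h1
  have h2 : 1 / α * (-α * ∫ ω, pnl hT S Λ Φ₀ ψ ω ∂Q) = -∫ ω, pnl hT S Λ Φ₀ ψ ω ∂Q := by
    field_simp
  have h3 := mul_le_mul_of_nonneg_left h1 (by positivity : 0 ≤ 1 / α)
  rw [h2] at h3
  linarith

lemma certaintyEquivalent_le_dualObjective (hT : 0 < T) (hW : IsExpBound P S W a)
    (hS : IsOptional 𝓕 S) (hQ : FiniteEntropy P Q) (hM : IsDualMartingale 𝓕 Q M) (hΛ : 0 < Λ)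
    (hα : 0 < α) (hψ : IsAdmissible P 𝓕 Φ₀ ψ) :
    certaintyEquivalent P hT S Λ α Φ₀ ψ ≤ ((dualObjective P hT S Λ α Φ₀ Q M : ℝ) : EReal) := by
  by_cases htop : expLoss P hT S Λ α Φ₀ ψ = ⊤
  · rw [certaintyEquivalent_of_top hT hα htop]
    exact bot_le
  · have h := integrable_exp_of_expLoss hT hS hψ.optional htop
    rw [certaintyEquivalent_eq hT h, EReal.coe_le_coe_iff]
    have h1 := weak_duality hT hW hS hQ hM hΛ hα hψ h
    have h2 : 0 ≤ 1 / (2 * Λ) * ∫ p, (extendZero M p.1 p.2 - S p.1 p.2 - Λ * ψ p.1 p.2) ^ 2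
        ∂((leb (Icc 0 T)).prod Q) :=
      mul_nonneg (by positivity) (integral_nonneg fun _ ↦ sq_nonneg _)
    linarith

end Duality

end AlmgrenChriss

namespace AlmgrenChriss

/-! ### Existence and uniqueness of the optimal strategy -/

section PathLimit

variable {τ : Type*} {mτ : MeasurableSpace τ} {μ : Measure τ}

lemma summable_of_summable_sq {x : ℕ → ℝ}
    (h : Summable fun n ↦ 2 ^ n * (x (n + 1) - x n) ^ 2) :
    (∃ l, Tendsto x atTop (𝓝 l)) ∧
      ∀ n, x n ^ 2 ≤ 2 * x 0 ^ 2 + 4 * ∑' n, 2 ^ n * (x (n + 1) - x n) ^ 2 := by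
  constructor
  · have h1 : Summable fun n ↦ x (n + 1) - x n := by
      refine Summable.of_norm_bounded (g := fun n ↦ (1 / 2 : ℝ) ^ n
        + 2 ^ n * (x (n + 1) - x n) ^ 2) (summable_geometric_two.add h) fun n ↦ ?_
      rw [Real.norm_eq_abs]
      have h2 : (1 / 2 : ℝ) ^ n * 2 ^ n = 1 := by rw [← mul_pow]; norm_num
      have h3 : (0 : ℝ) < 2 ^ n := by positivity
      have h4 : (0 : ℝ) < (1 / 2) ^ n := by positivity
      set u := |x (n + 1) - x n| with hu
      rw [← sq_abs, ← hu]
      have h5 : 0 ≤ u := abs_nonneg _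
      nlinarith [mul_nonneg h3.le (sq_nonneg (u - (1 / 2) ^ n))]
    obtain ⟨l, hl⟩ := h1
    refine ⟨x 0 + l, ?_⟩
    have h2 := (hl.tendsto_sum_nat).const_add (x 0)
    refine h2.congr fun n ↦ ?_
    rw [Finset.sum_range_sub]; ring
  · intro n
    have h1 : (x n - x 0) ^ 2 ≤ 2 * ∑' n, 2 ^ n * (x (n + 1) - x n) ^ 2 := by
      rw [← Finset.sum_range_sub]
      refine (Finset.sum_sq_le_sum_mul_sum_of_sq_le_mul (Finset.range n)
        (f := fun k ↦ (1 / 2 : ℝ) ^ k) (g := fun k ↦ 2 ^ k * (x (k + 1) - x k) ^ 2)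
        (fun k _ ↦ by positivity) (fun k _ ↦ by positivity) fun k _ ↦ ?_).trans ?_
      · have h2 : (1 / 2 : ℝ) ^ k * 2 ^ k = 1 := by rw [← mul_pow]; norm_num
        exact le_of_eq (by rw [← mul_assoc, h2, one_mul])
      · refine mul_le_mul ?_ (h.sum_le_tsum _ fun k _ ↦ by positivity)
          (Finset.sum_nonneg fun k _ ↦ by positivity) (by norm_num)
        exact (summable_geometric_two.sum_le_tsum _ fun k _ ↦ by positivity).trans
          tsum_geometric_two.le
    nlinarith [sq_nonneg (x n - 2 * x 0)]

/-- A sequence in `L²` with rapidly decreasing increments converges a.e., and together with its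
squares it is dominated. -/
lemma exists_dominating_of_summable {f : ℕ → τ → ℝ} (hf : ∀ n, MemLp (f n) 2 μ)
    (h : Summable fun n ↦ 2 ^ n * ∫ t, (f (n + 1) t - f n t) ^ 2 ∂μ) :
    (∀ᵐ t ∂μ, ∃ l, Tendsto (fun n ↦ f n t) atTop (𝓝 l)) ∧
      ∃ G : τ → ℝ, Integrable G μ ∧ ∀ᵐ t ∂μ, ∀ n, f n t ^ 2 ≤ G t := by
  have hd : ∀ n, Integrable (fun t ↦ (2 : ℝ) ^ n * (f (n + 1) t - f n t) ^ 2) μ := fun n ↦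
    ((hf (n + 1)).sub (hf n)).integrable_sq.const_mul _
  have hae : ∀ n, AEMeasurable (fun t ↦ ENNReal.ofReal (2 ^ n * (f (n + 1) t - f n t) ^ 2)) μ :=
    fun n ↦ (hd n).1.aemeasurable.ennreal_ofReal
  have hfin : ∫⁻ t, ∑' n, ENNReal.ofReal (2 ^ n * (f (n + 1) t - f n t) ^ 2) ∂μ ≠ ⊤ := by
    rw [lintegral_tsum hae]
    have : ∀ n, ∫⁻ t, ENNReal.ofReal (2 ^ n * (f (n + 1) t - f n t) ^ 2) ∂μ
        = ENNReal.ofReal (2 ^ n * ∫ t, (f (n + 1) t - f n t) ^ 2 ∂μ) := fun n ↦ by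
      rw [← integral_const_mul, ofReal_integral_eq_lintegral_ofReal (hd n)
        (ae_of_all _ fun t ↦ by positivity)]
    simp_rw [this]
    exact h.tsum_ofReal_ne_top
  have hGm : AEMeasurable (fun t ↦ ∑' n, ENNReal.ofReal (2 ^ n * (f (n + 1) t - f n t) ^ 2)) μ :=
    AEMeasurable.tsum hae
  have hlt := ae_lt_top' hGm hfin
  have hsum : ∀ t, ∑' n, ENNReal.ofReal (2 ^ n * (f (n + 1) t - f n t) ^ 2) < ⊤ →
      Summable fun n ↦ (2 : ℝ) ^ n * (f (n + 1) t - f n t) ^ 2 := fun t ht ↦ by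
    have := ENNReal.summable_toReal ht.ne
    refine this.congr fun n ↦ ?_
    rw [ENNReal.toReal_ofReal (by positivity)]
  have hG : Integrable (fun t ↦ 2 * f 0 t ^ 2
      + 4 * (∑' n, ENNReal.ofReal (2 ^ n * (f (n + 1) t - f n t) ^ 2)).toReal) μ :=
    ((hf 0).integrable_sq.const_mul 2).add
      ((integrable_toReal_of_lintegral_ne_top hGm hfin).const_mul 4)
  refine ⟨?_, _, hG, ?_⟩
  · filter_upwards [hlt] with t ht using
      (summable_of_summable_sq (x := fun n ↦ f n t) (hsum t ht)).1
  · filter_upwards [hlt] with t ht n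
    refine ((summable_of_summable_sq (x := fun n ↦ f n t) (hsum t ht)).2 n).trans_eq ?_
    rw [ENNReal.tsum_toReal_eq (fun n ↦ ENNReal.ofReal_ne_top)]
    congr 2
    refine tsum_congr fun n ↦ ?_
    rw [ENNReal.toReal_ofReal (by positivity)]

lemma tendsto_integral_mul_of_dominated [IsFiniteMeasure μ] {f : ℕ → τ → ℝ} {F G : τ → ℝ}
    (hf : ∀ n, AEStronglyMeasurable (f n) μ) (hG : Integrable G μ)
    (hGf : ∀ᵐ t ∂μ, ∀ n, f n t ^ 2 ≤ G t) (hF : ∀ᵐ t ∂μ, Tendsto (fun n ↦ f n t) atTop (𝓝 (F t))) :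
    Integrable (fun t ↦ F t ^ 2) μ ∧
    Tendsto (fun n ↦ ∫ t, f n t ^ 2 ∂μ) atTop (𝓝 (∫ t, F t ^ 2 ∂μ)) ∧
    ∀ s : τ → ℝ, MemLp s 2 μ →
      Tendsto (fun n ↦ ∫ t, f n t * s t ∂μ) atTop (𝓝 (∫ t, F t * s t ∂μ)) := by
  have hFm : AEStronglyMeasurable F μ := aestronglyMeasurable_of_tendsto_ae atTop hf hF
  refine ⟨hG.mono' (hFm.pow 2) ?_, tendsto_integral_of_dominated_convergence G
    (fun n ↦ (hf n).pow 2) hG (fun n ↦ ?_) ?_, fun s hs ↦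
    tendsto_integral_of_dominated_convergence (fun t ↦ G t + s t ^ 2)
    (fun n ↦ (hf n).mul hs.1) (hG.add hs.integrable_sq) (fun n ↦ ?_) ?_⟩
  · filter_upwards [hGf, hF] with t h1 h2
    rw [Real.norm_eq_abs, abs_of_nonneg (sq_nonneg _)]
    exact le_of_tendsto' (h2.pow 2) h1
  · filter_upwards [hGf] with t h1
    rw [Real.norm_eq_abs, abs_of_nonneg (sq_nonneg _)]
    exact h1 n
  · filter_upwards [hF] with t h2 using h2.pow 2
  · filter_upwards [hGf] with t h1
    rw [Real.norm_eq_abs, abs_le]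
    constructor <;> nlinarith [h1 n, sq_nonneg (f n t + s t), sq_nonneg (f n t - s t)]
  · filter_upwards [hF] with t h2 using h2.mul_const _

/-- If `4ⁿ (1 - exp (- κ bₙ))` is bounded then `2ⁿ bₙ` is summable. -/
lemma summable_of_one_sub_exp_le {b : ℕ → ℝ} (hb : ∀ n, 0 ≤ b n) {κ C : ℝ} (hκ : 0 < κ)
    (h : ∀ n, 4 ^ n * (1 - Real.exp (-(κ * b n))) ≤ C) : Summable fun n ↦ 2 ^ n * b n := by
  have hlim : Tendsto (fun n : ℕ ↦ C * (1 / 4 : ℝ) ^ n) atTop (𝓝 (C * 0)) :=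
    (tendsto_pow_atTop_nhds_zero_of_lt_one (by norm_num) (by norm_num)).const_mul C
  rw [mul_zero] at hlim
  refine Summable.of_norm_bounded_eventually_nat (g := fun n ↦ 2 * C / κ * (1 / 2 : ℝ) ^ n)
    (summable_geometric_two.mul_left _) ?_
  filter_upwards [hlim.eventually (eventually_le_nhds (show (0 : ℝ) < 1 / 2 by norm_num))] with n hn
  have h4 : (1 / 4 : ℝ) ^ n * 4 ^ n = 1 := by rw [← mul_pow]; norm_num
  have h2 : (2 : ℝ) ^ n * (1 / 4) ^ n = (1 / 2) ^ n := by rw [← mul_pow]; norm_num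
  have hq : 0 < (1 / 4 : ℝ) ^ n := by positivity
  set ε := C * (1 / 4 : ℝ) ^ n with hε
  have hx0 : 0 ≤ κ * b n := mul_nonneg hκ.le (hb n)
  have h1 : 1 - Real.exp (-(κ * b n)) ≤ ε := by
    have := mul_le_mul_of_nonneg_left (h n) hq.le
    rw [← mul_assoc, h4, one_mul] at this
    linarith [mul_comm C ((1 / 4 : ℝ) ^ n)]
  have h3 : Real.exp (-(κ * b n)) * (1 + κ * b n) ≤ 1 := by
    have h5 := Real.add_one_le_exp (κ * b n)
    calc Real.exp (-(κ * b n)) * (1 + κ * b n)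
        ≤ Real.exp (-(κ * b n)) * Real.exp (κ * b n) := by gcongr; linarith
      _ = 1 := by rw [← Real.exp_add]; simp
  have h6 : κ * b n ≤ 2 * ε := by nlinarith
  have h7 : b n ≤ 2 * ε / κ := by rw [le_div_iff₀ hκ]; linarith
  rw [Real.norm_eq_abs, abs_of_nonneg (mul_nonneg (by positivity) (hb n))]
  calc 2 ^ n * b n ≤ 2 ^ n * (2 * ε / κ) := by gcongr
    _ = 2 * C / κ * (2 ^ n * (1 / 4) ^ n) := by rw [hε]; ring
    _ = _ := by rw [h2]

end PathLimit

variable {Ω : Type*} {m : MeasurableSpace Ω} {T : ℝ} {P Q : Measure Ω}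
  {𝓕 : Filtration (Icc (0 : ℝ) T) m} {S φ ψ : Icc (0 : ℝ) T → Ω → ℝ} {W : Ω → ℝ} {a : ℝ}
  {Λ α Φ₀ : ℝ}

lemma IsAdmissible.memLp_path (hT : 0 < T) (hφ : IsAdmissible P 𝓕 Φ₀ φ) :
    ∀ᵐ ω ∂P, MemLp (fun t ↦ φ t ω) 2 (leb (Icc 0 T)) := by
  filter_upwards [hφ.sq_integrable] with ω h using hφ.optional.memLp_path hT h

lemma IsAdmissible.midpoint (hT : 0 < T) (hφ : IsAdmissible P 𝓕 Φ₀ φ)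
    (hψ : IsAdmissible P 𝓕 Φ₀ ψ) :
    IsAdmissible P 𝓕 Φ₀ fun t ω ↦ 2⁻¹ * (φ t ω + ψ t ω) := by
  refine ⟨(hφ.optional.add hψ.optional).const_mul _, ?_, ?_⟩
  · filter_upwards [hφ.memLp_path hT, hψ.memLp_path hT] with ω h1 h2
    exact ((h1.add h2).const_mul (2⁻¹ : ℝ)).integrable_sq
  · filter_upwards [hφ.memLp_path hT, hψ.memLp_path hT, hφ.liquidation, hψ.liquidation]
      with ω h1 h2 h3 h4
    rw [integral_const_mul, integral_add (h1.integrable one_le_two) (h2.integrable one_le_two)]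
    linarith

lemma isAdmissible_const (hT : 0 < T) : IsAdmissible P 𝓕 Φ₀ fun _ _ ↦ -Φ₀ / T := by
  refine ⟨IsOptional.const _, ae_of_all _ fun ω ↦ integrable_const _, ae_of_all _ fun ω ↦ ?_⟩
  rw [integral_const, leb_real_univ hT, smul_eq_mul]
  field_simp
  ring

/-- The losses of a bounded strategy grow at most linearly in `sup |S|`. -/
lemma abs_pnl_le (hT : 0 < T) (hW : IsExpBound P S W a) (hΛ : 0 < Λ) {K : ℝ}
    (hK : ∀ t ω, |ψ t ω| ≤ K) (ω : Ω) :
    |pnl hT S Λ Φ₀ ψ ω| ≤ (|Φ₀| + K * T + Λ / 2 * (K ^ 2 * T)) * (1 + √(W ω)) := by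
  have hK0 : 0 ≤ K := (abs_nonneg _).trans (hK (zeroIcc hT) ω)
  have hSW : ∀ t, |S t ω| ≤ √(W ω) := fun t ↦ Real.abs_le_sqrt (hW.sq_le t ω)
  have h1 : |∫ t, ψ t ω * S t ω ∂leb (Icc 0 T)| ≤ K * √(W ω) * T := by
    have := norm_integral_le_of_norm_le_const (μ := leb (Icc (0 : ℝ) T)) (C := K * √(W ω))
      (f := fun t ↦ ψ t ω * S t ω) (ae_of_all _ fun t ↦ by
        rw [Real.norm_eq_abs, abs_mul]
        exact mul_le_mul (hK t ω) (hSW t) (abs_nonneg _) hK0)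
    rwa [leb_real_univ hT, Real.norm_eq_abs] at this
  have h2 : |∫ t, ψ t ω ^ 2 ∂leb (Icc 0 T)| ≤ K ^ 2 * T := by
    have := norm_integral_le_of_norm_le_const (μ := leb (Icc (0 : ℝ) T)) (C := K ^ 2)
      (f := fun t ↦ ψ t ω ^ 2) (ae_of_all _ fun t ↦ by
        rw [Real.norm_eq_abs, abs_pow]
        exact pow_le_pow_left₀ (abs_nonneg _) (hK t ω) 2)
    rwa [leb_real_univ hT, Real.norm_eq_abs] at this
  have h3 : |Φ₀ * S (zeroIcc hT) ω| ≤ |Φ₀| * √(W ω) := by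
    rw [abs_mul]; gcongr; exact hSW _
  have h0 := Real.sqrt_nonneg (W ω)
  have h4 : |Λ / 2 * ∫ t, ψ t ω ^ 2 ∂leb (Icc 0 T)| ≤ Λ / 2 * (K ^ 2 * T) := by
    rw [abs_mul, abs_of_pos (half_pos hΛ)]; gcongr
  have e : pnl hT S Λ Φ₀ ψ ω = -(Φ₀ * S (zeroIcc hT) ω) - (∫ t, ψ t ω * S t ω ∂leb (Icc 0 T))
      - Λ / 2 * ∫ t, ψ t ω ^ 2 ∂leb (Icc 0 T) := by rw [pnl]; ring
  have h5 : |pnl hT S Λ Φ₀ ψ ω| ≤ |Φ₀| * √(W ω) + K * √(W ω) * T + Λ / 2 * (K ^ 2 * T) := by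
    rw [e]
    refine (abs_sub _ _).trans (add_le_add ((abs_sub _ _).trans (add_le_add ?_ h1)) h4)
    rwa [abs_neg]
  have h6 : 0 ≤ |Φ₀| := abs_nonneg _
  have h7 : 0 ≤ Λ / 2 * (K ^ 2 * T) * √(W ω) := by positivity
  have h8 : 0 ≤ K * T := by positivity
  nlinarith

lemma integrable_exp_pnl_of_bounded [IsProbabilityMeasure P] (hT : 0 < T)
    (hW : IsExpBound P S W a) (hS : IsOptional 𝓕 S) (hΛ : 0 < Λ) (hψ : IsOptional 𝓕 ψ) {K : ℝ}
    (hK : ∀ t ω, |ψ t ω| ≤ K) (c : ℝ) :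
    Integrable (fun ω ↦ Real.exp (c * pnl hT S Λ Φ₀ ψ ω)) P := by
  refine hW.integrable_exp_of_le hT ((measurable_pnl hT hS hψ).const_mul c).aemeasurable
    (C := |c| * (|Φ₀| + K * T + Λ / 2 * (K ^ 2 * T))) (ae_of_all _ fun ω ↦ ?_)
  rw [abs_mul, mul_assoc]
  exact mul_le_mul_of_nonneg_left (abs_pnl_le hT hW hΛ hK ω) (abs_nonneg c)

/-- The lower bound, uniform in the strategy, for `exp (- α V_T)`. -/
noncomputable def expLossFloor (hT : 0 < T) (S : Icc (0 : ℝ) T → Ω → ℝ) (Λ α Φ₀ : ℝ) (ω : Ω) : ℝ :=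
  Real.exp (α * (Φ₀ * S (zeroIcc hT) ω - 1 / (2 * Λ) * ∫ t, S t ω ^ 2 ∂leb (Icc 0 T)))

lemma expLossFloor_le (hT : 0 < T) (hΛ : 0 < Λ) (hα : 0 < α) {ω : Ω}
    (hS2 : MemLp (fun t ↦ S t ω) 2 (leb (Icc 0 T)))
    (hψ2 : MemLp (fun t ↦ ψ t ω) 2 (leb (Icc 0 T))) :
    expLossFloor hT S Λ α Φ₀ ω ≤ Real.exp (-α * pnl hT S Λ Φ₀ ψ ω) := by
  rw [expLossFloor, neg_mul, ← mul_neg]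
  refine Real.exp_le_exp.2 (mul_le_mul_of_nonneg_left ?_ hα.le)
  have hi : Integrable (fun t ↦ ψ t ω * S t ω) (leb (Icc 0 T)) := hψ2.integrable_mul hS2
  have h1 : ∫ t, (-(1 / (2 * Λ)) * S t ω ^ 2 - Λ / 2 * ψ t ω ^ 2) ∂leb (Icc 0 T)
      ≤ ∫ t, ψ t ω * S t ω ∂leb (Icc 0 T) := by
    refine integral_mono ((hS2.integrable_sq.const_mul _).sub (hψ2.integrable_sq.const_mul _)) hi
      fun t ↦ ?_
    have h4 : ψ t ω * S t ω - (-(1 / (2 * Λ)) * S t ω ^ 2 - Λ / 2 * ψ t ω ^ 2)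
        = (Λ * ψ t ω + S t ω) ^ 2 / (2 * Λ) := by
      field_simp; ring
    have h5 : 0 ≤ (Λ * ψ t ω + S t ω) ^ 2 / (2 * Λ) := by positivity
    simp only
    linarith
  rw [integral_sub (hS2.integrable_sq.const_mul _) (hψ2.integrable_sq.const_mul _),
    integral_const_mul, integral_const_mul] at h1
  rw [pnl]
  linarith

lemma neg_pnl_midpoint (hT : 0 < T) {ω : Ω}
    (hS2 : MemLp (fun t ↦ S t ω) 2 (leb (Icc 0 T)))
    (hφ2 : MemLp (fun t ↦ φ t ω) 2 (leb (Icc 0 T)))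
    (hψ2 : MemLp (fun t ↦ ψ t ω) 2 (leb (Icc 0 T))) :
    pnl hT S Λ Φ₀ (fun t ω ↦ 2⁻¹ * (φ t ω + ψ t ω)) ω
      = (pnl hT S Λ Φ₀ φ ω + pnl hT S Λ Φ₀ ψ ω) / 2
        + Λ / 8 * ∫ t, (φ t ω - ψ t ω) ^ 2 ∂leb (Icc 0 T) := by
  have h1 : Integrable (fun t ↦ φ t ω * S t ω) (leb (Icc 0 T)) := hφ2.integrable_mul hS2
  have h2 : Integrable (fun t ↦ ψ t ω * S t ω) (leb (Icc 0 T)) := hψ2.integrable_mul hS2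
  have h3 : Integrable (fun t ↦ φ t ω * ψ t ω) (leb (Icc 0 T)) := hφ2.integrable_mul hψ2
  have q1 := hφ2.integrable_sq
  have q2 := hψ2.integrable_sq
  have q3 : Integrable (fun t ↦ φ t ω ^ 2 + ψ t ω ^ 2) (leb (Icc 0 T)) := q1.add q2
  have e1 : ∫ t, 2⁻¹ * (φ t ω + ψ t ω) * S t ω ∂leb (Icc 0 T)
      = 2⁻¹ * (∫ t, φ t ω * S t ω ∂leb (Icc 0 T) + ∫ t, ψ t ω * S t ω ∂leb (Icc 0 T)) := by
    rw [← integral_add h1 h2, ← integral_const_mul]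
    refine integral_congr_ae (ae_of_all _ fun t ↦ ?_)
    simp only; ring
  have e2 : ∫ t, (2⁻¹ * (φ t ω + ψ t ω)) ^ 2 ∂leb (Icc 0 T)
      = 4⁻¹ * (∫ t, φ t ω ^ 2 ∂leb (Icc 0 T) + ∫ t, ψ t ω ^ 2 ∂leb (Icc 0 T)
        + 2 * ∫ t, φ t ω * ψ t ω ∂leb (Icc 0 T)) := by
    rw [← integral_add q1 q2, ← integral_const_mul, ← integral_add q3 (h3.const_mul 2),
      ← integral_const_mul]
    refine integral_congr_ae (ae_of_all _ fun t ↦ ?_)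
    simp only; ring
  have e3 : ∫ t, (φ t ω - ψ t ω) ^ 2 ∂leb (Icc 0 T)
      = ∫ t, φ t ω ^ 2 ∂leb (Icc 0 T) + ∫ t, ψ t ω ^ 2 ∂leb (Icc 0 T)
        - 2 * ∫ t, φ t ω * ψ t ω ∂leb (Icc 0 T) := by
    rw [← integral_add q1 q2, ← integral_const_mul, ← integral_sub q3 (h3.const_mul 2)]
    refine integral_congr_ae (ae_of_all _ fun t ↦ ?_)
    simp only; ring
  simp only [pnl]
  rw [e1, e2, e3]
  ring

/-- The uniform convexity of the expected loss. The quadratic cost makes the loss of a midpoint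
smaller than the mean loss by a term that controls the distance of the two strategies in
probability. -/
lemma expLoss_midpoint_add_le [IsProbabilityMeasure P] (hT : 0 < T) (hW : IsExpBound P S W a)
    (hS : IsOptional 𝓕 S) (hΛ : 0 < Λ) (hα : 0 < α)
    (hφ : IsAdmissible P 𝓕 Φ₀ φ) (hψ : IsAdmissible P 𝓕 Φ₀ ψ) :
    2 * (∫⁻ ω, ENNReal.ofReal (expLossFloor hT S Λ α Φ₀ ω *
        (1 - Real.exp (-(α * Λ / 8 * ∫ t, (φ t ω - ψ t ω) ^ 2 ∂leb (Icc 0 T))))) ∂P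
      + expLoss P hT S Λ α Φ₀ (fun t ω ↦ 2⁻¹ * (φ t ω + ψ t ω)))
      ≤ expLoss P hT S Λ α Φ₀ φ + expLoss P hT S Λ α Φ₀ ψ := by
  have hm : ∀ {η : Icc (0 : ℝ) T → Ω → ℝ}, IsOptional 𝓕 η → Measurable fun ω ↦
      ENNReal.ofReal (Real.exp (-α * pnl hT S Λ Φ₀ η ω)) := fun h ↦
    ((measurable_pnl hT hS h).const_mul _).exp.ennreal_ofReal
  have hmid := (hφ.midpoint hT hψ).optional
  unfold expLoss
  rw [← lintegral_add_right _ (hm hmid), ← lintegral_add_right _ (hm hψ.optional),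
    ← lintegral_const_mul' _ _ (by simp)]
  refine lintegral_mono_ae ?_
  filter_upwards [hφ.memLp_path hT, hψ.memLp_path hT] with ω h1 h2
  have hS2 := hW.memLp_path hT hS ω
  have f1 := expLossFloor_le (Φ₀ := Φ₀) hT hΛ hα hS2 h1
  have f2 := expLossFloor_le (Φ₀ := Φ₀) hT hΛ hα hS2 h2
  have hf0 : 0 < expLossFloor hT S Λ α Φ₀ ω := Real.exp_pos _
  rw [neg_pnl_midpoint hT hS2 h1 h2]
  have hd : 0 ≤ ∫ t, (φ t ω - ψ t ω) ^ 2 ∂leb (Icc 0 T) := integral_nonneg fun _ ↦ sq_nonneg _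
  set d := ∫ t, (φ t ω - ψ t ω) ^ 2 ∂leb (Icc 0 T)
  set X := pnl hT S Λ Φ₀ φ ω
  set Y := pnl hT S Λ Φ₀ ψ ω
  have hq1 : Real.exp (-(α * Λ / 8 * d)) ≤ 1 := Real.exp_le_one_iff.2 (by
    have : 0 ≤ α * Λ / 8 * d := by positivity
    linarith)
  have e : Real.exp (-α * ((X + Y) / 2 + Λ / 8 * d))
      = Real.exp (-α * X / 2) * Real.exp (-α * Y / 2) * Real.exp (-(α * Λ / 8 * d)) := by
    rw [← Real.exp_add, ← Real.exp_add]; ring_nf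
  have eX : Real.exp (-α * X) = Real.exp (-α * X / 2) ^ 2 := by
    rw [← Real.exp_nat_mul]; ring_nf
  have eY : Real.exp (-α * Y) = Real.exp (-α * Y / 2) ^ 2 := by
    rw [← Real.exp_nat_mul]; ring_nf
  rw [← ENNReal.ofReal_add (mul_nonneg hf0.le (sub_nonneg.2 hq1)) (Real.exp_pos _).le,
    ← ENNReal.ofReal_add (Real.exp_pos _).le (Real.exp_pos _).le,
    show (2 : ENNReal) = ENNReal.ofReal 2 by simp, ← ENNReal.ofReal_mul (by norm_num)]
  refine ENNReal.ofReal_le_ofReal ?_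
  -- with `x² = e ^ (- α X)`, `y² = e ^ (- α Y)` and floor `w`, this is
  -- `2 (w (1 - q) + x y q) ≤ x² + y²`, a consequence of `w ≤ x²`, `w ≤ y²` and `0 ≤ q ≤ 1`
  rw [e]
  rw [eX] at f1 ⊢
  rw [eY] at f2 ⊢
  set x := Real.exp (-α * X / 2)
  set y := Real.exp (-α * Y / 2)
  set q := Real.exp (-(α * Λ / 8 * d))
  have hq0 : 0 < q := Real.exp_pos _
  nlinarith [mul_nonneg hq0.le (sq_nonneg (x - y)),
    mul_nonneg (sub_nonneg.2 hq1) (sub_nonneg.2 f1),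
    mul_nonneg (sub_nonneg.2 hq1) (sub_nonneg.2 f2)]

lemma measurable_integral_sq_sub (hT : 0 < T) (hφ : IsOptional 𝓕 φ) (hψ : IsOptional 𝓕 ψ) :
    Measurable fun ω ↦ ∫ t, (φ t ω - ψ t ω) ^ 2 ∂leb (Icc 0 T) := by
  simpa only [sq] using measurable_integral_path hT ((hφ.sub hψ).mul (hφ.sub hψ))

lemma measurable_expLossFloor (hT : 0 < T) (hS : IsOptional 𝓕 S) :
    Measurable (expLossFloor hT S Λ α Φ₀) := by
  have h0 : Measurable (S (zeroIcc hT)) := (hS.adapted _).mono (𝓕.le _) le_rfl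
  have h2 : Measurable fun ω ↦ ∫ t, S t ω ^ 2 ∂leb (Icc 0 T) := by
    simpa only [sq] using measurable_integral_path hT (hS.mul hS)
  exact (((h0.const_mul _).sub (h2.const_mul _)).const_mul _).exp

/-- Two strategies of minimal expected loss coincide. -/
lemma ae_eq_of_isMinimal [IsProbabilityMeasure P] (hT : 0 < T) (hW : IsExpBound P S W a)
    (hS : IsOptional 𝓕 S) (hΛ : 0 < Λ) (hα : 0 < α)
    (hφ : IsAdmissible P 𝓕 Φ₀ φ) (hψ : IsAdmissible P 𝓕 Φ₀ ψ)
    (hfin : expLoss P hT S Λ α Φ₀ φ ≠ ⊤)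
    (hφmin : ∀ η, IsAdmissible P 𝓕 Φ₀ η → expLoss P hT S Λ α Φ₀ φ ≤ expLoss P hT S Λ α Φ₀ η)
    (hψφ : expLoss P hT S Λ α Φ₀ ψ ≤ expLoss P hT S Λ α Φ₀ φ) :
    ∀ᵐ p ∂((leb (Icc 0 T)).prod P), φ p.1 p.2 = ψ p.1 p.2 := by
  have h := expLoss_midpoint_add_le hT hW hS hΛ hα hφ hψ
  have h1 := hφmin _ (hφ.midpoint hT hψ)
  have h0 : ∫⁻ ω, ENNReal.ofReal (expLossFloor hT S Λ α Φ₀ ω *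
        (1 - Real.exp (-(α * Λ / 8 * ∫ t, (φ t ω - ψ t ω) ^ 2 ∂leb (Icc 0 T))))) ∂P = 0 := by
    have h2 := (mul_le_mul_right (add_le_add_right h1 _) 2).trans
      (h.trans (add_le_add_right hψφ _))
    rw [← two_mul, ENNReal.mul_le_mul_iff_right (by simp) (by simp)] at h2
    refine le_antisymm ((ENNReal.add_le_add_iff_right hfin).1 (h2.trans_eq ?_)) bot_le
    rw [zero_add]
  have hmd := measurable_integral_sq_sub hT hφ.optional hψ.optional
  have hmg : Measurable fun ω ↦ ENNReal.ofReal (expLossFloor hT S Λ α Φ₀ ω *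
      (1 - Real.exp (-(α * Λ / 8 * ∫ t, (φ t ω - ψ t ω) ^ 2 ∂leb (Icc 0 T))))) :=
    ((measurable_expLossFloor hT hS).mul
      (measurable_const.sub ((hmd.const_mul _).neg.exp))).ennreal_ofReal
  rw [lintegral_eq_zero_iff hmg] at h0
  have hms : MeasurableSet {p : Icc (0 : ℝ) T × Ω | φ p.1 p.2 = ψ p.1 p.2} :=
    measurableSet_eq_fun (hφ.optional.measurable hT) (hψ.optional.measurable hT)
  change ∀ᵐ p ∂((leb (Icc 0 T)).prod P), p ∈ {p : Icc (0 : ℝ) T × Ω | φ p.1 p.2 = ψ p.1 p.2}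
  rw [Measure.ae_prod_mem_iff_ae_ae_mem hms]
  refine (Measure.ae_ae_comm hms).2 ?_
  filter_upwards [h0, hφ.memLp_path hT, hψ.memLp_path hT] with ω h0 h1 h2
  have hd0 : 0 ≤ ∫ t, (φ t ω - ψ t ω) ^ 2 ∂leb (Icc 0 T) := integral_nonneg fun _ ↦ sq_nonneg _
  have hd : ∫ t, (φ t ω - ψ t ω) ^ 2 ∂leb (Icc 0 T) = 0 := by
    refine le_antisymm ?_ hd0
    have h3 := ENNReal.ofReal_eq_zero.1 h0
    have h4 : 1 - Real.exp (-(α * Λ / 8 * ∫ t, (φ t ω - ψ t ω) ^ 2 ∂leb (Icc 0 T))) ≤ 0 :=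
      nonpos_of_mul_nonpos_right h3 (Real.exp_pos _)
    have h5 : 1 ≤ Real.exp (-(α * Λ / 8 * ∫ t, (φ t ω - ψ t ω) ^ 2 ∂leb (Icc 0 T))) := by linarith
    rw [Real.one_le_exp_iff] at h5
    have h6 : 0 < α * Λ / 8 := by positivity
    nlinarith
  have hd' := (integral_eq_zero_iff_of_nonneg (f := fun t ↦ (φ t ω - ψ t ω) ^ 2)
    (fun _ ↦ sq_nonneg _) (h1.sub h2).integrable_sq).1 hd
  filter_upwards [hd'] with t ht
  exact sub_eq_zero.1 (pow_eq_zero_iff two_ne_zero |>.1 ht)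

/-- The minimal expected loss is attained. By uniform convexity a minimizing sequence is Cauchy in
probability for the `L²(dt)`-distance; the rate `8⁻ⁿ` makes the sequence itself converge. -/
lemma exists_isMinimal [IsProbabilityMeasure P] (hT : 0 < T) (hW : IsExpBound P S W a)
    (hS : IsOptional 𝓕 S) (hΛ : 0 < Λ) (hα : 0 < α) :
    ∃ φ, IsAdmissible P 𝓕 Φ₀ φ ∧ expLoss P hT S Λ α Φ₀ φ ≠ ⊤ ∧
      ∀ η, IsAdmissible P 𝓕 Φ₀ η → expLoss P hT S Λ α Φ₀ φ ≤ expLoss P hT S Λ α Φ₀ η := by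
  set I : ENNReal := ⨅ η : {η // IsAdmissible P 𝓕 Φ₀ η}, expLoss P hT S Λ α Φ₀ η.1 with hI
  have hIle : ∀ η, IsAdmissible P 𝓕 Φ₀ η → I ≤ expLoss P hT S Λ α Φ₀ η := fun η hη ↦
    iInf_le (fun η : {η // IsAdmissible P 𝓕 Φ₀ η} ↦ expLoss P hT S Λ α Φ₀ η.1) ⟨η, hη⟩
  have hItop : I ≠ ⊤ := by
    refine ne_top_of_le_ne_top ?_ (hIle _ (isAdmissible_const hT))
    rw [expLoss_eq hT (integrable_exp_pnl_of_bounded hT hW hS hΛ (IsOptional.const (𝓕 := 𝓕) _)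
      (fun _ _ ↦ le_rfl) _)]
    exact ENNReal.ofReal_ne_top
  have hex : ∀ n : ℕ, ∃ η, IsAdmissible P 𝓕 Φ₀ η ∧
      expLoss P hT S Λ α Φ₀ η < I + ENNReal.ofReal ((1 / 8) ^ n) := fun n ↦ by
    have h1 : I < I + ENNReal.ofReal ((1 / 8) ^ n) :=
      ENNReal.lt_add_right hItop (ENNReal.ofReal_pos.2 (by positivity)).ne'
    obtain ⟨η, hη⟩ := iInf_lt_iff.1 h1
    exact ⟨η.1, η.2, hη⟩
  choose f hf hlt using hex
  -- the gain from averaging consecutive terms, of expectation at most `8⁻ⁿ`, so that `∑ 4ⁿ gₙ` is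
  -- almost surely finite
  let g : ℕ → Ω → ℝ := fun n ω ↦ expLossFloor hT S Λ α Φ₀ ω *
    (1 - Real.exp (-(α * Λ / 8 * ∫ t, (f (n + 1) t ω - f n t ω) ^ 2 ∂leb (Icc 0 T))))
  have hgm : ∀ n, Measurable (g n) := fun n ↦ (measurable_expLossFloor hT hS).mul
    (measurable_const.sub (((measurable_integral_sq_sub hT (hf (n + 1)).optional
      (hf n).optional).const_mul _).neg.exp))
  have hg : ∀ n, ∫⁻ ω, ENNReal.ofReal (g n ω) ∂P ≤ ENNReal.ofReal ((1 / 8) ^ n) := fun n ↦ by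
    have h1 := expLoss_midpoint_add_le hT hW hS hΛ hα (hf (n + 1)) (hf n)
    have h2 := hIle _ ((hf (n + 1)).midpoint hT (hf n))
    have h3 : expLoss P hT S Λ α Φ₀ (f (n + 1)) ≤ I + ENNReal.ofReal ((1 / 8) ^ n) :=
      (hlt (n + 1)).le.trans (add_le_add_right (ENNReal.ofReal_le_ofReal
        (pow_le_pow_of_le_one (by norm_num) (by norm_num) n.le_succ)) _)
    have h4 := (mul_le_mul_right (add_le_add_right h2 _) 2).trans
      (h1.trans (add_le_add h3 (hlt n).le))
    rw [← two_mul, ENNReal.mul_le_mul_iff_right (by simp) (by simp), add_comm I] at h4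
    exact (ENNReal.add_le_add_iff_right hItop).1 h4
  have hsumfin : ∫⁻ ω, ∑' n, ENNReal.ofReal (4 ^ n * g n ω) ∂P ≠ ⊤ := by
    rw [lintegral_tsum fun n ↦ ((hgm n).const_mul _).ennreal_ofReal.aemeasurable]
    refine ne_top_of_le_ne_top summable_geometric_two.tsum_ofReal_ne_top
      (ENNReal.tsum_le_tsum fun n ↦ ?_)
    simp_rw [ENNReal.ofReal_mul (show (0 : ℝ) ≤ 4 ^ n by positivity)]
    rw [lintegral_const_mul' _ _ ENNReal.ofReal_ne_top]
    refine (mul_le_mul_right (hg n) _).trans_eq ?_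
    rw [← ENNReal.ofReal_mul (by positivity), ← mul_pow]
    norm_num
  have hlt_top := ae_lt_top' (AEMeasurable.tsum fun n ↦
    ((hgm n).const_mul (4 ^ n)).ennreal_ofReal.aemeasurable (μ := P)) hsumfin
  have hpath : ∀ᵐ ω ∂P, ∀ n, MemLp (fun t ↦ f n t ω) 2 (leb (Icc 0 T)) :=
    ae_all_iff.2 fun n ↦ (hf n).memLp_path hT
  have hdom : ∀ᵐ ω ∂P, (∀ᵐ t ∂leb (Icc 0 T), ∃ l, Tendsto (fun n ↦ f n t ω) atTop (𝓝 l)) ∧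
      ∃ G : Icc (0 : ℝ) T → ℝ, Integrable G (leb (Icc 0 T)) ∧
        ∀ᵐ t ∂leb (Icc 0 T), ∀ n, f n t ω ^ 2 ≤ G t := by
    filter_upwards [hlt_top, hpath] with ω h1 h2
    refine exists_dominating_of_summable h2 ?_
    have hw : 0 < expLossFloor hT S Λ α Φ₀ ω := Real.exp_pos _
    refine summable_of_one_sub_exp_le (fun n ↦ integral_nonneg fun _ ↦ sq_nonneg _)
      (κ := α * Λ / 8) (by positivity)
      (C := (∑' n, ENNReal.ofReal (4 ^ n * g n ω)).toReal / expLossFloor hT S Λ α Φ₀ ω) fun n ↦ ?_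
    rw [le_div_iff₀ hw]
    refine le_trans (le_of_eq ?_) ((ENNReal.ofReal_le_iff_le_toReal h1.ne).1 (ENNReal.le_tsum n))
    simp only [g]
    ring
  -- the superior limit is optional, and it is the limit wherever there is one; its junk values on
  -- the exceptional null set do not matter
  let F : Icc (0 : ℝ) T → Ω → ℝ := fun t ω ↦ limsup (fun n ↦ f n t ω) atTop
  have hFopt : IsOptional 𝓕 F := by
    have h : ∀ n, Measurable[optionalSigma 𝓕] fun p : Icc (0 : ℝ) T × Ω ↦ f n p.1 p.2 :=
      fun n ↦ (hf n).optional
    exact Measurable.limsup h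
  have hlim : ∀ᵐ ω ∂P, Integrable (fun t ↦ F t ω ^ 2) (leb (Icc 0 T)) ∧
      Tendsto (fun n ↦ ∫ t, f n t ω ^ 2 ∂leb (Icc 0 T)) atTop
        (𝓝 (∫ t, F t ω ^ 2 ∂leb (Icc 0 T))) ∧
      ∀ s : Icc (0 : ℝ) T → ℝ, MemLp s 2 (leb (Icc 0 T)) →
        Tendsto (fun n ↦ ∫ t, f n t ω * s t ∂leb (Icc 0 T)) atTop
          (𝓝 (∫ t, F t ω * s t ∂leb (Icc 0 T))) := by
    filter_upwards [hdom, hpath] with ω h1 h2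
    obtain ⟨hc, G, hG, hGf⟩ := h1
    refine tendsto_integral_mul_of_dominated (fun n ↦ (h2 n).1) hG hGf ?_
    filter_upwards [hc] with t ht
    obtain ⟨l, hl⟩ := ht
    simpa only [F, hl.limsup_eq] using hl
  have hFadm : IsAdmissible P 𝓕 Φ₀ F := by
    refine ⟨hFopt, hlim.mono fun ω h ↦ h.1, ?_⟩
    filter_upwards [hlim, ae_all_iff.2 fun n ↦ (hf n).liquidation] with ω h1 h2
    have h3 := h1.2.2 (fun _ ↦ 1) (memLp_const 1)
    simp only [mul_one] at h3
    have h4 := tendsto_nhds_unique (h3.const_add Φ₀)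
      (tendsto_const_nhds.congr fun n ↦ (h2 n).symm)
    exact h4
  have hpnl : ∀ᵐ ω ∂P, Tendsto (fun n ↦ pnl hT S Λ Φ₀ (f n) ω) atTop
      (𝓝 (pnl hT S Λ Φ₀ F ω)) := by
    filter_upwards [hlim] with ω h1
    exact (tendsto_const_nhds.sub (h1.2.2 _ (hW.memLp_path hT hS ω))).sub (h1.2.1.const_mul _)
  have hFle : expLoss P hT S Λ α Φ₀ F ≤ I := by
    have h1 : expLoss P hT S Λ α Φ₀ F = ∫⁻ ω, liminf (fun n ↦
        ENNReal.ofReal (Real.exp (-α * pnl hT S Λ Φ₀ (f n) ω))) atTop ∂P := by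
      refine lintegral_congr_ae ?_
      filter_upwards [hpnl] with ω h
      refine (Tendsto.liminf_eq ?_).symm
      exact (ENNReal.continuous_ofReal.tendsto _).comp
        ((Real.continuous_exp.tendsto _).comp (h.const_mul (-α)))
    rw [h1]
    refine (lintegral_liminf_le fun n ↦
      ((measurable_pnl hT hS (hf n).optional).const_mul _).exp.ennreal_ofReal).trans ?_
    have h2 : Tendsto (fun n : ℕ ↦ I + ENNReal.ofReal ((1 / 8) ^ n)) atTop (𝓝 (I + 0)) := by
      refine tendsto_const_nhds.add ?_
      rw [← ENNReal.ofReal_zero]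
      exact (ENNReal.continuous_ofReal.tendsto _).comp
        (tendsto_pow_atTop_nhds_zero_of_lt_one (by norm_num) (by norm_num))
    rw [add_zero] at h2
    rw [← h2.liminf_eq]
    exact liminf_le_liminf (Eventually.of_forall fun n ↦ (hlt n).le)
  exact ⟨F, hFadm, ne_top_of_le_ne_top hItop hFle, fun η hη ↦ hFle.trans (hIle η hη)⟩

end AlmgrenChriss

namespace AlmgrenChriss

/-! ### The first-order condition and the dual measure -/

section FirstOrder

variable {Ω : Type*} {m : MeasurableSpace Ω} {P : Measure Ω}

/-- The first-order condition at a minimizer, in a direction `D` along which the exponent is a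
quadratic polynomial. The difference quotients decrease by convexity, so the derivative can be taken
under the integral by Fatou's lemma. -/
lemma integral_exp_mul_nonneg_of_minimal {X D C : Ω → ℝ} (hX : Measurable X) (hD : Measurable D)
    (hC : Measurable C) (hC0 : ∀ ω, 0 ≤ C ω) (hXi : Integrable (fun ω ↦ Real.exp (X ω)) P)
    (hYi : Integrable (fun ω ↦ Real.exp (X ω + D ω + C ω)) P)
    (hmin : ∀ ε : ℝ, 0 < ε → ε ≤ 1 →
      Integrable (fun ω ↦ Real.exp (X ω + ε * D ω + ε ^ 2 * C ω)) P →
      ∫ ω, Real.exp (X ω) ∂P ≤ ∫ ω, Real.exp (X ω + ε * D ω + ε ^ 2 * C ω) ∂P) :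
    Integrable (fun ω ↦ Real.exp (X ω) * D ω) P ∧ 0 ≤ ∫ ω, Real.exp (X ω) * D ω ∂P := by
  have hconv : ∀ ε : ℝ, 0 < ε → ε ≤ 1 → ∀ ω, Real.exp (X ω + ε * D ω + ε ^ 2 * C ω)
      ≤ (1 - ε) * Real.exp (X ω) + ε * Real.exp (X ω + D ω + C ω) := by
    intro ε h0 h1 ω
    have h2 := convexOn_exp.2 (mem_univ (X ω)) (mem_univ (X ω + D ω + C ω))
      (sub_nonneg.2 h1) h0.le (by ring)
    simp only [smul_eq_mul] at h2
    refine le_trans (Real.exp_le_exp.2 ?_) h2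
    nlinarith [hC0 ω, mul_nonneg (mul_nonneg h0.le (sub_nonneg.2 h1)) (hC0 ω)]
  have hint : ∀ ε : ℝ, 0 < ε → ε ≤ 1 →
      Integrable (fun ω ↦ Real.exp (X ω + ε * D ω + ε ^ 2 * C ω)) P := by
    intro ε h0 h1
    refine ((hXi.const_mul (1 - ε)).add (hYi.const_mul ε)).mono' ?_ (ae_of_all _ fun ω ↦ ?_)
    · exact (((hX.add (hD.const_mul ε)).add (hC.const_mul _)).exp).aestronglyMeasurable
    · rw [Real.norm_eq_abs, Real.abs_exp]
      exact hconv ε h0 h1 ω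
  let ε : ℕ → ℝ := fun n ↦ 1 / ((n : ℝ) + 1)
  have hε0 : ∀ n, 0 < ε n := fun n ↦ by positivity
  have hε1 : ∀ n, ε n ≤ 1 := fun n ↦ by
    simp only [ε]
    rw [div_le_one (by positivity)]
    simp
  -- the chord over `[0, 1]` minus the chord over `[0, ε]`, nonnegative by convexity
  let u : ℕ → Ω → ℝ := fun n ω ↦ Real.exp (X ω + D ω + C ω) - Real.exp (X ω)
    - (ε n)⁻¹ * (Real.exp (X ω + ε n * D ω + ε n ^ 2 * C ω) - Real.exp (X ω))
  let v : Ω → ℝ := fun ω ↦ Real.exp (X ω + D ω + C ω) - Real.exp (X ω) - Real.exp (X ω) * D ω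
  have hu0 : ∀ n ω, 0 ≤ u n ω := by
    intro n ω
    have h1 := hconv (ε n) (hε0 n) (hε1 n) ω
    have h2 : (ε n)⁻¹ * (Real.exp (X ω + ε n * D ω + ε n ^ 2 * C ω) - Real.exp (X ω))
        ≤ Real.exp (X ω + D ω + C ω) - Real.exp (X ω) := by
      rw [inv_mul_le_iff₀ (hε0 n)]
      linarith
    exact sub_nonneg.2 h2
  have hui : ∀ n, Integrable (u n) P := fun n ↦
    (hYi.sub hXi).sub (((hint _ (hε0 n) (hε1 n)).sub hXi).const_mul _)
  have hulim : ∀ ω, Tendsto (fun n ↦ u n ω) atTop (𝓝 (v ω)) := by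
    intro ω
    have hd : HasDerivAt (fun e : ℝ ↦ Real.exp (X ω + e * D ω + e ^ 2 * C ω))
        (Real.exp (X ω) * D ω) 0 := by
      have h1 : HasDerivAt (fun e : ℝ ↦ X ω + e * D ω + e ^ 2 * C ω) (D ω) 0 := by
        refine HasDerivAt.congr_deriv ((((hasDerivAt_id (0 : ℝ)).mul_const (D ω)).const_add
          (X ω)).add (((hasDerivAt_id (0 : ℝ)).pow 2).mul_const (C ω))) ?_
        simp
      have h2 := h1.exp
      simpa using h2
    have h3 := hd.tendsto_slope_zero_right
    have h4 : Tendsto ε atTop (𝓝[>] 0) := tendsto_nhdsWithin_iff.2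
      ⟨tendsto_one_div_add_atTop_nhds_zero_nat, Eventually.of_forall hε0⟩
    have h5 := h3.comp h4
    refine Tendsto.sub tendsto_const_nhds (h5.congr fun n ↦ ?_)
    simp
  have hv0 : ∀ ω, 0 ≤ v ω := fun ω ↦ ge_of_tendsto' (hulim ω) fun n ↦ hu0 n ω
  have hvm : Measurable v :=
    (((hX.add hD).add hC).exp.sub hX.exp).sub (hX.exp.mul hD)
  have hum : ∀ n, Measurable (u n) := fun n ↦ (((hX.add hD).add hC).exp.sub hX.exp).sub
    ((((hX.add (hD.const_mul _)).add (hC.const_mul _)).exp.sub hX.exp).const_mul _)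
  set K := ∫ ω, Real.exp (X ω + D ω + C ω) ∂P - ∫ ω, Real.exp (X ω) ∂P with hK
  have huint : ∀ n, ∫ ω, u n ω ∂P ≤ K := by
    intro n
    have h1 := hmin (ε n) (hε0 n) (hε1 n) (hint _ (hε0 n) (hε1 n))
    have i1 : Integrable (fun ω ↦ Real.exp (X ω + D ω + C ω) - Real.exp (X ω)) P := hYi.sub hXi
    have i2 : Integrable (fun ω ↦ (ε n)⁻¹ * (Real.exp (X ω + ε n * D ω + ε n ^ 2 * C ω)
      - Real.exp (X ω))) P := ((hint _ (hε0 n) (hε1 n)).sub hXi).const_mul _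
    simp only [u]
    rw [integral_sub i1 i2, integral_sub hYi hXi, integral_const_mul,
      integral_sub (hint _ (hε0 n) (hε1 n)) hXi]
    have := mul_nonneg (inv_nonneg.2 (hε0 n).le) (sub_nonneg.2 h1)
    linarith
  have hvlint : ∫⁻ ω, ENNReal.ofReal (v ω) ∂P ≤ ENNReal.ofReal K := by
    have h1 : ∫⁻ ω, ENNReal.ofReal (v ω) ∂P
        = ∫⁻ ω, liminf (fun n ↦ ENNReal.ofReal (u n ω)) atTop ∂P := by
      refine lintegral_congr fun ω ↦ (Tendsto.liminf_eq ?_).symm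
      exact (ENNReal.continuous_ofReal.tendsto _).comp (hulim ω)
    rw [h1]
    refine (lintegral_liminf_le fun n ↦ (hum n).ennreal_ofReal).trans ?_
    refine (liminf_le_liminf (v := fun _ ↦ ENNReal.ofReal K)
      (Eventually.of_forall fun n ↦ ?_)).trans_eq (by simp)
    rw [← ofReal_integral_eq_lintegral_ofReal (hui n) (ae_of_all _ (hu0 n))]
    exact ENNReal.ofReal_le_ofReal (huint n)
  have hvi : Integrable v P := by
    refine ⟨hvm.aestronglyMeasurable, ?_⟩
    rw [hasFiniteIntegral_iff_ofReal (ae_of_all _ hv0)]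
    exact hvlint.trans_lt ENNReal.ofReal_lt_top
  have hK0 : 0 ≤ K := (integral_nonneg (hu0 0)).trans (huint 0)
  have hvint : ∫ ω, v ω ∂P ≤ K := by
    rw [← ofReal_integral_eq_lintegral_ofReal hvi (ae_of_all _ hv0)] at hvlint
    exact (ENNReal.ofReal_le_ofReal_iff hK0).1 hvlint
  have i1 : Integrable (fun ω ↦ Real.exp (X ω + D ω + C ω) - Real.exp (X ω)) P := hYi.sub hXi
  have e : ∀ ω, Real.exp (X ω) * D ω = Real.exp (X ω + D ω + C ω) - Real.exp (X ω) - v ω :=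
    fun ω ↦ by simp only [v]; ring
  simp_rw [e]
  refine ⟨i1.sub hvi, ?_⟩
  rw [integral_sub i1 hvi, integral_sub hYi hXi]
  linarith

/-- If `e ^ X D` is integrable for a subgradient `D ≤ Y - X`, where `Y` has exponential moments,
then `e ^ X X` is integrable. -/
lemma integrable_exp_mul_self [IsFiniteMeasure P] {X Y D : Ω → ℝ} (hX : Measurable X)
    (hY : Measurable Y) (hXi : Integrable (fun ω ↦ Real.exp (X ω)) P)
    (hYi : ∀ c : ℝ, Integrable (fun ω ↦ Real.exp (c * Y ω)) P)
    (hDi : Integrable (fun ω ↦ Real.exp (X ω) * D ω) P) (hD : ∀ᵐ ω ∂P, D ω ≤ Y ω - X ω) :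
    Integrable (fun ω ↦ Real.exp (X ω) * X ω) P := by
  have hY1 : Integrable (fun ω ↦ Real.exp (Y ω)) P := by simpa using hYi 1
  have h1 : Integrable (fun ω ↦ Real.exp (X ω) * (Y ω - X ω)) P := by
    refine integrable_of_le_of_le (hX.exp.mul (hY.sub hX)).aestronglyMeasurable
      (g₁ := fun ω ↦ Real.exp (X ω) * D ω) (g₂ := fun ω ↦ Real.exp (Y ω) - Real.exp (X ω))
      ?_ (ae_of_all _ fun ω ↦ ?_) hDi (hY1.sub hXi)
    · filter_upwards [hD] with ω hω
      exact mul_le_mul_of_nonneg_left hω (Real.exp_pos _).le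
    · have h2 := Real.add_one_le_exp (Y ω - X ω)
      have h3 : Real.exp (Y ω) = Real.exp (X ω) * Real.exp (Y ω - X ω) := by
        rw [← Real.exp_add]; ring_nf
      simp only
      rw [h3]
      nlinarith [Real.exp_pos (X ω)]
  -- the three terms serve for `X < 0`, for `X ≥ 2 |Y|` and for `0 ≤ X < 2 |Y|`, respectively
  have hG : Integrable (fun ω ↦ 1 + 2 * |Real.exp (X ω) * (Y ω - X ω)|
      + 2 * (Real.exp (3 * Y ω) + Real.exp (-3 * Y ω))) P :=
    ((integrable_const 1).add (h1.abs.const_mul 2)).add (((hYi 3).add (hYi (-3))).const_mul 2)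
  refine hG.mono' (hX.exp.mul hX).aestronglyMeasurable (ae_of_all _ fun ω ↦ ?_)
  rw [Real.norm_eq_abs]
  have e3 : 0 < Real.exp (3 * Y ω) := Real.exp_pos _
  have e4 : 0 < Real.exp (-3 * Y ω) := Real.exp_pos _
  have eX : 0 < Real.exp (X ω) := Real.exp_pos _
  have a0 : 0 ≤ |Real.exp (X ω) * (Y ω - X ω)| := abs_nonneg _
  rcases lt_or_ge (X ω) 0 with hneg | hpos
  · have h5 : |Real.exp (X ω) * X ω| ≤ 1 := by
      rw [abs_mul, Real.abs_exp, abs_of_neg hneg]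
      have h6 := Real.add_one_le_exp (-X ω)
      calc Real.exp (X ω) * -X ω ≤ Real.exp (X ω) * Real.exp (-X ω) := by gcongr; linarith
        _ = 1 := by rw [← Real.exp_add]; simp
    linarith
  · rw [abs_mul, Real.abs_exp, abs_of_nonneg hpos]
    rcases le_or_gt (2 * |Y ω|) (X ω) with hbig | hsmall
    · have h6 : X ω ≤ 2 * |Y ω - X ω| := by
        have h7 := le_abs_self (Y ω)
        have h8 := neg_abs_le (Y ω - X ω)
        linarith
      rw [abs_mul, Real.abs_exp] at a0 ⊢
      nlinarith
    · have h6 : Real.exp (X ω) * X ω ≤ Real.exp (2 * |Y ω|) * (2 * |Y ω|) :=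
        mul_le_mul (Real.exp_le_exp.2 hsmall.le) hsmall.le hpos (Real.exp_pos _).le
      have h7 : |Y ω| ≤ Real.exp |Y ω| := by linarith [Real.add_one_le_exp |Y ω|]
      have h8 : Real.exp (2 * |Y ω|) * |Y ω| ≤ Real.exp (3 * |Y ω|) := by
        calc Real.exp (2 * |Y ω|) * |Y ω| ≤ Real.exp (2 * |Y ω|) * Real.exp |Y ω| := by gcongr
          _ = Real.exp (3 * |Y ω|) := by rw [← Real.exp_add]; ring_nf
      have h9 : Real.exp (3 * |Y ω|) ≤ Real.exp (3 * Y ω) + Real.exp (-3 * Y ω) := by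
        rcases abs_cases (Y ω) with ⟨h, _⟩ | ⟨h, _⟩
        · rw [h]; linarith
        · rw [h, show 3 * -Y ω = -3 * Y ω by ring]; linarith
      nlinarith

/-- A tilted measure `e ^ X / E[e ^ X]` with `e ^ X X` integrable has finite entropy. -/
lemma finiteEntropy_tilted [IsProbabilityMeasure P] {X : Ω → ℝ}
    (hXi : Integrable (fun ω ↦ Real.exp (X ω)) P)
    (hXX : Integrable (fun ω ↦ Real.exp (X ω) * X ω) P) :
    FiniteEntropy P (P.tilted X) ∧ Integrable X (P.tilted X) ∧
      ∫ ω, llr (P.tilted X) P ω ∂(P.tilted X)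
        = ∫ ω, X ω ∂(P.tilted X) - Real.log (∫ ω, Real.exp (X ω) ∂P) := by
  have hp : IsProbabilityMeasure (P.tilted X) := isProbabilityMeasure_tilted hXi
  have hac := tilted_absolutelyContinuous P X
  have hX : Integrable X (P.tilted X) := (integrable_tilted_iff hXi _).2 (by simpa using hXX)
  have hllr : llr (P.tilted X) P =ᵐ[P.tilted X]
      fun ω ↦ X ω - Real.log (∫ ω, Real.exp (X ω) ∂P) :=
    hac.ae_le (log_rnDeriv_tilted_left_self hXi)
  refine ⟨⟨hp, hac, absolutelyContinuous_tilted hXi,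
    (hX.sub (integrable_const _)).congr hllr.symm⟩, hX, ?_⟩
  rw [integral_congr_ae hllr, integral_sub hX (integrable_const _)]
  simp

end FirstOrder

variable {Ω : Type*} {m : MeasurableSpace Ω} {T : ℝ} {P Q : Measure Ω}
  {𝓕 : Filtration (Icc (0 : ℝ) T) m} {S φ ψ : Icc (0 : ℝ) T → Ω → ℝ} {W : Ω → ℝ} {a : ℝ}
  {Λ α Φ₀ : ℝ}

/-- The derivative of `- V_T` at the strategy `φ` in the direction of `ψ`. -/
noncomputable def pnlSlope (S : Icc (0 : ℝ) T → Ω → ℝ) (Λ : ℝ) (φ ψ : Icc (0 : ℝ) T → Ω → ℝ)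
    (ω : Ω) : ℝ :=
  ∫ t, (ψ t ω - φ t ω) * (S t ω + Λ * φ t ω) ∂leb (Icc 0 T)

lemma pnl_segment (hT : 0 < T) {ω : Ω}
    (hS2 : MemLp (fun t ↦ S t ω) 2 (leb (Icc 0 T)))
    (hφ2 : MemLp (fun t ↦ φ t ω) 2 (leb (Icc 0 T)))
    (hψ2 : MemLp (fun t ↦ ψ t ω) 2 (leb (Icc 0 T))) (ε : ℝ) :
    pnl hT S Λ Φ₀ (fun t ω ↦ φ t ω + ε * (ψ t ω - φ t ω)) ω
      = pnl hT S Λ Φ₀ φ ω - ε * pnlSlope S Λ φ ψ ω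
        - ε ^ 2 * (Λ / 2 * ∫ t, (ψ t ω - φ t ω) ^ 2 ∂leb (Icc 0 T)) := by
  have hd : MemLp (fun t ↦ ψ t ω - φ t ω) 2 (leb (Icc 0 T)) := hψ2.sub hφ2
  have h1 : Integrable (fun t ↦ φ t ω * S t ω) (leb (Icc 0 T)) := hφ2.integrable_mul hS2
  have h2 : Integrable (fun t ↦ (ψ t ω - φ t ω) * S t ω) (leb (Icc 0 T)) := hd.integrable_mul hS2
  have h3 : Integrable (fun t ↦ (ψ t ω - φ t ω) * φ t ω) (leb (Icc 0 T)) := hd.integrable_mul hφ2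
  have q1 := hφ2.integrable_sq
  have q2 := hd.integrable_sq
  have e1 : ∫ t, (φ t ω + ε * (ψ t ω - φ t ω)) * S t ω ∂leb (Icc 0 T)
      = ∫ t, φ t ω * S t ω ∂leb (Icc 0 T)
        + ε * ∫ t, (ψ t ω - φ t ω) * S t ω ∂leb (Icc 0 T) := by
    rw [← integral_const_mul, ← integral_add h1 (h2.const_mul ε)]
    refine integral_congr_ae (ae_of_all _ fun t ↦ ?_)
    simp only; ring
  have q3 : Integrable (fun t ↦ φ t ω ^ 2 + 2 * ε * ((ψ t ω - φ t ω) * φ t ω))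
    (leb (Icc 0 T)) := q1.add (h3.const_mul _)
  have e2 : ∫ t, (φ t ω + ε * (ψ t ω - φ t ω)) ^ 2 ∂leb (Icc 0 T)
      = ∫ t, φ t ω ^ 2 ∂leb (Icc 0 T) + 2 * ε * ∫ t, (ψ t ω - φ t ω) * φ t ω ∂leb (Icc 0 T)
        + ε ^ 2 * ∫ t, (ψ t ω - φ t ω) ^ 2 ∂leb (Icc 0 T) := by
    rw [← integral_const_mul, ← integral_const_mul, ← integral_add q1 (h3.const_mul _),
      ← integral_add q3 (q2.const_mul _)]
    refine integral_congr_ae (ae_of_all _ fun t ↦ ?_)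
    simp only; ring
  have e3 : pnlSlope S Λ φ ψ ω = ∫ t, (ψ t ω - φ t ω) * S t ω ∂leb (Icc 0 T)
      + Λ * ∫ t, (ψ t ω - φ t ω) * φ t ω ∂leb (Icc 0 T) := by
    rw [pnlSlope, ← integral_const_mul, ← integral_add h2 (h3.const_mul Λ)]
    refine integral_congr_ae (ae_of_all _ fun t ↦ ?_)
    simp only; ring
  simp only [pnl]
  rw [e1, e2, e3]
  ring

lemma IsAdmissible.segment (hT : 0 < T) (hφ : IsAdmissible P 𝓕 Φ₀ φ)
    (hψ : IsAdmissible P 𝓕 Φ₀ ψ) (ε : ℝ) :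
    IsAdmissible P 𝓕 Φ₀ fun t ω ↦ φ t ω + ε * (ψ t ω - φ t ω) := by
  refine ⟨hφ.optional.add ((hψ.optional.sub hφ.optional).const_mul ε), ?_, ?_⟩
  · filter_upwards [hφ.memLp_path hT, hψ.memLp_path hT] with ω h1 h2
    exact (h1.add ((h2.sub h1).const_mul ε)).integrable_sq
  · filter_upwards [hφ.memLp_path hT, hψ.memLp_path hT, hφ.liquidation, hψ.liquidation]
      with ω h1 h2 h3 h4
    have i1 := h1.integrable one_le_two
    have i2 := h2.integrable one_le_two
    have i3 : Integrable (fun t ↦ ε * (ψ t ω - φ t ω)) (leb (Icc 0 T)) := (i2.sub i1).const_mul ε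
    rw [integral_add i1 i3, integral_const_mul, integral_sub i2 i1]
    have h5 : ∫ t, ψ t ω ∂leb (Icc 0 T) = ∫ t, φ t ω ∂leb (Icc 0 T) := by linarith
    rw [h5]
    linarith

lemma measurable_pnlSlope (hT : 0 < T) (hS : IsOptional 𝓕 S) (hφ : IsOptional 𝓕 φ)
    (hψ : IsOptional 𝓕 ψ) : Measurable (pnlSlope S Λ φ ψ) :=
  measurable_integral_path hT ((hψ.sub hφ).mul (hS.add (hφ.const_mul Λ)))

/-- The first-order condition for an optimal strategy, in the direction of a bounded one. -/
lemma first_order_pnl [IsProbabilityMeasure P] (hT : 0 < T) (hW : IsExpBound P S W a)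
    (hS : IsOptional 𝓕 S) (hΛ : 0 < Λ) (hα : 0 < α) (hφ : IsAdmissible P 𝓕 Φ₀ φ)
    (hfin : expLoss P hT S Λ α Φ₀ φ ≠ ⊤)
    (hmin : ∀ η, IsAdmissible P 𝓕 Φ₀ η → expLoss P hT S Λ α Φ₀ φ ≤ expLoss P hT S Λ α Φ₀ η)
    (hψ : IsAdmissible P 𝓕 Φ₀ ψ) {K : ℝ} (hK : ∀ t ω, |ψ t ω| ≤ K) :
    Integrable (fun ω ↦ Real.exp (-α * pnl hT S Λ Φ₀ φ ω) * (α * pnlSlope S Λ φ ψ ω)) P ∧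
      0 ≤ ∫ ω, Real.exp (-α * pnl hT S Λ Φ₀ φ ω) * (α * pnlSlope S Λ φ ψ ω) ∂P ∧
      ∀ᵐ ω ∂P, α * pnlSlope S Λ φ ψ ω
        ≤ -α * pnl hT S Λ Φ₀ ψ ω - -α * pnl hT S Λ Φ₀ φ ω := by
  have hseg : ∀ᵐ ω ∂P, ∀ ε : ℝ, -α * pnl hT S Λ Φ₀ (fun t ω ↦ φ t ω + ε * (ψ t ω - φ t ω)) ω
      = -α * pnl hT S Λ Φ₀ φ ω + ε * (α * pnlSlope S Λ φ ψ ω)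
        + ε ^ 2 * (α * (Λ / 2 * ∫ t, (ψ t ω - φ t ω) ^ 2 ∂leb (Icc 0 T))) := by
    filter_upwards [hφ.memLp_path hT, hψ.memLp_path hT] with ω h1 h2 ε
    rw [pnl_segment hT (hW.memLp_path hT hS ω) h1 h2]
    ring
  have hone : ∀ᵐ ω ∂P, -α * pnl hT S Λ Φ₀ ψ ω
      = -α * pnl hT S Λ Φ₀ φ ω + α * pnlSlope S Λ φ ψ ω
        + α * (Λ / 2 * ∫ t, (ψ t ω - φ t ω) ^ 2 ∂leb (Icc 0 T)) := by
    filter_upwards [hseg] with ω h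
    have h1 := h 1
    have e : (fun (t : Icc (0 : ℝ) T) (ω : Ω) ↦ φ t ω + 1 * (ψ t ω - φ t ω)) = ψ := by
      ext t ω; ring
    rw [e] at h1
    rw [h1]; ring
  have hC0 : ∀ ω, 0 ≤ α * (Λ / 2 * ∫ t, (ψ t ω - φ t ω) ^ 2 ∂leb (Icc 0 T)) := fun ω ↦ by
    have : 0 ≤ ∫ t, (ψ t ω - φ t ω) ^ 2 ∂leb (Icc 0 T) := integral_nonneg fun _ ↦ sq_nonneg _
    positivity
  have hXi := integrable_exp_of_expLoss hT hS hφ.optional hfin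
  have hYi := integrable_exp_pnl_of_bounded (Φ₀ := Φ₀) hT hW hS hΛ hψ.optional hK (-α)
  have key := integral_exp_mul_nonneg_of_minimal (P := P)
    (X := fun ω ↦ -α * pnl hT S Λ Φ₀ φ ω) (D := fun ω ↦ α * pnlSlope S Λ φ ψ ω)
    (C := fun ω ↦ α * (Λ / 2 * ∫ t, (ψ t ω - φ t ω) ^ 2 ∂leb (Icc 0 T)))
    ((measurable_pnl hT hS hφ.optional).const_mul _)
    ((measurable_pnlSlope hT hS hφ.optional hψ.optional).const_mul _)
    (((measurable_integral_sq_sub hT hψ.optional hφ.optional).const_mul _).const_mul _) hC0 hXi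
    (hYi.congr (hone.mono fun ω h ↦ by simp only [h])) (fun ε _ _ hi ↦ by
      have hi' : Integrable (fun ω ↦ Real.exp (-α * pnl hT S Λ Φ₀
          (fun t ω ↦ φ t ω + ε * (ψ t ω - φ t ω)) ω)) P :=
        hi.congr (hseg.mono fun ω h ↦ by simp only [h ε])
      have h1 := hmin _ (hφ.segment hT hψ ε)
      rw [expLoss_eq hT hXi, expLoss_eq hT hi',
        ENNReal.ofReal_le_ofReal_iff (integral_nonneg fun _ ↦ (Real.exp_pos _).le)] at h1
      refine h1.trans_eq (integral_congr_ae (hseg.mono fun ω h ↦ ?_))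
      simp only [h ε])
  refine ⟨key.1, key.2, ?_⟩
  filter_upwards [hone] with ω h
  rw [h]
  linarith [hC0 ω]

/-- The measure with density proportional to `exp (- α V_T)` for the optimal strategy has finite
entropy. -/
lemma finiteEntropy_of_isMinimal [IsProbabilityMeasure P] (hT : 0 < T) (hW : IsExpBound P S W a)
    (hS : IsOptional 𝓕 S) (hΛ : 0 < Λ) (hα : 0 < α) (hφ : IsAdmissible P 𝓕 Φ₀ φ)
    (hfin : expLoss P hT S Λ α Φ₀ φ ≠ ⊤)
    (hmin : ∀ η, IsAdmissible P 𝓕 Φ₀ η → expLoss P hT S Λ α Φ₀ φ ≤ expLoss P hT S Λ α Φ₀ η) :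
    let X : Ω → ℝ := fun ω ↦ -α * pnl hT S Λ Φ₀ φ ω
    FiniteEntropy P (P.tilted X) ∧ Integrable X (P.tilted X) ∧
      ∫ ω, llr (P.tilted X) P ω ∂(P.tilted X)
        = ∫ ω, X ω ∂(P.tilted X) - Real.log (∫ ω, Real.exp (X ω) ∂P) := by
  intro X
  have hXi := integrable_exp_of_expLoss hT hS hφ.optional hfin
  have hψ : IsAdmissible P 𝓕 Φ₀ fun _ _ ↦ -Φ₀ / T := isAdmissible_const hT
  -- compare with the strategy of constant speed, whose loss has all exponential moments
  obtain ⟨h1, -, h3⟩ := first_order_pnl hT hW hS hΛ hα hφ hfin hmin hψ (fun _ _ ↦ le_rfl)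
  refine finiteEntropy_tilted hXi (integrable_exp_mul_self
    ((measurable_pnl hT hS hφ.optional).const_mul _)
    ((measurable_pnl hT hS hψ.optional).const_mul (-α)) hXi (fun c ↦ ?_) h1 h3)
  simp_rw [← mul_assoc]
  exact integrable_exp_pnl_of_bounded hT hW hS hΛ hψ.optional (fun _ _ ↦ le_rfl) _

/-- Under the dual measure, the process `S + Λ φ` is orthogonal to all bounded round trips. -/
lemma integral_mul_eq_zero_of_isMinimal [IsProbabilityMeasure P] (hT : 0 < T)
    (hW : IsExpBound P S W a)
    (hS : IsOptional 𝓕 S) (hΛ : 0 < Λ) (hα : 0 < α) (hφ : IsAdmissible P 𝓕 Φ₀ φ)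
    (hfin : expLoss P hT S Λ α Φ₀ φ ≠ ⊤)
    (hmin : ∀ η, IsAdmissible P 𝓕 Φ₀ η → expLoss P hT S Λ α Φ₀ φ ≤ expLoss P hT S Λ α Φ₀ η)
    (hQ : Q = P.tilted fun ω ↦ -α * pnl hT S Λ Φ₀ φ ω) (hQe : FiniteEntropy P Q)
    (hφ2 : MemLp (fun p : Icc (0 : ℝ) T × Ω ↦ φ p.1 p.2) 2 ((leb (Icc 0 T)).prod Q))
    {η : Icc (0 : ℝ) T → Ω → ℝ} (hη : IsOptional 𝓕 η) {K : ℝ} (hK : ∀ t ω, |η t ω| ≤ K)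
    (hη0 : ∀ᵐ ω ∂P, ∫ t, η t ω ∂leb (Icc 0 T) = 0) :
    ∫ p, η p.1 p.2 * (S p.1 p.2 + Λ * φ p.1 p.2) ∂((leb (Icc 0 T)).prod Q) = 0 := by
  have := hQe.prob
  have hXi := integrable_exp_of_expLoss hT hS hφ.optional hfin
  have hN : MemLp (fun p : Icc (0 : ℝ) T × Ω ↦ S p.1 p.2 + Λ * φ p.1 p.2) 2
    ((leb (Icc 0 T)).prod Q) := (hW.memLp_prod hT hS hQe).add (hφ2.const_mul Λ)
  have hη2 : MemLp (fun p : Icc (0 : ℝ) T × Ω ↦ η p.1 p.2) 2 ((leb (Icc 0 T)).prod Q) :=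
    MemLp.of_bound (hη.measurable hT).aestronglyMeasurable K (ae_of_all _ fun p ↦ hK p.1 p.2)
  have hηN : Integrable (fun p : Icc (0 : ℝ) T × Ω ↦ η p.1 p.2 * (S p.1 p.2 + Λ * φ p.1 p.2))
    ((leb (Icc 0 T)).prod Q) := hη2.integrable_mul hN
  have hcN : Integrable (fun p : Icc (0 : ℝ) T × Ω ↦ (-Φ₀ / T - φ p.1 p.2) *
    (S p.1 p.2 + Λ * φ p.1 p.2)) ((leb (Icc 0 T)).prod Q) :=
    ((memLp_const (-Φ₀ / T)).sub hφ2).integrable_mul hN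
  set A := ∫ p, η p.1 p.2 * (S p.1 p.2 + Λ * φ p.1 p.2) ∂((leb (Icc 0 T)).prod Q) with hA
  set B := ∫ p : Icc (0 : ℝ) T × Ω, (-Φ₀ / T - φ p.1 p.2) * (S p.1 p.2 + Λ * φ p.1 p.2)
    ∂((leb (Icc 0 T)).prod Q) with hB
  -- compare with the strategy `-Φ₀ / T + r η`; as `r` ranges over all reals, `A` has to vanish
  have key : ∀ r : ℝ, 0 ≤ B + r * A := by
    intro r
    have hc : IsAdmissible P 𝓕 Φ₀ fun _ _ ↦ -Φ₀ / T := isAdmissible_const hT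
    have hbd : ∀ (t : Icc (0 : ℝ) T) (ω : Ω), |-Φ₀ / T + r * η t ω| ≤ |-Φ₀ / T| + |r| * K :=
      fun t ω ↦ (abs_add_le _ _).trans (by
        rw [abs_mul]
        exact add_le_add_right (mul_le_mul_of_nonneg_left (hK t ω) (abs_nonneg r)) _)
    have hηp : ∀ ω, MemLp (fun t ↦ η t ω) 2 (leb (Icc 0 T)) := fun ω ↦
      MemLp.of_bound (hη.measurable_path hT ω).aestronglyMeasurable K (ae_of_all _ fun t ↦ hK t ω)
    have hψ : IsAdmissible P 𝓕 Φ₀ fun t ω ↦ -Φ₀ / T + r * η t ω := by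
      refine ⟨hc.optional.add (hη.const_mul r), ae_of_all _ fun ω ↦ ?_, ?_⟩
      · exact ((memLp_const (-Φ₀ / T)).add ((hηp ω).const_mul r)).integrable_sq
      · filter_upwards [hη0, hc.liquidation] with ω h1 h2
        rw [integral_add (integrable_const _) (((hηp ω).integrable one_le_two).const_mul r),
          integral_const_mul, h1, mul_zero, add_zero, h2]
    obtain ⟨-, h2, -⟩ := first_order_pnl hT hW hS hΛ hα hφ hfin hmin hψ hbd
    have h3 : 0 ≤ ∫ ω, pnlSlope S Λ φ (fun t ω ↦ -Φ₀ / T + r * η t ω) ω ∂Q := by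
      rw [hQ, integral_tilted]
      have hZ := integral_exp_pos hXi
      have e : ∀ ω, (Real.exp (-α * pnl hT S Λ Φ₀ φ ω)
          / ∫ ω, Real.exp (-α * pnl hT S Λ Φ₀ φ ω) ∂P)
            • pnlSlope S Λ φ (fun t ω ↦ -Φ₀ / T + r * η t ω) ω
          = (α * ∫ ω, Real.exp (-α * pnl hT S Λ Φ₀ φ ω) ∂P)⁻¹ *
            (Real.exp (-α * pnl hT S Λ Φ₀ φ ω)
              * (α * pnlSlope S Λ φ (fun t ω ↦ -Φ₀ / T + r * η t ω) ω)) := fun ω ↦ by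
        rw [smul_eq_mul]
        field_simp
      simp_rw [e]
      rw [integral_const_mul]
      exact mul_nonneg (by positivity) h2
    have h4 : ∫ ω, pnlSlope S Λ φ (fun t ω ↦ -Φ₀ / T + r * η t ω) ω ∂Q = B + r * A := by
      have hsum : Integrable (fun p : Icc (0 : ℝ) T × Ω ↦ (-Φ₀ / T - φ p.1 p.2) *
          (S p.1 p.2 + Λ * φ p.1 p.2) + r * (η p.1 p.2 * (S p.1 p.2 + Λ * φ p.1 p.2)))
          ((leb (Icc 0 T)).prod Q) := hcN.add (hηN.const_mul r)
      rw [hA, hB, ← integral_const_mul, ← integral_add hcN (hηN.const_mul r),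
        integral_prod_symm _ hsum]
      refine integral_congr_ae (ae_of_all _ fun ω ↦ ?_)
      simp only [pnlSlope]
      refine integral_congr_ae (ae_of_all _ fun t ↦ ?_)
      simp only
      ring
    rwa [h4] at h3
  by_contra hA0
  have h1 := key (-(B + 1) / A)
  rw [div_mul_cancel₀ _ hA0] at h1
  linarith

end AlmgrenChriss

namespace AlmgrenChriss

/-! ### Oscillations of a martingale along the dyadic times -/

section Displacement

/-- Greedy recording of a sequence `y`: a reference value and a counter. Whenever the sequence is at
distance at least `ε` from the reference value, the reference value is reset to the current value
and the counter is raised. -/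
noncomputable def displacement (ε : ℝ) (y : ℕ → ℝ) : ℕ → ℝ × ℕ
  | 0 => (y 0, 0)
  | k + 1 =>
    if ε ≤ |y (k + 1) - (displacement ε y k).1| then (y (k + 1), (displacement ε y k).2 + 1)
    else displacement ε y k

variable {ε : ℝ} {y : ℕ → ℝ}

lemma displacement_succ_of_le {k : ℕ} (h : ε ≤ |y (k + 1) - (displacement ε y k).1|) :
    displacement ε y (k + 1) = (y (k + 1), (displacement ε y k).2 + 1) := by
  rw [displacement, if_pos h]

lemma displacement_succ_of_lt {k : ℕ} (h : |y (k + 1) - (displacement ε y k).1| < ε) :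
    displacement ε y (k + 1) = displacement ε y k := by
  rw [displacement, if_neg (not_le.2 h)]

lemma abs_sub_displacement_lt (hε : 0 < ε) (k : ℕ) : |y k - (displacement ε y k).1| < ε := by
  cases k with
  | zero => simpa [displacement] using hε
  | succ k =>
    rcases le_or_gt ε |y (k + 1) - (displacement ε y k).1| with h | h
    · rw [displacement_succ_of_le h]; simpa using hε
    · rw [displacement_succ_of_lt h]; exact h

lemma displacement_snd_le (k : ℕ) : (displacement ε y k).2 ≤ k := by
  induction k with
  | zero => simp [displacement]
  | succ k ih =>
    rcases le_or_gt ε |y (k + 1) - (displacement ε y k).1| with h | h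
    · rw [displacement_succ_of_le h]; simpa using ih
    · rw [displacement_succ_of_lt h]; omega

lemma monotone_displacement_snd : Monotone fun k ↦ (displacement ε y k).2 := by
  refine monotone_nat_of_le_succ fun k ↦ ?_
  rcases le_or_gt ε |y (k + 1) - (displacement ε y k).1| with h | h
  · rw [displacement_succ_of_le h]; simp
  · rw [displacement_succ_of_lt h]

lemma displacement_eq_of_snd_eq {i j : ℕ} (hij : i ≤ j)
    (h : (displacement ε y i).2 = (displacement ε y j).2) :
    displacement ε y i = displacement ε y j := by
  induction j, hij using Nat.le_induction with
  | base => rfl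
  | succ j hij ih =>
    have h1 := monotone_displacement_snd (ε := ε) (y := y) hij
    rcases le_or_gt ε |y (j + 1) - (displacement ε y j).1| with h2 | h2
    · rw [displacement_succ_of_le h2] at h
      dsimp only at h h1
      omega
    · rw [displacement_succ_of_lt h2] at h ⊢
      exact ih h

/-- A displacement by at least `2 * ε` raises the counter. -/
lemma displacement_snd_lt_of_le (hε : 0 < ε) {i j : ℕ} (hij : i ≤ j) (h : 2 * ε ≤ |y j - y i|) :
    (displacement ε y i).2 < (displacement ε y j).2 := by
  refine lt_of_le_of_ne (monotone_displacement_snd hij) fun he ↦ ?_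
  have h1 := displacement_eq_of_snd_eq hij he
  have h2 := abs_lt.1 (abs_sub_displacement_lt (y := y) hε i)
  have h3 := abs_lt.1 (abs_sub_displacement_lt (y := y) hε j)
  rw [h1] at h2
  have : |y j - y i| < 2 * ε := abs_lt.2 ⟨by linarith, by linarith⟩
  linarith

lemma displacement_sq_step (hε : 0 < ε) (k : ℕ) :
    ε ^ 2 * (displacement ε y (k + 1)).2 + (y (k + 1) - (displacement ε y (k + 1)).1) ^ 2
      ≤ ε ^ 2 * (displacement ε y k).2 + (y (k + 1) - (displacement ε y k).1) ^ 2 := by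
  rcases le_or_gt ε |y (k + 1) - (displacement ε y k).1| with h | h
  · rw [displacement_succ_of_le h]
    have : ε ^ 2 ≤ (y (k + 1) - (displacement ε y k).1) ^ 2 := by
      rw [← sq_abs (y (k + 1) - _)]; exact pow_le_pow_left₀ hε.le h 2
    push_cast; nlinarith
  · rw [displacement_succ_of_lt h]

end Displacement

variable {Ω : Type*} {m : MeasurableSpace Ω} {T : ℝ} {Q : Measure Ω}

section Counting

variable {ι : Type*} [Preorder ι] {𝓖 : Filtration ι m} {ξ : ι → Ω → ℝ}

lemma measurable_displacement (hξ : Adapted 𝓖 ξ) {q : ℕ → ι} (hq : Monotone q) (ε : ℝ) (k : ℕ) :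
    Measurable[𝓖 (q k)] fun ω ↦ displacement ε (fun k ↦ ξ (q k) ω) k := by
  induction k with
  | zero => exact (hξ (q 0)).prodMk measurable_const
  | succ k ih =>
    have ih' := ih.mono (𝓖.mono (hq k.le_succ)) le_rfl
    have h1 := hξ (q (k + 1))
    simp only [displacement]
    refine Measurable.ite ?_ (h1.prodMk ?_) ih'
    · exact measurableSet_le (mδ := 𝓖 (q (k + 1))) measurable_const
        (continuous_abs.measurable.comp (h1.sub ih'.fst))
    · exact (measurable_from_top (f := fun n : ℕ ↦ n + 1)).comp ih'.snd

/-- The expected number of `ε`-displacements of a square-integrable martingale along finitely many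
times is at most `ε⁻²` times the second moment at the last of them: each displacement contributes
`ε²` to the variance. -/
lemma integral_displacement_le [IsProbabilityMeasure Q] (hξ : Martingale ξ 𝓖 Q) {q : ℕ → ι}
    (hq : Monotone q) (h2 : ∀ k, MemLp (ξ (q k)) 2 Q) {ε : ℝ} (hε : 0 < ε) (k : ℕ) :
    ε ^ 2 * ∫ ω, ((displacement ε (fun k ↦ ξ (q k) ω) k).2 : ℝ) ∂Q
      + ∫ ω, (ξ (q k) ω - (displacement ε (fun k ↦ ξ (q k) ω) k).1) ^ 2 ∂Q
      ≤ ∫ ω, ξ (q k) ω ^ 2 ∂Q := by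
  have had : Adapted 𝓖 ξ := fun t ↦ (hξ.stronglyMeasurable t).measurable
  have hm := fun k ↦ measurable_displacement had hq ε k
  have hdm : ∀ k, Measurable[𝓖 (q k)] fun ω ↦ ξ (q k) ω
      - (displacement ε (fun k ↦ ξ (q k) ω) k).1 := fun k ↦ (had (q k)).sub (hm k).fst
  have hd : ∀ k, MemLp (fun ω ↦ ξ (q k) ω - (displacement ε (fun k ↦ ξ (q k) ω) k).1) 2 Q :=
    fun k ↦ MemLp.of_bound ((hdm k).mono (𝓖.le _) le_rfl).aestronglyMeasurable ε
      (ae_of_all _ fun ω ↦ (abs_sub_displacement_lt (y := fun k ↦ ξ (q k) ω) hε k).le)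
  have hc : ∀ k, Integrable (fun ω ↦ ((displacement ε (fun k ↦ ξ (q k) ω) k).2 : ℝ)) Q := by
    intro k
    refine Integrable.of_bound (C := k) ?_ (ae_of_all _ fun ω ↦ ?_)
    · exact ((measurable_from_top (f := fun n : ℕ ↦ (n : ℝ))).comp
        ((hm k).mono (𝓖.le _) le_rfl).snd).aestronglyMeasurable
    · rw [Real.norm_of_nonneg (Nat.cast_nonneg _)]
      exact_mod_cast displacement_snd_le k
  induction k with
  | zero =>
    simp only [displacement, Nat.cast_zero, integral_zero, mul_zero, sub_self, zero_add]
    simpa using integral_nonneg (μ := Q) (f := fun ω ↦ ξ (q 0) ω ^ 2) fun ω ↦ sq_nonneg _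
  | succ k ih =>
    set c : ℕ → Ω → ℝ := fun k ω ↦ ((displacement ε (fun k ↦ ξ (q k) ω) k).2 : ℝ) with hcdef
    set d : ℕ → Ω → ℝ := fun k ω ↦ ξ (q k) ω - (displacement ε (fun k ↦ ξ (q k) ω) k).1 with hddef
    have hk : q k ≤ q (k + 1) := hq k.le_succ
    have hD : MemLp (fun ω ↦ ξ (q (k + 1)) ω - ξ (q k) ω) 2 Q := (h2 (k + 1)).sub (h2 k)
    have e0 := integral_sq_sub_martingale hξ hk (h2 (k + 1))
    have i1 : Integrable (fun ω ↦ d k ω * ξ (q (k + 1)) ω) Q := (hd k).integrable_mul (h2 (k + 1))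
    have i2 : Integrable (fun ω ↦ d k ω * ξ (q k) ω) Q := (hd k).integrable_mul (h2 k)
    have e1 := integral_mul_martingale hξ hk (hdm k).stronglyMeasurable i1
    have i3 : Integrable (fun ω ↦ (d k ω + (ξ (q (k + 1)) ω - ξ (q k) ω)) ^ 2) Q :=
      ((hd k).add hD).integrable_sq
    have e2 : ∫ ω, (d k ω + (ξ (q (k + 1)) ω - ξ (q k) ω)) ^ 2 ∂Q
        = ∫ ω, d k ω ^ 2 ∂Q + ∫ ω, (ξ (q (k + 1)) ω - ξ (q k) ω) ^ 2 ∂Q := by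
      have i4 : Integrable (fun ω ↦ d k ω ^ 2 + (ξ (q (k + 1)) ω - ξ (q k) ω) ^ 2) Q :=
        (hd k).integrable_sq.add hD.integrable_sq
      have i5 : Integrable (fun ω ↦ 2 * (d k ω * ξ (q (k + 1)) ω - d k ω * ξ (q k) ω)) Q :=
        (i1.sub i2).const_mul 2
      rw [← integral_add (hd k).integrable_sq hD.integrable_sq, ← sub_eq_zero,
        ← integral_sub i3 i4]
      calc _ = ∫ ω, 2 * (d k ω * ξ (q (k + 1)) ω - d k ω * ξ (q k) ω) ∂Q :=
            integral_congr_ae (ae_of_all _ fun ω ↦ by ring)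
        _ = 0 := by
            rw [integral_const_mul, integral_sub i1 i2, e1, sub_self, mul_zero]
    have i6 : Integrable (fun ω ↦ ε ^ 2 * c (k + 1) ω + d (k + 1) ω ^ 2) Q :=
      ((hc (k + 1)).const_mul _).add (hd (k + 1)).integrable_sq
    have i7 : Integrable (fun ω ↦ ε ^ 2 * c k ω
        + (d k ω + (ξ (q (k + 1)) ω - ξ (q k) ω)) ^ 2) Q := ((hc k).const_mul _).add i3
    have hle : ∫ ω, (ε ^ 2 * c (k + 1) ω + d (k + 1) ω ^ 2) ∂Q ≤ ∫ ω, (ε ^ 2 * c k ω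
        + (d k ω + (ξ (q (k + 1)) ω - ξ (q k) ω)) ^ 2) ∂Q := by
      refine integral_mono i6 i7 fun ω ↦ ?_
      have := displacement_sq_step (y := fun k ↦ ξ (q k) ω) hε k
      have e : d k ω + (ξ (q (k + 1)) ω - ξ (q k) ω)
        = ξ (q (k + 1)) ω - (displacement ε (fun k ↦ ξ (q k) ω) k).1 := by
        simp only [hddef]; ring
      dsimp only
      rw [e]
      exact this
    rw [integral_add ((hc (k + 1)).const_mul _) (hd (k + 1)).integrable_sq, integral_const_mul,
      integral_add ((hc k).const_mul _) i3, integral_const_mul, e2, e0] at hle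
    linarith

lemma measure_displacement_le [IsProbabilityMeasure Q] (hξ : Martingale ξ 𝓖 Q) {q : ℕ → ι}
    (hq : Monotone q) (h2 : ∀ k, MemLp (ξ (q k)) 2 Q) {ε : ℝ} (hε : 0 < ε) (k n : ℕ) :
    n * Q {ω | n ≤ (displacement ε (fun k ↦ ξ (q k) ω) k).2}
      ≤ ENNReal.ofReal ((∫ ω, ξ (q k) ω ^ 2 ∂Q) / ε ^ 2) := by
  have had : Adapted 𝓖 ξ := fun t ↦ (hξ.stronglyMeasurable t).measurable
  have hm : Measurable fun ω ↦ ((displacement ε (fun k ↦ ξ (q k) ω) k).2 : ℝ) :=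
    (measurable_from_top (f := fun n : ℕ ↦ (n : ℝ))).comp
      ((measurable_displacement had hq ε k).mono (𝓖.le _) le_rfl).snd
  have h := integral_displacement_le hξ hq h2 hε k
  have h0 := integral_nonneg (μ := Q)
    (f := fun ω ↦ (ξ (q k) ω - (displacement ε (fun k ↦ ξ (q k) ω) k).1) ^ 2) fun ω ↦ sq_nonneg _
  have hi : Integrable (fun ω ↦ ((displacement ε (fun k ↦ ξ (q k) ω) k).2 : ℝ)) Q := by
    refine Integrable.of_bound (C := k) hm.aestronglyMeasurable (ae_of_all _ fun ω ↦ ?_)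
    rw [Real.norm_of_nonneg (Nat.cast_nonneg _)]
    exact_mod_cast displacement_snd_le k
  have h1 := mul_meas_ge_le_integral_of_nonneg (ae_of_all Q fun ω ↦ Nat.cast_nonneg
    (displacement ε (fun k ↦ ξ (q k) ω) k).2) hi n
  have h3 : (n : ℝ) * Q.real {ω | n ≤ (displacement ε (fun k ↦ ξ (q k) ω) k).2}
      ≤ (∫ ω, ξ (q k) ω ^ 2 ∂Q) / ε ^ 2 := by
    rw [le_div_iff₀ (by positivity)]
    simp only [Nat.cast_le] at h1
    have := mul_le_mul_of_nonneg_left h1 (sq_nonneg ε)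
    linarith
  have h4 := ENNReal.ofReal_le_ofReal h3
  rwa [ENNReal.ofReal_mul (Nat.cast_nonneg _), ENNReal.ofReal_natCast, ofReal_measureReal] at h4

end Counting

section Oscillation

/-- The path `x` makes at least `n` successive displacements by at least `ε`, between times of `E`,
before or at time `b`. -/
def Oscillates {ι : Type*} [Preorder ι] (x : ι → ℝ) (E : Set ι) (ε : ℝ) : ℕ → ι → Prop
  | 0, _ => True
  | n + 1, b => ∃ u ∈ E, ∃ v ∈ E, u < v ∧ v ≤ b ∧ ε ≤ |x v - x u| ∧ Oscillates x E ε n u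

variable {ι : Type*} [Preorder ι] {x : ι → ℝ} {ε : ℝ}

lemma Oscillates.mono_right {E : Set ι} {n : ℕ} {b c : ι} (hbc : b ≤ c)
    (h : Oscillates x E ε n b) : Oscillates x E ε n c := by
  cases n with
  | zero => trivial
  | succ n =>
    obtain ⟨u, hu, v, hv, huv, hvb, hx, h⟩ := h
    exact ⟨u, hu, v, hv, huv, hvb.trans hbc, hx, h⟩

lemma Oscillates.mono_eps {E : Set ι} {δ : ℝ} (hδ : δ ≤ ε) {n : ℕ} {b : ι}
    (h : Oscillates x E ε n b) : Oscillates x E δ n b := by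
  induction n generalizing b with
  | zero => trivial
  | succ n ih =>
    obtain ⟨u, hu, v, hv, huv, hvb, hx, h⟩ := h
    exact ⟨u, hu, v, hv, huv, hvb, hδ.trans hx, ih h⟩

lemma Oscillates.mono_set {E F : Set ι} (hEF : E ⊆ F) {n : ℕ} {b : ι}
    (h : Oscillates x E ε n b) : Oscillates x F ε n b := by
  induction n generalizing b with
  | zero => trivial
  | succ n ih =>
    obtain ⟨u, hu, v, hv, huv, hvb, hx, h⟩ := h
    exact ⟨u, hEF hu, v, hEF hv, huv, hvb, hx, ih h⟩

lemma Oscillates.exists_of_iUnion {E : ℕ → Set ι} (hE : Monotone E) {n : ℕ} {b : ι}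
    (h : Oscillates x (⋃ k, E k) ε n b) : ∃ k, Oscillates x (E k) ε n b := by
  induction n generalizing b with
  | zero => exact ⟨0, trivial⟩
  | succ n ih =>
    obtain ⟨u, hu, v, hv, huv, hvb, hx, h⟩ := h
    obtain ⟨i, hi⟩ := mem_iUnion.1 hu
    obtain ⟨j, hj⟩ := mem_iUnion.1 hv
    obtain ⟨k, hk⟩ := ih h
    have h1 : i ≤ max i (max j k) := le_max_left _ _
    have h2 : j ≤ max i (max j k) := (le_max_left _ _).trans (le_max_right _ _)
    have h3 : k ≤ max i (max j k) := (le_max_right _ _).trans (le_max_right _ _)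
    exact ⟨max i (max j k), u, hE h1 hi, v, hE h2 hj, huv, hvb, hx, hk.mono_set (hE h3)⟩

lemma Oscillates.le_displacement (hε : 0 < ε) {E : Set ι} {q : ℕ → ι}
    (hE : ∀ j, ∀ u ∈ E, u ≤ q j → ∃ i ≤ j, q i = u) {n j : ℕ}
    (h : Oscillates x E (2 * ε) n (q j)) : n ≤ (displacement ε (fun k ↦ x (q k)) j).2 := by
  induction n generalizing j with
  | zero => exact Nat.zero_le _
  | succ n ih =>
    obtain ⟨u, hu, v, hv, huv, hvb, hx, h⟩ := h
    obtain ⟨i', hi', rfl⟩ := hE j v hv hvb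
    obtain ⟨i, hi, rfl⟩ := hE i' u hu huv.le
    have h1 := displacement_snd_lt_of_le (y := fun k ↦ x (q k)) hε hi hx
    have h2 := monotone_displacement_snd (ε := ε) (y := fun k ↦ x (q k)) hi'
    have h3 := ih h
    dsimp only at h2
    omega

end Oscillation

/-- The dyadic times of level `n` in `[0, T)`. -/
def dyadicTimes (T : ℝ) (n : ℕ) : Set (Ico (0 : ℝ) T) := {t | ∃ k : ℕ, (t : ℝ) = k / 2 ^ n}

lemma monotone_dyadicTimes : Monotone (dyadicTimes T) := by
  refine monotone_nat_of_le_succ fun n ↦ ?_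
  rintro t ⟨k, hk⟩
  exact ⟨2 * k, by rw [hk, pow_succ]; push_cast; field_simp⟩

/-- The dyadic times of level `n` up to time `b`, followed by `b`. -/
noncomputable def dyadicGrid (b : Ico (0 : ℝ) T) (n k : ℕ) : Ico (0 : ℝ) T :=
  ⟨min (k / 2 ^ n) b, le_min (by positivity) b.2.1, min_lt_of_right_lt b.2.2⟩

lemma monotone_dyadicGrid (b : Ico (0 : ℝ) T) (n : ℕ) : Monotone (dyadicGrid b n) := by
  intro i j hij
  have : (i : ℝ) ≤ j := by exact_mod_cast hij
  exact Subtype.mk_le_mk.2 (min_le_min (by gcongr) le_rfl)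

lemma exists_dyadicGrid_eq (b : Ico (0 : ℝ) T) (n : ℕ) : ∃ k, dyadicGrid b n k = b := by
  refine ⟨⌈(b : ℝ) * 2 ^ n⌉₊, Subtype.ext (min_eq_right ?_)⟩
  rw [le_div_iff₀ (by positivity)]
  exact Nat.le_ceil _

lemma exists_dyadicGrid_eq_of_mem {b : Ico (0 : ℝ) T} {n j : ℕ} {u : Ico (0 : ℝ) T}
    (hu : u ∈ dyadicTimes T n) (h : u ≤ dyadicGrid b n j) : ∃ i ≤ j, dyadicGrid b n i = u := by
  obtain ⟨k, hk⟩ := hu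
  have h1 : (u : ℝ) ≤ min ((j : ℝ) / 2 ^ n) (b : ℝ) := h
  refine ⟨k, ?_, Subtype.ext ?_⟩
  · have := h1.trans (min_le_left _ _)
    rw [hk, div_le_div_iff_of_pos_right (by positivity)] at this
    exact_mod_cast this
  · change min ((k : ℝ) / 2 ^ n) b = u
    rw [← hk]
    exact min_eq_left (h1.trans (min_le_right _ _))

/-- Before a fixed time, almost every path of a square-integrable martingale makes only finitely
many `ε`-displacements along the dyadic times. -/
lemma measure_oscillates_eq_zero [IsProbabilityMeasure Q] {𝓖 : Filtration (Ico (0 : ℝ) T) m}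
    {ξ : Ico (0 : ℝ) T → Ω → ℝ} (hξ : Martingale ξ 𝓖 Q) (h2 : ∀ t, MemLp (ξ t) 2 Q) {ε : ℝ}
    (hε : 0 < ε) (b : Ico (0 : ℝ) T) :
    Q {ω | ∀ n, Oscillates (fun t ↦ ξ t ω) (⋃ k, dyadicTimes T k) (2 * ε) n b} = 0 := by
  set A : ℕ → ℕ → Set Ω := fun n k ↦ {ω | Oscillates (fun t ↦ ξ t ω) (dyadicTimes T k) (2 * ε) n b}
  set C := ENNReal.ofReal ((∫ ω, ξ b ω ^ 2 ∂Q) / ε ^ 2)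
  have h1 : ∀ n k, n * Q (A n k) ≤ C := by
    intro n k
    obtain ⟨j, hj⟩ := exists_dyadicGrid_eq b k
    have h := measure_displacement_le hξ (monotone_dyadicGrid b k) (fun _ ↦ h2 _) hε j n
    rw [hj] at h
    refine le_trans ?_ h
    gcongr
    intro ω hω
    exact Oscillates.le_displacement (x := fun t ↦ ξ t ω) hε
      (fun j u hu h ↦ exists_dyadicGrid_eq_of_mem hu h) (hj.symm ▸ hω)
  have h3 : ∀ n, n * Q (⋃ k, A n k) ≤ C := by
    intro n
    have hmono : Monotone (A n) := fun i j hij ω hω ↦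
      Oscillates.mono_set (monotone_dyadicTimes hij) hω
    rw [hmono.measure_iUnion, ENNReal.mul_iSup]
    exact iSup_le fun k ↦ h1 n k
  have h4 : ∀ n : ℕ, n * Q {ω | ∀ n, Oscillates (fun t ↦ ξ t ω) (⋃ k, dyadicTimes T k) (2 * ε) n b}
      ≤ C := by
    intro n
    refine le_trans ?_ (h3 n)
    gcongr
    intro ω hω
    exact mem_iUnion.2 ((hω n).exists_of_iUnion monotone_dyadicTimes)
  by_contra hne
  obtain ⟨n, hn⟩ := ENNReal.exists_nat_mul_gt hne (b := C) ENNReal.ofReal_ne_top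
  exact absurd (h4 n) (not_le.2 hn)

end AlmgrenChriss

namespace AlmgrenChriss

/-! ### Right-continuous versions of square-integrable martingales -/

section Limits

variable {ι : Type*} [LinearOrder ι] {x : ι → ℝ} {D : Set ι}

lemma exists_tendsto_of_forall_exists {α : Type*} {l : Filter α} {f : α → ℝ}
    (h : ∀ ε > 0, ∃ s ∈ l, ∀ u ∈ s, ∀ v ∈ s, |f v - f u| < ε) : ∃ a, Tendsto f l (𝓝 a) := by
  rcases l.eq_or_neBot with rfl | hl
  · exact ⟨0, tendsto_bot⟩
  · refine cauchy_map_iff_exists_tendsto.1 (Metric.cauchy_iff.2 ⟨inferInstance, fun ε hε ↦ ?_⟩)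
    obtain ⟨s, hs, h⟩ := h ε hε
    refine ⟨f '' s, image_mem_map hs, ?_⟩
    rintro _ ⟨u, hu, rfl⟩ _ ⟨v, hv, rfl⟩
    rw [Real.dist_eq, abs_sub_comm]
    exact h u hu v hv

lemma exists_lt_of_forall_not {s : Set ι} {ε : ℝ} (hε : 0 < ε)
    (h : ¬∀ u ∈ s, ∀ v ∈ s, |x v - x u| < ε) : ∃ u ∈ s, ∃ v ∈ s, u < v ∧ ε ≤ |x v - x u| := by
  push Not at h
  obtain ⟨u, hu, v, hv, h⟩ := h
  rcases lt_trichotomy u v with h1 | rfl | h1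
  · exact ⟨u, hu, v, hv, h1, h⟩
  · simp at h; linarith
  · exact ⟨v, hv, u, hu, h1, by rwa [abs_sub_comm]⟩

variable [TopologicalSpace ι] [OrderTopology ι]

/-- A path with finitely many displacements before each time has limits from the right: otherwise
it would oscillate arbitrarily often in each right neighbourhood. -/
lemma exists_tendsto_right [NoMaxOrder ι] (h : ∀ ε > 0, ∀ b, ∃ n, ¬Oscillates x D ε n b) (t : ι) :
    ∃ a, Tendsto x (𝓝[D ∩ Ioi t] t) (𝓝 a) := by
  refine exists_tendsto_of_forall_exists fun ε hε ↦ ?_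
  by_contra hcon
  have h1 : ∀ c > t, ∃ u ∈ D ∩ Ioo t c, ∃ v ∈ D ∩ Ioo t c, u < v ∧ ε ≤ |x v - x u| := by
    intro c hc
    refine exists_lt_of_forall_not hε fun h2 ↦ hcon ⟨D ∩ Ioo t c, ?_, h2⟩
    rw [← Ioi_inter_Iio, ← inter_assoc]
    exact inter_mem_nhdsWithin _ (Iio_mem_nhds hc)
  have h3 : ∀ n, ∀ c > t, Oscillates x D ε n c := by
    intro n
    induction n with
    | zero => exact fun _ _ ↦ trivial
    | succ n ih =>
      intro c hc
      obtain ⟨u, hu, v, hv, huv, hx⟩ := h1 c hc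
      exact ⟨u, hu.1, v, hv.1, huv, hv.2.2.le, hx, ih u hu.2.1⟩
  obtain ⟨b, hb⟩ := exists_gt t
  obtain ⟨n, hn⟩ := h ε hε b
  exact hn (h3 n b hb)

lemma exists_tendsto_left (h : ∀ ε > 0, ∀ b, ∃ n, ¬Oscillates x D ε n b) (t : ι) :
    ∃ a, Tendsto x (𝓝[D ∩ Iio t] t) (𝓝 a) := by
  refine exists_tendsto_of_forall_exists fun ε hε ↦ ?_
  by_contra hcon
  have h1 : ∀ c < t, ∃ u ∈ D ∩ Ioo c t, ∃ v ∈ D ∩ Ioo c t, u < v ∧ ε ≤ |x v - x u| := by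
    intro c hc
    refine exists_lt_of_forall_not hε fun h2 ↦ hcon ⟨D ∩ Ioo c t, ?_, h2⟩
    rw [← Ioi_inter_Iio, inter_comm (Ioi c), ← inter_assoc]
    exact inter_mem_nhdsWithin _ (Ioi_mem_nhds hc)
  have h0 : ∃ c, c < t := by
    by_contra h0
    push Not at h0
    have : D ∩ Iio t = ∅ := eq_empty_of_forall_notMem fun s hs ↦ (h0 s).not_gt hs.2
    exact hcon ⟨∅, by simp [this], by simp⟩
  have h3 : ∀ n, ∃ c < t, Oscillates x D ε n c := by
    intro n
    induction n with
    | zero => exact ⟨_, h0.choose_spec, trivial⟩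
    | succ n ih =>
      obtain ⟨c, hc, hO⟩ := ih
      obtain ⟨u, hu, v, hv, huv, hx⟩ := h1 c hc
      exact ⟨v, hv.2.2, u, hu.1, v, hv.1, huv, le_rfl, hx, hO.mono_right hu.2.1.le⟩
  obtain ⟨n, hn⟩ := h ε hε t
  obtain ⟨c, hc, hO⟩ := h3 n
  exact hn (hO.mono_right hc.le)

variable [NoMaxOrder ι]

lemma nhdsWithin_inter_Ioi_neBot (hD : ∀ t c : ι, t < c → ∃ d ∈ D, t < d ∧ d < c) (t : ι) :
    (𝓝[D ∩ Ioi t] t).NeBot := by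
  rw [← mem_closure_iff_nhdsWithin_neBot, mem_closure_iff]
  intro o ho hto
  obtain ⟨c, hc, hco⟩ := exists_Ico_subset_of_mem_nhds (ho.mem_nhds hto) (exists_gt t)
  obtain ⟨d, hd, htd, hdc⟩ := hD t c hc
  exact ⟨d, hco ⟨htd.le, hdc⟩, hd, htd⟩

/-- Taking right limits along a dense set of times preserves one-sided limits. -/
lemma tendsto_limUnder_of_tendsto (hD : ∀ t c : ι, t < c → ∃ d ∈ D, t < d ∧ d < c)
    (h : ∀ t, ∃ a, Tendsto x (𝓝[D ∩ Ioi t] t) (𝓝 a)) {U : Set ι} (hU : IsOpen U) {t : ι} {a : ℝ}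
    (ha : Tendsto x (𝓝[D ∩ U] t) (𝓝 a)) :
    Tendsto (fun s ↦ limUnder (𝓝[D ∩ Ioi s] s) x) (𝓝[U] t) (𝓝 a) := by
  rw [(closed_nhds_basis a).tendsto_right_iff]
  rintro K ⟨hKa, hK⟩
  obtain ⟨V, hV, htV, hVK⟩ := mem_nhdsWithin.1 (ha hKa)
  filter_upwards [mem_nhdsWithin.2 ⟨V, hV, htV, Subset.rfl⟩] with s hs
  have := nhdsWithin_inter_Ioi_neBot hD s
  refine hK.mem_of_tendsto (tendsto_nhds_limUnder (h s)) ?_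
  refine mem_nhdsWithin.2 ⟨V ∩ U, hV.inter hU, hs, fun r hr ↦ hVK ⟨hr.1.1, hr.2.1, hr.1.2⟩⟩

lemma isRCLL_limUnder (hD : ∀ t c : ι, t < c → ∃ d ∈ D, t < d ∧ d < c)
    (h : ∀ ε > 0, ∀ b, ∃ n, ¬Oscillates x D ε n b) :
    IsRCLL fun s ↦ limUnder (𝓝[D ∩ Ioi s] s) x := by
  intro t
  have hr := exists_tendsto_right h
  refine ⟨continuousWithinAt_Ioi_iff_Ici.1 ?_, ?_⟩
  · exact tendsto_limUnder_of_tendsto hD hr isOpen_Ioi (tendsto_nhds_limUnder (hr t))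
  · obtain ⟨a, ha⟩ := exists_tendsto_left h t
    exact ⟨a, tendsto_limUnder_of_tendsto hD hr isOpen_Iio ha⟩

end Limits

variable {Ω : Type*} {m : MeasurableSpace Ω} {T : ℝ} {P Q : Measure Ω}
  {𝓕 : Filtration (Icc (0 : ℝ) T) m}

lemma exists_dyadicTimes_between (t c : Ico (0 : ℝ) T) (h : t < c) :
    ∃ d ∈ ⋃ k, dyadicTimes T k, t < d ∧ d < c := by
  have h' : (0 : ℝ) < c - t := sub_pos.2 h
  obtain ⟨n, hn⟩ := exists_pow_lt_of_lt_one h' (one_half_lt_one (α := ℝ))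
  have h2 : (0 : ℝ) < 2 ^ n := by positivity
  set k := ⌊(t : ℝ) * 2 ^ n⌋₊ + 1 with hk
  have h3 : (t : ℝ) < (k : ℝ) / 2 ^ n := by
    rw [lt_div_iff₀ h2, hk]; push_cast; exact Nat.lt_floor_add_one _
  have h4 : (k : ℝ) / 2 ^ n < c := by
    have h5 : (⌊(t : ℝ) * 2 ^ n⌋₊ : ℝ) ≤ t * 2 ^ n := Nat.floor_le (mul_nonneg t.2.1 h2.le)
    have h6 : (k : ℝ) / 2 ^ n ≤ t + (1 / 2) ^ n := by
      rw [div_le_iff₀ h2, add_mul, ← mul_pow, hk]; push_cast; norm_num; linarith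
    linarith
  exact ⟨⟨k / 2 ^ n, by positivity, h4.trans c.2.2⟩, mem_iUnion.2 ⟨n, k, rfl⟩, h3, h4⟩

/-- The right-continuity of the filtration, for random variables. -/
lemma UsualConditions.measurable_of_forall_gt {hT : 0 < T} (h𝓕 : UsualConditions P hT 𝓕)
    {t : Ico (0 : ℝ) T} {f : Ω → ℝ} (hf : ∀ u, t < u → Measurable[𝓕 (toIcc u)] f) :
    Measurable[𝓕 (toIcc t)] f := by
  have := h𝓕.rightContinuous
  intro s hs
  refine Filtration.IsRightContinuous.measurableSet ?_
  have hmax : ¬IsMax (toIcc t) := fun h ↦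
    absurd (h (show toIcc t ≤ lastIcc hT from t.2.2.le)) (not_le.2 t.2.2)
  rw [Filtration.rightCont_eq_of_not_isMax _ hmax]
  refine MeasurableSpace.measurableSet_iInf.2 fun j ↦
    MeasurableSpace.measurableSet_iInf.2 fun hj ↦ ?_
  obtain ⟨r, hr1, hr2⟩ := exists_between (show (t : ℝ) < (j : ℝ) from hj)
  have hr : r ∈ Ico (0 : ℝ) T := ⟨t.2.1.trans hr1.le, hr2.trans_le j.2.2⟩
  exact 𝓕.mono (show toIcc ⟨r, hr⟩ ≤ j from hr2.le) _ (hf ⟨r, hr⟩ hr1 hs)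

/-- If a square-integrable martingale converges almost surely along times decreasing to `t`, then
the limit is its value at `t`, provided that it is measurable at time `t`. -/
lemma ae_eq_of_tendsto_right [IsProbabilityMeasure Q] {ι : Type*} [Preorder ι] {𝓖 : Filtration ι m}
    {ξ : ι → Ω → ℝ} (hξ : Martingale ξ 𝓖 Q) {t b : ι} {d : ℕ → ι} (htd : ∀ n, t ≤ d n)
    (hdb : ∀ n, d n ≤ b) {f : Ω → ℝ} (hf : Measurable[𝓖 t] f)
    (hlim : ∀ᵐ ω ∂Q, Tendsto (fun n ↦ ξ (d n) ω) atTop (𝓝 (f ω))) : f =ᵐ[Q] ξ t := by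
  set F : ℕ → Ω → ℝ := fun n ↦ Q[ξ b | 𝓖 (d n)] with hF
  have hFξ : ∀ n, F n =ᵐ[Q] ξ (d n) := fun n ↦ hξ.condExp_ae_eq (hdb n)
  have hui : UniformIntegrable F 1 Q :=
    (hξ.integrable b).uniformIntegrable_condExp fun n ↦ 𝓖.le (d n)
  have hFlim : ∀ᵐ ω ∂Q, Tendsto (fun n ↦ F n ω) atTop (𝓝 (f ω)) := by
    filter_upwards [hlim, ae_all_iff.2 hFξ] with ω h1 h2
    simpa only [h2] using h1
  have hfm : Measurable f := hf.mono (𝓖.le t) le_rfl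
  have hf1 : MemLp f 1 Q := hui.memLp_of_ae_tendsto hFlim
  have hL1 := tendsto_Lp_finite_of_tendsto_ae le_rfl ENNReal.one_ne_top hui.1 hf1 hui.2.1 hFlim
  have h := ae_eq_condExp_of_forall_setIntegral_eq (𝓖.le t) (hξ.integrable t)
    (fun s _ _ ↦ (hf1.integrable le_rfl).integrableOn) (fun s hs _ ↦ ?_)
    hf.stronglyMeasurable.aestronglyMeasurable
  · exact h.trans (hξ.condExp_ae_eq le_rfl)
  · refine tendsto_nhds_unique (tendsto_setIntegral_of_L1' f hf1.1
      (Eventually.of_forall fun n ↦ integrable_condExp) hL1 s) ?_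
    have : ∀ n, ∫ ω in s, F n ω ∂Q = ∫ ω in s, ξ t ω ∂Q := fun n ↦ by
      rw [hξ.setIntegral_eq (htd n) hs]
      exact setIntegral_congr_ae (𝓖.le t s hs) ((hFξ n).mono fun ω h _ ↦ h)
    exact tendsto_const_nhds.congr fun n ↦ (this n).symm

/-- Under the usual conditions, a square-integrable martingale on `[0, T)` has a version with
right-continuous paths with left limits. -/
theorem exists_rcll_version [IsProbabilityMeasure Q] {hT : 0 < T} (h𝓕 : UsualConditions P hT 𝓕)
    (hPQ : P ≪ Q) {ξ : Ico (0 : ℝ) T → Ω → ℝ} (hξ : Martingale ξ (restrictIco 𝓕) Q)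
    (h2 : ∀ t, MemLp (ξ t) 2 Q) :
    ∃ N, Martingale N (restrictIco 𝓕) Q ∧ (∀ ω, IsRCLL fun t ↦ N t ω) ∧ ∀ t, N t =ᵐ[Q] ξ t := by
  classical
  set D : Set (Ico (0 : ℝ) T) := ⋃ k, dyadicTimes T k with hDdef
  have hD : ∀ t c : Ico (0 : ℝ) T, t < c → ∃ d ∈ D, t < d ∧ d < c := exists_dyadicTimes_between
  have hmax : NoMaxOrder (Ico (0 : ℝ) T) := ⟨fun t ↦ by
    obtain ⟨r, hr1, hr2⟩ := exists_between t.2.2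
    exact ⟨⟨r, t.2.1.trans hr1.le, hr2⟩, hr1⟩⟩
  -- the event that every number of displacements is finite, which has full measure
  set G : Set Ω := {ω | ∀ i j : ℕ, ∃ n,
    ¬Oscillates (fun t ↦ ξ t ω) D (2 * (1 / ((i : ℝ) + 1))) n (approachLast hT j)} with hG
  have hGQ : Q Gᶜ = 0 := by
    have : Gᶜ = ⋃ i : ℕ, ⋃ j : ℕ, {ω | ∀ n,
        Oscillates (fun t ↦ ξ t ω) D (2 * (1 / ((i : ℝ) + 1))) n (approachLast hT j)} := by
      ext ω; simp [hG]
    rw [this]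
    exact measure_iUnion_null fun i ↦ measure_iUnion_null fun j ↦
      measure_oscillates_eq_zero hξ h2 (by positivity) _
  -- completeness puts this event into the initial σ-algebra
  have hGm : ∀ t : Icc (0 : ℝ) T, MeasurableSet[𝓕 t] G := fun t ↦ by
    have h := h𝓕.complete Gᶜ (hPQ hGQ)
    exact 𝓕.mono (show zeroIcc hT ≤ t from t.2.1) _ (compl_compl G ▸ h.compl)
  have hosc : ∀ ω ∈ G, ∀ ε > 0, ∀ b, ∃ n, ¬Oscillates (fun t ↦ ξ t ω) D ε n b := by
    intro ω hω ε hε b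
    obtain ⟨i, hi⟩ := exists_nat_one_div_lt (half_pos hε)
    obtain ⟨j, hj⟩ := exists_lt_approachLast hT b.2.2
    obtain ⟨n, hn⟩ := hω i j
    refine ⟨n, fun h ↦ hn ?_⟩
    refine Oscillates.mono_right (show b ≤ approachLast hT j from hj.le) ?_
    exact h.mono_eps (by linarith)
  set N : Ico (0 : ℝ) T → Ω → ℝ := fun t ω ↦
    if ω ∈ G then limUnder (𝓝[D ∩ Ioi t] t) (fun s ↦ ξ s ω) else 0 with hN
  have hNrcll : ∀ ω, IsRCLL fun t ↦ N t ω := by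
    intro ω
    by_cases hω : ω ∈ G
    · simp only [hN, if_pos hω]
      exact isRCLL_limUnder hD (hosc ω hω)
    · simp only [hN, if_neg hω]
      exact fun t ↦ ⟨continuousWithinAt_const, 0, tendsto_const_nhds⟩
  have hseq : ∀ t : Ico (0 : ℝ) T, ∃ d : ℕ → Ico (0 : ℝ) T, Tendsto d atTop (𝓝[D ∩ Ioi t] t) ∧
      ∀ ω ∈ G, Tendsto (fun n ↦ ξ (d n) ω) atTop (𝓝 (N t ω)) := by
    intro t
    have := nhdsWithin_inter_Ioi_neBot hD t
    obtain ⟨d, hd⟩ := exists_seq_tendsto (𝓝[D ∩ Ioi t] t)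
    refine ⟨d, hd, fun ω hω ↦ ?_⟩
    simp only [hN, if_pos hω]
    exact (tendsto_nhds_limUnder (exists_tendsto_right (hosc ω hω) t)).comp hd
  -- the same along times before a given `u > t`
  have hshift : ∀ t u : Ico (0 : ℝ) T, t < u → ∃ d : ℕ → Ico (0 : ℝ) T, (∀ n, t < d n ∧ d n < u) ∧
      ∀ ω ∈ G, Tendsto (fun n ↦ ξ (d n) ω) atTop (𝓝 (N t ω)) := by
    intro t u htu
    obtain ⟨d, hd, hlim⟩ := hseq t
    have h1 : ∀ᶠ n in atTop, d n ∈ (D ∩ Ioi t) ∩ Iio u :=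
      hd (inter_mem_nhdsWithin _ (Iio_mem_nhds htu))
    obtain ⟨K, hK⟩ := eventually_atTop.1 h1
    exact ⟨fun n ↦ d (n + K), fun n ↦ ⟨(hK _ (Nat.le_add_left _ _)).1.2,
      (hK _ (Nat.le_add_left _ _)).2⟩, fun ω hω ↦ (hlim ω hω).comp (tendsto_add_atTop_nat K)⟩
  have hNmeas : ∀ t, Measurable[𝓕 (toIcc t)] (N t) := by
    intro t
    refine h𝓕.measurable_of_forall_gt fun u htu ↦ ?_
    obtain ⟨d, hd, hlim⟩ := hshift t u htu
    refine @measurable_of_tendsto_metrizable Ω ℝ (𝓕 (toIcc u)) _ _ _ _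
      (fun n ω ↦ if ω ∈ G then ξ (d n) ω else 0) (N t) (fun n ↦ ?_) (tendsto_pi_nhds.2 fun ω ↦ ?_)
    · exact Measurable.ite (hGm _) (((hξ.stronglyMeasurable (d n)).measurable).mono
        (𝓕.mono (show toIcc (d n) ≤ toIcc u from (hd n).2.le)) le_rfl) measurable_const
    · by_cases hω : ω ∈ G
      · simpa only [if_pos hω] using hlim ω hω
      · simp only [if_neg hω, hN, tendsto_const_nhds]
  have hNξ : ∀ t, N t =ᵐ[Q] ξ t := by
    intro t
    obtain ⟨u, htu⟩ := exists_gt t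
    obtain ⟨d, hd, hlim⟩ := hshift t u htu
    refine ae_eq_of_tendsto_right hξ (fun n ↦ (hd n).1.le) (fun n ↦ (hd n).2.le) (hNmeas t) ?_
    filter_upwards [compl_mem_ae_iff.2 hGQ] with ω hω
    exact hlim ω (not_not.1 hω)
  refine ⟨N, ⟨fun t ↦ (hNmeas t).stronglyMeasurable, fun s t hst ↦ ?_⟩, hNrcll, hNξ⟩
  exact (condExp_congr_ae (hNξ t)).trans ((hξ.2 s t hst).trans (hNξ s).symm)

end AlmgrenChriss

namespace AlmgrenChriss

/-! ### Processes orthogonal to round trips are martingales -/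

variable {Ω : Type*} {m : MeasurableSpace Ω} {T : ℝ} {P Q : Measure Ω}
  {𝓕 : Filtration (Icc (0 : ℝ) T) m} {Y : Icc (0 : ℝ) T → Ω → ℝ}

lemma sq_integral_le {α : Type*} {mα : MeasurableSpace α} {μ : Measure α} [IsFiniteMeasure μ]
    {f : α → ℝ} (hf : MemLp f 2 μ) : (∫ x, f x ∂μ) ^ 2 ≤ μ.real univ * ∫ x, f x ^ 2 ∂μ := by
  have hi := hf.integrable one_le_two
  have h : ∀ c : ℝ, 0 ≤ ∫ x, f x ^ 2 ∂μ - 2 * c * ∫ x, f x ∂μ + c ^ 2 * μ.real univ := by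
    intro c
    have h0 := integral_nonneg (μ := μ) (f := fun x ↦ (f x - c) ^ 2) fun x ↦ sq_nonneg _
    have i1 : Integrable (fun x ↦ f x ^ 2 - 2 * c * f x) μ := hf.integrable_sq.sub (hi.const_mul _)
    have e : ∫ x, (f x - c) ^ 2 ∂μ = ∫ x, (f x ^ 2 - 2 * c * f x + c ^ 2) ∂μ :=
      integral_congr_ae (ae_of_all _ fun x ↦ by ring)
    rw [e, integral_add i1 (integrable_const _), integral_sub hf.integrable_sq (hi.const_mul _),
      integral_const_mul, integral_const, smul_eq_mul, mul_comm (μ.real univ)] at h0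
    exact h0
  have hμ : 0 ≤ μ.real univ := measureReal_nonneg
  rcases hμ.eq_or_lt with h0 | h0
  · have : μ = 0 := by
      rw [← Measure.measure_univ_eq_zero]
      exact (measureReal_eq_zero_iff).1 h0.symm
    simp [this]
  · have := mul_nonneg h0.le (h ((∫ x, f x ∂μ) / μ.real univ))
    have e : μ.real univ * (∫ x, f x ^ 2 ∂μ - 2 * ((∫ x, f x ∂μ) / μ.real univ) * ∫ x, f x ∂μ
        + ((∫ x, f x ∂μ) / μ.real univ) ^ 2 * μ.real univ)
        = μ.real univ * ∫ x, f x ^ 2 ∂μ - (∫ x, f x ∂μ) ^ 2 := by field_simp; ring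
    linarith

lemma memLp_integral_left {α : Type*} {mα : MeasurableSpace α} {μ : Measure α} [IsFiniteMeasure μ]
    [IsFiniteMeasure Q] {f : α → Ω → ℝ} (hf : MemLp (fun p : α × Ω ↦ f p.1 p.2) 2 (μ.prod Q)) :
    MemLp (fun ω ↦ ∫ x, f x ω ∂μ) 2 Q := by
  have hi := hf.integrable one_le_two
  have hm : AEStronglyMeasurable (fun ω ↦ ∫ x, f x ω ∂μ) Q := hi.integral_prod_right.1
  rw [memLp_two_iff_integrable_sq hm]
  refine (hf.integrable_sq.integral_prod_right.const_mul (μ.real univ)).mono' (hm.pow 2) ?_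
  filter_upwards [hf.integrable_sq.prod_left_ae, hi.prod_left_ae] with ω h1 h2
  rw [Real.norm_of_nonneg (sq_nonneg _)]
  exact sq_integral_le ((memLp_two_iff_integrable_sq h2.1).2 h1)

lemma prod_restrict_left (s : Set (Icc (0 : ℝ) T)) [SFinite Q] :
    ((leb (Icc (0 : ℝ) T)).restrict s).prod Q = ((leb (Icc 0 T)).prod Q).restrict (s ×ˢ univ) := by
  rw [← Measure.prod_restrict, Measure.restrict_univ]

section

variable [IsProbabilityMeasure Q]

lemma memLp_setIntegral_path (hY2 : MemLp (fun p : Icc (0 : ℝ) T × Ω ↦ Y p.1 p.2) 2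
    ((leb (Icc 0 T)).prod Q)) (s : Set (Icc (0 : ℝ) T)) :
    MemLp (fun ω ↦ ∫ u in s, Y u ω ∂leb (Icc 0 T)) 2 Q := by
  refine memLp_integral_left ?_
  rw [prod_restrict_left]
  exact hY2.restrict _

lemma integral_indicator_Ici_mul (hY2 : MemLp (fun p : Icc (0 : ℝ) T × Ω ↦ Y p.1 p.2) 2
    ((leb (Icc 0 T)).prod Q)) (s : Icc (0 : ℝ) T) {g : Ω → ℝ} (hg : Measurable g) {K : ℝ}
    (hK : ∀ ω, |g ω| ≤ K) :
    Integrable (fun p : Icc (0 : ℝ) T × Ω ↦ (if s ≤ p.1 then g p.2 else 0) * Y p.1 p.2)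
      ((leb (Icc 0 T)).prod Q) ∧
    ∫ p, (if s ≤ p.1 then g p.2 else 0) * Y p.1 p.2 ∂((leb (Icc 0 T)).prod Q)
      = ∫ ω, g ω * ∫ u in Ici s, Y u ω ∂leb (Icc 0 T) ∂Q := by
  have hi : Integrable (fun p : Icc (0 : ℝ) T × Ω ↦ (if s ≤ p.1 then g p.2 else 0) * Y p.1 p.2)
      ((leb (Icc 0 T)).prod Q) := by
    refine (hY2.integrable one_le_two).bdd_mul (c := K) ?_ (ae_of_all _ fun p ↦ ?_)
    · exact (Measurable.ite (measurableSet_Ici.preimage measurable_fst)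
        (hg.comp measurable_snd) measurable_const).aestronglyMeasurable
    · split_ifs
      · exact hK _
      · simpa using (abs_nonneg _).trans (hK p.2)
  refine ⟨hi, ?_⟩
  rw [integral_prod_symm _ hi]
  refine integral_congr_ae (ae_of_all _ fun ω ↦ ?_)
  dsimp only
  rw [← integral_const_mul, ← integral_indicator measurableSet_Ici]
  refine integral_congr_ae (ae_of_all _ fun u ↦ ?_)
  by_cases h : s ≤ u <;> simp [h]

end

/-- The future average of a process `Y` over `[t, T]`. -/
noncomputable def futureMean (Y : Icc (0 : ℝ) T → Ω → ℝ) (t : Ico (0 : ℝ) T) (ω : Ω) : ℝ :=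
  (T - t)⁻¹ * ∫ u in Ici (toIcc t), Y u ω ∂leb (Icc 0 T)

/-- `Y` is orthogonal to the round trips, the bounded optional processes `η` with
`∫₀ᵀ η_t dt = 0`. -/
def OrthogonalToRoundTrips (𝓕 : Filtration (Icc (0 : ℝ) T) m) (Q : Measure Ω)
    (Y : Icc (0 : ℝ) T → Ω → ℝ) : Prop :=
  ∀ (η : Icc (0 : ℝ) T → Ω → ℝ) (K : ℝ), IsOptional 𝓕 η → (∀ t ω, |η t ω| ≤ K) →
    (∀ ω, ∫ t, η t ω ∂leb (Icc 0 T) = 0) →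
    ∫ p, η p.1 p.2 * Y p.1 p.2 ∂((leb (Icc 0 T)).prod Q) = 0

lemma integral_ite_Ici (s : Icc (0 : ℝ) T) (c : ℝ) :
    ∫ u, (if s ≤ u then c else 0) ∂leb (Icc 0 T) = (T - s) * c := by
  have : (fun u ↦ if s ≤ u then c else 0) = (Ici s).indicator fun _ ↦ c := by
    ext u; by_cases h : s ≤ u <;> simp [h]
  rw [this, integral_indicator_const _ measurableSet_Ici, leb_real_Ici, smul_eq_mul]

variable [IsProbabilityMeasure Q]

lemma memLp_futureMean (hY2 : MemLp (fun p : Icc (0 : ℝ) T × Ω ↦ Y p.1 p.2) 2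
    ((leb (Icc 0 T)).prod Q)) (t : Ico (0 : ℝ) T) : MemLp (futureMean Y t) 2 Q :=
  (memLp_setIntegral_path hY2 _).const_mul _

/-- Testing orthogonality with the round trips that move a position held over `[s, T]` to
`[t, T]`. -/
lemma OrthogonalToRoundTrips.setIntegral_futureMean (h : OrthogonalToRoundTrips 𝓕 Q Y)
    (hY2 : MemLp (fun p : Icc (0 : ℝ) T × Ω ↦ Y p.1 p.2) 2 ((leb (Icc 0 T)).prod Q))
    {s t : Ico (0 : ℝ) T} (hst : s ≤ t) {A : Set Ω} (hA : MeasurableSet[𝓕 (toIcc s)] A) :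
    ∫ ω in A, futureMean Y s ω ∂Q = ∫ ω in A, futureMean Y t ω ∂Q := by
  have hA' : MeasurableSet A := 𝓕.le _ _ hA
  have hgm : ∀ (r : Ico (0 : ℝ) T), s ≤ r →
      Measurable[𝓕 (toIcc r)] (A.indicator fun _ ↦ (T - (r : ℝ))⁻¹) := fun r hr ↦
    measurable_const.indicator (𝓕.mono (show toIcc s ≤ toIcc r from hr) _ hA)
  have hgb : ∀ (r : Ico (0 : ℝ) T) ω, |A.indicator (fun _ ↦ (T - (r : ℝ))⁻¹) ω|
      ≤ (T - (r : ℝ))⁻¹ := fun r ω ↦ by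
    have : 0 ≤ (T - (r : ℝ))⁻¹ := inv_nonneg.2 (sub_nonneg.2 r.2.2.le)
    by_cases hω : ω ∈ A <;> simp [hω, abs_of_nonneg this, this]
  have key : ∀ r : Ico (0 : ℝ) T, ∫ ω in A, futureMean Y r ω ∂Q
      = ∫ ω, A.indicator (fun _ ↦ (T - (r : ℝ))⁻¹) ω
        * ∫ u in Ici (toIcc r), Y u ω ∂leb (Icc 0 T) ∂Q := by
    intro r
    rw [← integral_indicator hA']
    refine integral_congr_ae (ae_of_all _ fun ω ↦ ?_)
    by_cases hω : ω ∈ A <;> simp [hω, futureMean]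
  have hone : ∀ (r : Ico (0 : ℝ) T) ω, ∫ u, (if toIcc r ≤ u
      then A.indicator (fun _ ↦ (T - (r : ℝ))⁻¹) ω else 0) ∂leb (Icc 0 T)
      = A.indicator (fun _ ↦ (1 : ℝ)) ω := by
    intro r ω
    rw [integral_ite_Ici]
    have : T - (r : ℝ) ≠ 0 := (sub_pos.2 r.2.2).ne'
    by_cases hω : ω ∈ A <;> simp [hω, toIcc, this]
  obtain ⟨is, es⟩ := integral_indicator_Ici_mul hY2 (toIcc s)
    ((hgm s le_rfl).mono (𝓕.le _) le_rfl) (hgb s)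
  obtain ⟨it, et⟩ := integral_indicator_Ici_mul hY2 (toIcc t)
    ((hgm t hst).mono (𝓕.le _) le_rfl) (hgb t)
  have os := isOptional_indicator_Ici (toIcc s) (hgm s le_rfl)
  have ot := isOptional_indicator_Ici (toIcc t) (hgm t hst)
  have hb : ∀ (r : Ico (0 : ℝ) T) (u : Icc (0 : ℝ) T) ω, |if toIcc r ≤ u
      then A.indicator (fun _ ↦ (T - (r : ℝ))⁻¹) ω else 0| ≤ (T - (r : ℝ))⁻¹ := by
    intro r u ω
    split_ifs
    · exact hgb r ω
    · simpa using (abs_nonneg _).trans (hgb r ω)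
  have hi : ∀ (r : Ico (0 : ℝ) T) ω, Integrable (fun u ↦ if toIcc r ≤ u
      then A.indicator (fun _ ↦ (T - (r : ℝ))⁻¹) ω else 0) (leb (Icc 0 T)) := fun r ω ↦
    Integrable.of_bound (Measurable.ite measurableSet_Ici measurable_const
      measurable_const).aestronglyMeasurable _ (ae_of_all _ fun u ↦ hb r u ω)
  -- the round trip `1_A ((T - s)⁻¹ 1_{[s, T]} - (T - t)⁻¹ 1_{[t, T]})`
  have h0 := h _ ((T - (s : ℝ))⁻¹ + (T - (t : ℝ))⁻¹) (os.sub ot)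
    (fun u ω ↦ (abs_sub _ _).trans (add_le_add (hb s u ω) (hb t u ω)))
    (fun ω ↦ by rw [integral_sub (hi s ω) (hi t ω), hone, hone, sub_self])
  simp only [sub_mul] at h0
  rw [integral_sub is it, es, et, ← key, ← key] at h0
  exact sub_eq_zero.1 h0

/-- The martingale of the conditional expectations of the future averages. -/
lemma OrthogonalToRoundTrips.martingale (h : OrthogonalToRoundTrips 𝓕 Q Y)
    (hY2 : MemLp (fun p : Icc (0 : ℝ) T × Ω ↦ Y p.1 p.2) 2 ((leb (Icc 0 T)).prod Q)) :
    Martingale (fun t : Ico (0 : ℝ) T ↦ Q[futureMean Y t | 𝓕 (toIcc t)]) (restrictIco 𝓕) Q := by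
  refine ⟨fun t ↦ stronglyMeasurable_condExp, fun s t hst ↦ ?_⟩
  have hle : 𝓕 (toIcc s) ≤ 𝓕 (toIcc t) := 𝓕.mono hst
  refine (condExp_condExp_of_le hle (𝓕.le _)).trans ?_
  refine ae_eq_condExp_of_forall_setIntegral_eq (𝓕.le _)
    ((memLp_futureMean hY2 s).integrable one_le_two)
    (fun A _ _ ↦ integrable_condExp.integrableOn) (fun A hA _ ↦ ?_)
    stronglyMeasurable_condExp.aestronglyMeasurable
  rw [setIntegral_condExp (𝓕.le _) ((memLp_futureMean hY2 t).integrable one_le_two) hA]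
  exact (h.setIntegral_futureMean hY2 hst hA).symm

/-- The amount accumulated by an optional strategy up to time `t` is known at time `t`. -/
lemma IsOptional.measurable_setIntegral_Iio {f : Icc (0 : ℝ) T → Ω → ℝ} (hf : IsOptional 𝓕 f)
    (t : Icc (0 : ℝ) T) : Measurable[𝓕 t] fun ω ↦ ∫ u in Iio t, f u ω ∂leb (Icc 0 T) := by
  have h : Measurable[𝓕 t] fun ω ↦ ∫ u in Iio t, f (min u t) ω ∂leb (Icc 0 T) :=
    (@StronglyMeasurable.integral_prod_left' _ _ _ _ (𝓕 t) _ _ _ _ _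
      (hf.progressive t).stronglyMeasurable).measurable
  convert h using 2 with ω
  refine setIntegral_congr_fun measurableSet_Iio fun u hu ↦ ?_
  rw [min_eq_left (le_of_lt hu)]

lemma memLp_extendZero_restrict (hT : 0 < T) {N : Ico (0 : ℝ) T → Ω → ℝ}
    (hN : Martingale N (restrictIco 𝓕) Q) (hr : ∀ ω, IsRCLL fun t ↦ N t ω) (t : Ico (0 : ℝ) T)
    (ht : MemLp (N t) 2 Q) :
    MemLp (fun p : Icc (0 : ℝ) T × Ω ↦ extendZero N p.1 p.2) 2
      (((leb (Icc 0 T)).restrict (Iio (toIcc t))).prod Q) := by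
  have hm := measurable_extendZero hT (fun t ↦ (hN.stronglyMeasurable t).measurable) hr
  refine memLp_two_of_lintegral_sq hm.aestronglyMeasurable ?_
  rw [lintegral_prod _ (hm.pow_const 2).ennreal_ofReal.aemeasurable]
  calc _ ≤ ∫⁻ _ in Iio (toIcc t), ENNReal.ofReal (∫ ω, N t ω ^ 2 ∂Q) ∂leb (Icc 0 T) := by
        refine lintegral_mono_ae ?_
        filter_upwards [ae_restrict_mem measurableSet_Iio] with u hu
        have huT : (u : ℝ) < T := lt_of_lt_of_le hu (toIcc t).2.2
        have hut : (⟨u, u.2.1, huT⟩ : Ico (0 : ℝ) T) ≤ t := le_of_lt hu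
        simp only [extendZero_of_lt N u huT]
        rw [← ofReal_integral_eq_lintegral_ofReal
          (memLp_martingale_of_le hN hut ht).integrable_sq (ae_of_all _ fun _ ↦ sq_nonneg _)]
        exact ENNReal.ofReal_le_ofReal (integral_sq_martingale_mono hN hut ht)
    _ < ⊤ := by
        rw [lintegral_const]
        exact ENNReal.mul_lt_top ENNReal.ofReal_lt_top (measure_lt_top _ _)

/-- Testing orthogonality with the round trips that follow a strategy `f` until time `t` and then
unwind it at constant speed. -/
lemma OrthogonalToRoundTrips.setIntegral_Iio (h : OrthogonalToRoundTrips 𝓕 Q Y) (hT : 0 < T)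
    (hY2 : MemLp (fun p : Icc (0 : ℝ) T × Ω ↦ Y p.1 p.2) 2 ((leb (Icc 0 T)).prod Q))
    {f : Icc (0 : ℝ) T → Ω → ℝ} (hf : IsOptional 𝓕 f) {K : ℝ} (hK : ∀ t ω, |f t ω| ≤ K)
    (t : Ico (0 : ℝ) T) :
    ∫ p in Iio (toIcc t) ×ˢ univ, f p.1 p.2 * Y p.1 p.2 ∂((leb (Icc 0 T)).prod Q)
      = ∫ ω, (∫ u in Iio (toIcc t), f u ω ∂leb (Icc 0 T)) * futureMean Y t ω ∂Q := by
  set F : Ω → ℝ := fun ω ↦ ∫ u in Iio (toIcc t), f u ω ∂leb (Icc 0 T) with hF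
  have hTt : 0 < T - (t : ℝ) := sub_pos.2 t.2.2
  have hFm : Measurable[𝓕 (toIcc t)] fun ω ↦ (T - (t : ℝ))⁻¹ * F ω :=
    (hf.measurable_setIntegral_Iio (toIcc t)).const_mul _
  have hfi : ∀ ω, Integrable (fun u ↦ f u ω) (leb (Icc 0 T)) := fun ω ↦
    Integrable.of_bound (hf.measurable_path hT ω).aestronglyMeasurable K
      (ae_of_all _ fun u ↦ hK u ω)
  obtain ⟨C, hC⟩ : ∃ C, ∀ ω, |(T - (t : ℝ))⁻¹ * F ω| ≤ C := by
    refine ⟨|(T - (t : ℝ))⁻¹| * (K * ((leb (Icc 0 T)).restrict (Iio (toIcc t))).real univ),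
      fun ω ↦ ?_⟩
    rw [abs_mul]
    gcongr
    exact norm_integral_le_of_norm_le_const (f := fun u ↦ f u ω) (ae_of_all _ fun u ↦ hK u ω)
  have o1 : IsOptional 𝓕 fun u ω ↦ if toIcc t ≤ u then (1 : ℝ) else 0 :=
    isOptional_indicator_Ici (toIcc t) measurable_const
  have o2 : IsOptional 𝓕 fun u ω ↦ f u ω * (1 - if toIcc t ≤ u then (1 : ℝ) else 0) :=
    hf.mul ((IsOptional.const 1).sub o1)
  have o3 := isOptional_indicator_Ici (toIcc t) hFm
  have e2 : ∀ u ω, f u ω * (1 - if toIcc t ≤ u then (1 : ℝ) else 0)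
      = (Iio (toIcc t)).indicator (fun u ↦ f u ω) u := by
    intro u ω
    by_cases hu : toIcc t ≤ u
    · simp [hu]
    · simp [hu, not_le.1 hu]
  have b2 : ∀ u ω, |f u ω * (1 - if toIcc t ≤ u then (1 : ℝ) else 0)| ≤ K := by
    intro u ω
    split_ifs
    · simpa using (abs_nonneg _).trans (hK u ω)
    · simpa using hK u ω
  have b3 : ∀ u ω, |if toIcc t ≤ u then (T - (t : ℝ))⁻¹ * F ω else 0| ≤ C := by
    intro u ω
    split_ifs
    · exact hC ω
    · simpa using (abs_nonneg _).trans (hC ω)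
  -- the round trip `f 1_{[0, t)} - (T - t)⁻¹ F 1_{[t, T]}`
  have h0 := h _ (K + C) (o2.sub o3)
    (fun u ω ↦ (abs_sub _ _).trans (add_le_add (b2 u ω) (b3 u ω))) (fun ω ↦ by
      have i3 : Integrable (fun u ↦ if toIcc t ≤ u then (T - (t : ℝ))⁻¹ * F ω else 0)
        (leb (Icc 0 T)) := Integrable.of_bound (Measurable.ite measurableSet_Ici measurable_const
          measurable_const).aestronglyMeasurable C (ae_of_all _ fun u ↦ b3 u ω)
      simp only [e2]
      rw [integral_sub ((hfi ω).indicator measurableSet_Iio) i3,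
        integral_indicator measurableSet_Iio, integral_ite_Ici]
      change F ω - (T - (t : ℝ)) * _ = 0
      field_simp
      ring)
  obtain ⟨i4, e4⟩ := integral_indicator_Ici_mul hY2 (toIcc t) (hFm.mono (𝓕.le _) le_rfl) hC
  have i5 : Integrable (fun p : Icc (0 : ℝ) T × Ω ↦ f p.1 p.2
      * (1 - if toIcc t ≤ p.1 then (1 : ℝ) else 0) * Y p.1 p.2) ((leb (Icc 0 T)).prod Q) :=
    (hY2.integrable one_le_two).bdd_mul (o2.measurable hT).aestronglyMeasurable
      (ae_of_all _ fun p ↦ b2 p.1 p.2)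
  simp only [sub_mul (_ * _)] at h0
  rw [integral_sub i5 i4, e4, sub_eq_zero] at h0
  rw [← integral_indicator (measurableSet_Iio.prod MeasurableSet.univ)]
  calc _ = _ := integral_congr_ae (ae_of_all _ fun p ↦ by
        rw [e2]
        by_cases hp : p.1 < toIcc t <;> simp [hp])
    _ = _ := h0
    _ = _ := integral_congr_ae (ae_of_all _ fun ω ↦ by simp only [futureMean]; ring)

/-- A square-integrable optional process that is orthogonal to the round trips coincides `dt ⊗ Q`
almost everywhere with a right-continuous martingale on `[0, T)`. -/
theorem OrthogonalToRoundTrips.exists_isDualMartingale (h : OrthogonalToRoundTrips 𝓕 Q Y)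
    {hT : 0 < T} (h𝓕 : UsualConditions P hT 𝓕) (hPQ : P ≪ Q) (hY : IsOptional 𝓕 Y)
    (hY2 : MemLp (fun p : Icc (0 : ℝ) T × Ω ↦ Y p.1 p.2) 2 ((leb (Icc 0 T)).prod Q)) :
    ∃ N, IsDualMartingale 𝓕 Q N ∧
      ∀ᵐ p ∂((leb (Icc 0 T)).prod Q), extendZero N p.1 p.2 = Y p.1 p.2 := by
  obtain ⟨N, hN, hNr, hNξ⟩ := exists_rcll_version h𝓕 hPQ (h.martingale hY2)
    fun t ↦ (memLp_futureMean hY2 t).condExp one_le_two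
  have hN2 : ∀ t, MemLp (N t) 2 Q := fun t ↦
    (memLp_congr_ae (hNξ t)).2 ((memLp_futureMean hY2 t).condExp one_le_two)
  have hNo : IsOptional 𝓕 (extendZero N) :=
    isOptional_extendZero (fun t ↦ (hN.stronglyMeasurable t).measurable) hNr
  -- the sign of the difference `Y - N`, as a test strategy
  set f : Icc (0 : ℝ) T → Ω → ℝ := fun u ω ↦ if 0 ≤ Y u ω - extendZero N u ω then 1 else -1
    with hfdef
  have hf : IsOptional 𝓕 f :=
    (Measurable.ite measurableSet_Ici measurable_const measurable_const :
      Measurable fun x : ℝ ↦ if 0 ≤ x then (1 : ℝ) else -1).comp (hY.sub hNo)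
  have hK : ∀ u ω, |f u ω| ≤ 1 := by
    intro u ω
    simp only [hfdef]
    split_ifs <;> simp
  have hzero : ∀ t : Ico (0 : ℝ) T,
      ∀ᵐ p ∂((leb (Icc 0 T)).prod Q).restrict (Iio (toIcc t) ×ˢ univ),
        extendZero N p.1 p.2 = Y p.1 p.2 := by
    intro t
    have hext := memLp_extendZero_restrict hT hN hNr t (hN2 t)
    have hf2 : MemLp (fun p : Icc (0 : ℝ) T × Ω ↦ f p.1 p.2) 2
        (((leb (Icc 0 T)).restrict (Iio (toIcc t))).prod Q) :=
      MemLp.of_bound (hf.measurable hT).aestronglyMeasurable 1 (ae_of_all _ fun p ↦ hK p.1 p.2)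
    have e1 := integral_prod_mul_martingale hN hf t (hN2 t) hf2 hext
    have e2 := h.setIntegral_Iio hT hY2 hf hK t
    set F : Ω → ℝ := fun ω ↦ ∫ u in Iio (toIcc t), f u ω ∂leb (Icc 0 T) with hF
    have hFm : StronglyMeasurable[𝓕 (toIcc t)] F :=
      (hf.measurable_setIntegral_Iio (toIcc t)).stronglyMeasurable
    have iN : Integrable (fun p : Icc (0 : ℝ) T × Ω ↦ f p.1 p.2 * N t p.2)
        (((leb (Icc 0 T)).restrict (Iio (toIcc t))).prod Q) :=
      hf2.integrable_mul ((hN2 t).comp_snd ((leb (Icc 0 T)).restrict (Iio (toIcc t))))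
    have e3 : ∫ p, f p.1 p.2 * N t p.2 ∂(((leb (Icc 0 T)).restrict (Iio (toIcc t))).prod Q)
        = ∫ ω, F ω * N t ω ∂Q := by
      rw [integral_prod_symm _ iN]
      exact integral_congr_ae (ae_of_all _ fun ω ↦
        integral_mul_const (N t ω) (fun u ↦ f u ω))
    have hFL : MemLp F 2 Q := memLp_integral_left hf2
    have iF : Integrable (fun ω ↦ F ω * futureMean Y t ω) Q :=
      hFL.integrable_mul (memLp_futureMean hY2 t)
    -- `F` is known at time `t`, and `N_t` is the conditional expectation of the future mean
    have e4 : ∫ ω, F ω * futureMean Y t ω ∂Q = ∫ ω, F ω * N t ω ∂Q := by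
      rw [← integral_condExp (𝓕.le (toIcc t))]
      refine integral_congr_ae ?_
      filter_upwards [condExp_mul_of_stronglyMeasurable_left hFm iF
        ((memLp_futureMean hY2 t).integrable one_le_two), hNξ t] with ω h1 h2
      exact h1.trans (by rw [Pi.mul_apply, h2])
    have hY2' : MemLp (fun p : Icc (0 : ℝ) T × Ω ↦ Y p.1 p.2) 2
        (((leb (Icc 0 T)).restrict (Iio (toIcc t))).prod Q) := by
      rw [prod_restrict_left]; exact hY2.restrict _
    rw [← prod_restrict_left] at e2 ⊢
    have i1 : Integrable (fun p : Icc (0 : ℝ) T × Ω ↦ f p.1 p.2 * Y p.1 p.2)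
      (((leb (Icc 0 T)).restrict (Iio (toIcc t))).prod Q) := hf2.integrable_mul hY2'
    have i2 : Integrable (fun p : Icc (0 : ℝ) T × Ω ↦ f p.1 p.2 * extendZero N p.1 p.2)
      (((leb (Icc 0 T)).restrict (Iio (toIcc t))).prod Q) := hf2.integrable_mul hext
    have habs : ∀ p : Icc (0 : ℝ) T × Ω, f p.1 p.2 * Y p.1 p.2 - f p.1 p.2 * extendZero N p.1 p.2
        = |Y p.1 p.2 - extendZero N p.1 p.2| := by
      intro p
      simp only [hfdef]
      split_ifs with hp
      · rw [abs_of_nonneg hp]; ring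
      · rw [abs_of_neg (not_le.1 hp)]; ring
    have e5 : ∫ p, |Y p.1 p.2 - extendZero N p.1 p.2|
        ∂(((leb (Icc 0 T)).restrict (Iio (toIcc t))).prod Q) = 0 := by
      simp only [← habs]
      rw [integral_sub i1 i2, e2, e1, e3, e4, sub_self]
    have i3 : Integrable (fun p : Icc (0 : ℝ) T × Ω ↦ |Y p.1 p.2 - extendZero N p.1 p.2|)
        (((leb (Icc 0 T)).restrict (Iio (toIcc t))).prod Q) := by
      simp only [← habs]
      exact i1.sub i2
    filter_upwards [(integral_eq_zero_iff_of_nonneg (fun p ↦ abs_nonneg _) i3).1 e5] with p hp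
    exact (sub_eq_zero.1 (abs_eq_zero.1 hp)).symm
  have hae : ∀ᵐ p ∂((leb (Icc 0 T)).prod Q), extendZero N p.1 p.2 = Y p.1 p.2 := by
    have h1 := (ae_restrict_iUnion_iff (fun n ↦ Iio (toIcc (approachLast hT n)) ×ˢ univ)
      (fun p : Icc (0 : ℝ) T × Ω ↦ extendZero N p.1 p.2 = Y p.1 p.2)).2 fun n ↦ hzero _
    have h2 : ∀ᵐ p ∂((leb (Icc 0 T)).prod Q), (p.1 : ℝ) < T :=
      Measure.quasiMeasurePreserving_fst.ae (ae_lt_last hT)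
    rw [ae_restrict_iff' (MeasurableSet.iUnion fun n ↦
      measurableSet_Iio.prod MeasurableSet.univ)] at h1
    filter_upwards [h1, h2] with p hp1 hp2
    obtain ⟨n, hn⟩ := exists_lt_approachLast hT hp2
    exact hp1 (mem_iUnion.2 ⟨n, hn, mem_univ _⟩)
  refine ⟨N, ⟨hN, hNr, ?_⟩, hae⟩
  rw [lintegral_sq_extendZero hT (fun t ↦ (hN.stronglyMeasurable t).measurable) hNr]
  rw [lintegral_congr_ae (g := fun p ↦ ENNReal.ofReal (Y p.1 p.2 ^ 2))
    (hae.mono fun p hp ↦ by simp only [hp])]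
  exact (hasFiniteIntegral_iff_ofReal (ae_of_all _ fun p ↦ sq_nonneg _)).1 hY2.integrable_sq.2

end AlmgrenChriss

namespace AlmgrenChriss

/-! ### Strong duality and uniqueness -/

variable {Ω : Type*} {m : MeasurableSpace Ω} {T : ℝ} {P Q : Measure Ω}
  {𝓕 : Filtration (Icc (0 : ℝ) T) m} {S φ ψ : Icc (0 : ℝ) T → Ω → ℝ} {W : Ω → ℝ} {a : ℝ}
  {Λ α Φ₀ : ℝ} {M N : Ico (0 : ℝ) T → Ω → ℝ}

lemma portfolioOf_of_lt {t : Icc (0 : ℝ) T} (ht : (t : ℝ) < T) (ω : Ω) :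
    portfolioOf S Λ M t ω = (extendZero M t ω - S t ω) / Λ := by
  simp [portfolioOf, extendZero, ht]

lemma isOptional_portfolioOf (hS : IsOptional 𝓕 S) (hM : IsDualMartingale 𝓕 Q M) :
    IsOptional 𝓕 (portfolioOf S Λ M) := by
  have h1 : IsOptional 𝓕 (extendZero fun (_ : Ico (0 : ℝ) T) (_ : Ω) ↦ (1 : ℝ)) :=
    isOptional_extendZero (fun _ ↦ measurable_const)
      fun _ _ ↦ ⟨continuousWithinAt_const, 1, tendsto_const_nhds⟩
  have h2 := (hM.isOptional.sub (h1.mul hS)).const_mul Λ⁻¹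
  convert h2 using 3 with t ω
  by_cases ht : (t : ℝ) < T
  · rw [portfolioOf_of_lt ht, extendZero_of_lt (fun _ _ ↦ (1 : ℝ)) t ht]
    ring
  · simp [portfolioOf, extendZero, ht]

lemma ae_ae_of_ae_prod_leb [SFinite P] {p : Icc (0 : ℝ) T → Ω → Prop}
    (h : ∀ᵐ x ∂((leb (Icc 0 T)).prod P), p x.1 x.2) :
    ∀ᵐ ω ∂P, ∀ᵐ t ∂leb (Icc (0 : ℝ) T), p t ω := by
  refine Measure.ae_ae_of_ae_prod (p := fun x : Ω × Icc (0 : ℝ) T ↦ p x.2 x.1) ?_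
  exact (Measure.measurePreserving_swap (μ := P)
    (ν := leb (Icc (0 : ℝ) T))).quasiMeasurePreserving.ae h

lemma pnl_ae_eq [SFinite P] (hT : 0 < T)
    (h : ∀ᵐ p ∂((leb (Icc 0 T)).prod P), φ p.1 p.2 = ψ p.1 p.2) :
    pnl hT S Λ Φ₀ φ =ᵐ[P] pnl hT S Λ Φ₀ ψ := by
  filter_upwards [ae_ae_of_ae_prod_leb (p := fun t ω ↦ φ t ω = ψ t ω) h] with ω hω
  rw [pnl, pnl, integral_congr_ae (hω.mono fun t ht ↦
    show φ t ω * S t ω = ψ t ω * S t ω by rw [ht]),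
    integral_congr_ae (hω.mono fun t ht ↦ show φ t ω ^ 2 = ψ t ω ^ 2 by rw [ht])]

lemma expLoss_congr [SFinite P] (hT : 0 < T)
    (h : ∀ᵐ p ∂((leb (Icc 0 T)).prod P), φ p.1 p.2 = ψ p.1 p.2) :
    expLoss P hT S Λ α Φ₀ φ = expLoss P hT S Λ α Φ₀ ψ :=
  lintegral_congr_ae ((pnl_ae_eq (S := S) (Λ := Λ) (Φ₀ := Φ₀) hT h).mono fun ω hω ↦ by
    simp only [hω])

lemma IsAdmissible.congr [SFinite P] (hφ : IsAdmissible P 𝓕 Φ₀ φ) (hψ : IsOptional 𝓕 ψ)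
    (h : ∀ᵐ p ∂((leb (Icc 0 T)).prod P), φ p.1 p.2 = ψ p.1 p.2) : IsAdmissible P 𝓕 Φ₀ ψ := by
  have h' := ae_ae_of_ae_prod_leb (p := fun t ω ↦ φ t ω = ψ t ω) h
  refine ⟨hψ, ?_, ?_⟩
  · filter_upwards [h', hφ.sq_integrable] with ω hω hi
    exact hi.congr (hω.mono fun t ht ↦ by simp only [ht])
  · filter_upwards [h', hφ.liquidation] with ω hω hl
    rw [← integral_congr_ae hω]
    exact hl

/-- Right-continuous paths that coincide at almost every time coincide at all times. -/
lemma eq_of_ae_eq_of_isRCLL {x y : Ico (0 : ℝ) T → ℝ} (hx : IsRCLL x) (hy : IsRCLL y)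
    (h : ∀ᵐ t : Ico (0 : ℝ) T ∂leb (Ico 0 T), x t = y t) : x = y := by
  ext t
  by_contra hne
  have h1 : ∀ᶠ u in 𝓝[≥] t, x u - y u ≠ 0 :=
    ((hx t).1.tendsto.sub (hy t).1.tendsto).eventually_ne (sub_ne_zero.2 hne)
  obtain ⟨r, hr1, hr2⟩ := exists_between t.2.2
  have htr : t < ⟨r, t.2.1.trans hr1.le, hr2⟩ := hr1
  obtain ⟨c, hc, hsub⟩ := (mem_nhdsGE_iff_exists_mem_Ioc_Ico_subset htr).1 h1
  have hpos : 0 < leb (Ico (0 : ℝ) T) (Ioo t c) := by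
    rw [leb, comap_subtype_coe_apply measurableSet_Ico]
    have : Subtype.val '' Ioo t c = Ioo (t : ℝ) c := by
      ext z; constructor
      · rintro ⟨w, hw, rfl⟩; exact hw
      · intro hz
        exact ⟨⟨z, t.2.1.trans hz.1.le, hz.2.trans c.2.2⟩, hz, rfl⟩
    rw [this, Real.volume_Ioo, ENNReal.ofReal_pos]
    exact sub_pos.2 hc.1
  obtain ⟨u, hu, hxy⟩ := ((frequently_ae_mem_iff.2 hpos.ne').and_eventually h).exists
  exact hsub ⟨hu.1.le, hu.2⟩ (sub_eq_zero.2 hxy)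

lemma indistinguishable_of_ae_eq [SFinite P] (hM : ∀ ω, IsRCLL fun t ↦ M t ω)
    (hN : ∀ ω, IsRCLL fun t ↦ N t ω)
    (h : ∀ᵐ p ∂((leb (Icc 0 T)).prod P), extendZero M p.1 p.2 = extendZero N p.1 p.2) :
    ∀ᵐ ω ∂P, ∀ t, M t ω = N t ω := by
  filter_upwards [ae_ae_of_ae_prod_leb (p := fun t ω ↦ extendZero M t ω = extendZero N t ω) h]
    with ω hω
  have h1 := measurePreserving_toIcc.quasiMeasurePreserving.ae hω
  simp only [extendZero_toIcc] at h1
  exact congrFun (eq_of_ae_eq_of_isRCLL (hM ω) (hN ω) h1)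

lemma isOptimal_iff (hT : 0 < T) : IsOptimal P hT 𝓕 S Λ α Φ₀ φ ↔ IsAdmissible P 𝓕 Φ₀ φ ∧
    ∀ η, IsAdmissible P 𝓕 Φ₀ η → expLoss P hT S Λ α Φ₀ φ ≤ expLoss P hT S Λ α Φ₀ η := by
  simp only [IsOptimal, expectedUtility, EReal.neg_le_neg_iff, EReal.coe_ennreal_le_coe_ennreal_iff]

variable [IsProbabilityMeasure P]

/-- The density of the dual measure is proportional to `exp(- α V_T)` for the optimal strategy `φ`,
and the dual martingale is the version of `S + Λ φ` with right-continuous paths. -/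
theorem exists_dual_optimizer {hT : 0 < T} (h𝓕 : UsualConditions P hT 𝓕)
    (hW : IsExpBound P S W a) (hS : IsOptional 𝓕 S) (hΛ : 0 < Λ) (hα : 0 < α)
    (hφ : IsAdmissible P 𝓕 Φ₀ φ) (hfin : expLoss P hT S Λ α Φ₀ φ ≠ ⊤)
    (hmin : ∀ η, IsAdmissible P 𝓕 Φ₀ η → expLoss P hT S Λ α Φ₀ φ ≤ expLoss P hT S Λ α Φ₀ η) :
    FiniteEntropy P (P.tilted fun ω ↦ -α * pnl hT S Λ Φ₀ φ ω) ∧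
    ∃ N, IsDualMartingale 𝓕 (P.tilted fun ω ↦ -α * pnl hT S Λ Φ₀ φ ω) N ∧
      (∀ᵐ p ∂((leb (Icc 0 T)).prod P), extendZero N p.1 p.2 = S p.1 p.2 + Λ * φ p.1 p.2) ∧
      dualObjective P hT S Λ α Φ₀ (P.tilted fun ω ↦ -α * pnl hT S Λ Φ₀ φ ω) N
        = -(1 / α) * Real.log (∫ ω, Real.exp (-α * pnl hT S Λ Φ₀ φ ω) ∂P) := by
  obtain ⟨hQ, hXi, hent⟩ := finiteEntropy_of_isMinimal hT hW hS hΛ hα hφ hfin hmin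
  refine ⟨hQ, ?_⟩
  set Q := P.tilted fun ω ↦ -α * pnl hT S Λ Φ₀ φ ω with hQdef
  have := hQ.prob
  have hVi : Integrable (fun ω ↦ -pnl hT S Λ Φ₀ φ ω) Q := by
    refine (hXi.const_mul α⁻¹).congr (ae_of_all _ fun ω ↦ ?_)
    field_simp
  have hφ2 := memLp_prod_of_integrable_pnl hT hW hS hφ hΛ hQ hVi (ae_of_all _ fun _ ↦ le_rfl)
  have horth : OrthogonalToRoundTrips 𝓕 Q fun t ω ↦ S t ω + Λ * φ t ω := fun η K hη hK hη0 ↦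
    integral_mul_eq_zero_of_isMinimal hT hW hS hΛ hα hφ hfin hmin hQdef hQ hφ2 hη hK
      (ae_of_all _ hη0)
  obtain ⟨N, hN, hNae⟩ := horth.exists_isDualMartingale h𝓕 hQ.ac'
    (hS.add (hφ.optional.const_mul Λ)) ((hW.memLp_prod hT hS hQ).add (hφ2.const_mul Λ))
  refine ⟨N, hN, (Measure.AbsolutelyContinuous.rfl.prod hQ.ac').ae_le hNae, ?_⟩
  have hgap : ∫ p, (extendZero N p.1 p.2 - S p.1 p.2 - Λ * φ p.1 p.2) ^ 2
      ∂((leb (Icc 0 T)).prod Q) = 0 := by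
    refine integral_eq_zero_of_ae (hNae.mono fun p hp ↦ ?_)
    simp [hp]
  rw [dualObjective_eq_add_gap hT hW hS hQ hN hΛ hφ hφ2, hgap, hent, integral_const_mul]
  field_simp
  ring

/-- The dual optimizer is unique: a pair with no duality gap attains equality in the entropy
inequality, and its martingale coincides with `S + Λ φ`. -/
lemma eq_of_dualObjective_le (hT : 0 < T)
    (hW : IsExpBound P S W a) (hS : IsOptional 𝓕 S) (hΛ : 0 < Λ) (hα : 0 < α)
    (hφ : IsAdmissible P 𝓕 Φ₀ φ) (hfin : expLoss P hT S Λ α Φ₀ φ ≠ ⊤)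
    (hQ : FiniteEntropy P Q) (hM : IsDualMartingale 𝓕 Q M)
    (hle : dualObjective P hT S Λ α Φ₀ Q M
      ≤ -(1 / α) * Real.log (∫ ω, Real.exp (-α * pnl hT S Λ Φ₀ φ ω) ∂P)) :
    Q = P.tilted (fun ω ↦ -α * pnl hT S Λ Φ₀ φ ω) ∧
      ∀ᵐ p ∂((leb (Icc 0 T)).prod P), extendZero M p.1 p.2 = S p.1 p.2 + Λ * φ p.1 p.2 := by
  have := hQ.prob
  have hX := integrable_exp_of_expLoss hT hS hφ.optional hfin
  have hV := integrable_pnl_of_exp hT hW hS hφ hΛ hα hQ hX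
  have hφ2 := memLp_prod_of_integrable_pnl hT hW hS hφ hΛ hQ hV.neg (ae_of_all _ fun _ ↦ le_rfl)
  have h1 := weak_duality hT hW hS hQ hM hΛ hα hφ hX
  have h2 : 0 ≤ ∫ p, (extendZero M p.1 p.2 - S p.1 p.2 - Λ * φ p.1 p.2) ^ 2
      ∂((leb (Icc 0 T)).prod Q) := integral_nonneg fun _ ↦ sq_nonneg _
  have h3 : ∫ p, (extendZero M p.1 p.2 - S p.1 p.2 - Λ * φ p.1 p.2) ^ 2
      ∂((leb (Icc 0 T)).prod Q) = 0 := by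
    refine le_antisymm ?_ h2
    have h4 : 0 < 1 / (2 * Λ) := by positivity
    by_contra h5
    have := mul_pos h4 (not_le.1 h5)
    linarith
  constructor
  · refine hQ.eq_tilted hX (hV.const_mul _) ?_
    rw [dualObjective_eq_add_gap hT hW hS hQ hM hΛ hφ hφ2, h3, mul_zero, add_zero] at hle
    have h6 := mul_le_mul_of_nonneg_left hle hα.le
    rw [integral_const_mul]
    have h7 : α * (1 / α * ∫ ω, llr Q P ω ∂Q + ∫ ω, pnl hT S Λ Φ₀ φ ω ∂Q)
        = ∫ ω, llr Q P ω ∂Q + α * ∫ ω, pnl hT S Λ Φ₀ φ ω ∂Q := by field_simp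
    have h8 : α * (-(1 / α) * Real.log (∫ ω, Real.exp (-α * pnl hT S Λ Φ₀ φ ω) ∂P))
        = -Real.log (∫ ω, Real.exp (-α * pnl hT S Λ Φ₀ φ ω) ∂P) := by field_simp
    rw [h7, h8] at h6
    linarith
  · have hi : Integrable (fun p : Icc (0 : ℝ) T × Ω ↦
        (extendZero M p.1 p.2 - S p.1 p.2 - Λ * φ p.1 p.2) ^ 2) ((leb (Icc 0 T)).prod Q) :=
      ((memLp_sub_prod hT hW hS hQ hM).sub (hφ2.const_mul Λ)).integrable_sq
    refine (Measure.AbsolutelyContinuous.rfl.prod hQ.ac').ae_le ?_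
    filter_upwards [(integral_eq_zero_iff_of_nonneg (fun p ↦ sq_nonneg _) hi).1 h3] with p hp
    have := pow_eq_zero_iff (two_ne_zero) |>.1 hp
    linarith

end AlmgrenChriss

theorem theorem2p1 {Ω : Type*} {m : MeasurableSpace Ω} (P : Measure Ω) [IsProbabilityMeasure P]
    {T : ℝ} (hT : 0 < T) (𝓕 : Filtration (Icc (0 : ℝ) T) m)
    (h𝓕 : UsualConditions P hT 𝓕) (h𝓕T : 𝓕 (lastIcc hT) = m)
    (S : Icc (0 : ℝ) T → Ω → ℝ) (hS_adapted : Adapted 𝓕 S) (hS_rcll : ∀ ω, IsRCLL fun t ↦ S t ω)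
    (hS_exp : ∃ a : ℝ, 0 < a ∧ Integrable (fun ω ↦ Real.exp (a * ⨆ t, S t ω ^ 2)) P)
    (Λ α : ℝ) (hΛ : 0 < Λ) (hα : 0 < α) (Φ₀ : ℝ) :
    -- the dual functional is well defined and finite on its whole domain
    (∀ (Q : Measure Ω) (M : Ico (0 : ℝ) T → Ω → ℝ), FiniteEntropy P Q → IsDualMartingale 𝓕 Q M →
      Integrable (dualIntegrand P hT S Λ α Φ₀ Q M) Q ∧
      Integrable (fun p : Ico (0 : ℝ) T × Ω ↦ |M p.1 p.2 - S (toIcc p.1) p.2| ^ 2)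
        ((leb (Ico 0 T)).prod Q)) ∧
    -- the primal maximum is attained and equals the dual infimum
    IsGreatest (certaintyEquivalent P hT S Λ α Φ₀ '' {φ | IsAdmissible P 𝓕 Φ₀ φ})
      (⨅ (Q : Measure Ω) (_ : FiniteEntropy P Q) (M : Ico (0 : ℝ) T → Ω → ℝ)
        (_ : IsDualMartingale 𝓕 Q M), ((dualObjective P hT S Λ α Φ₀ Q M : ℝ) : EReal)) ∧
    ∃ (Qhat : Measure Ω) (Mhat : Ico (0 : ℝ) T → Ω → ℝ),
      -- the unique dual minimizer
      IsDualMinimizer P hT 𝓕 S Λ α Φ₀ Qhat Mhat ∧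
      (∀ (Q : Measure Ω) (M : Ico (0 : ℝ) T → Ω → ℝ), IsDualMinimizer P hT 𝓕 S Λ α Φ₀ Q M →
        Q = Qhat ∧ ∀ᵐ ω ∂P, ∀ t, M t ω = Mhat t ω) ∧
      -- the unique optimal portfolio
      IsOptimal P hT 𝓕 S Λ α Φ₀ (portfolioOf S Λ Mhat) ∧
      ∀ φ, IsOptimal P hT 𝓕 S Λ α Φ₀ φ →
        ∀ᵐ p ∂((leb (Icc 0 T)).prod P),
          φ p.1 p.2 = portfolioOf S Λ Mhat p.1 p.2 := by
  obtain ⟨a, ha, hexp⟩ := hS_exp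
  have hS : IsOptional 𝓕 S := IsOptional.of_rcll hS_adapted hS_rcll
  have hW := isExpBound_iSup hS_rcll ha hexp
  obtain ⟨φ, hφ, hfin, hmin⟩ := exists_isMinimal (𝓕 := 𝓕) (Φ₀ := Φ₀) hT hW hS hΛ hα
  obtain ⟨hQ, N, hN, hNφ, hval⟩ := exists_dual_optimizer h𝓕 hW hS hΛ hα hφ hfin hmin
  have hX := integrable_exp_of_expLoss hT hS hφ.optional hfin
  have hCE := certaintyEquivalent_eq hT hX
  have hweak : ∀ (Q : Measure Ω) (M : Ico (0 : ℝ) T → Ω → ℝ), FiniteEntropy P Q →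
      IsDualMartingale 𝓕 Q M → ∀ ψ, IsAdmissible P 𝓕 Φ₀ ψ → certaintyEquivalent P hT S Λ α Φ₀ ψ
        ≤ ((dualObjective P hT S Λ α Φ₀ Q M : ℝ) : EReal) := fun Q M hQ hM ψ hψ ↦
    certaintyEquivalent_le_dualObjective hT hW hS hQ hM hΛ hα hψ
  have hport : ∀ᵐ p ∂((leb (Icc 0 T)).prod P), φ p.1 p.2 = portfolioOf S Λ N p.1 p.2 := by
    have hlt : ∀ᵐ p : Icc (0 : ℝ) T × Ω ∂((leb (Icc 0 T)).prod P), (p.1 : ℝ) < T :=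
      Measure.quasiMeasurePreserving_fst.ae (ae_lt_last hT)
    filter_upwards [hNφ, hlt] with p hp hpT
    rw [portfolioOf_of_lt hpT, hp]
    field_simp
    ring
  refine ⟨fun Q M hQ hM ↦ ⟨integrable_dualIntegrand hT hW hS hQ hM,
    integrable_sq_sub_Ico hT hW hS hQ hM⟩, ⟨⟨φ, hφ, ?_⟩, ?_⟩,
    _, N, ⟨⟨hQ, hN⟩, ?_⟩, ?_, ?_, ?_⟩
  · refine le_antisymm (le_iInf₂ fun Q hQ ↦ le_iInf₂ fun M hM ↦ hweak Q M hQ hM φ hφ) ?_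
    rw [hCE, ← hval]
    exact iInf₂_le_of_le _ hQ (iInf₂_le_of_le N hN le_rfl)
  · rintro _ ⟨ψ, hψ, rfl⟩
    exact le_iInf₂ fun Q hQ ↦ le_iInf₂ fun M hM ↦ hweak Q M hQ hM ψ hψ
  · intro Q M hQ' hM
    rw [hval, ← EReal.coe_le_coe_iff, ← hCE]
    exact hweak Q M hQ' hM φ hφ
  · intro Q M hQM
    have hle := hQM.2 _ N hQ hN
    rw [hval] at hle
    obtain ⟨h1, h2⟩ := eq_of_dualObjective_le hT hW hS hΛ hα hφ hfin hQM.1.1 hQM.1.2 hle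
    refine ⟨h1, indistinguishable_of_ae_eq hQM.1.2.rcll hN.rcll ?_⟩
    filter_upwards [h2, hNφ] with p hp hp'
    rw [hp, hp']
  · refine (isOptimal_iff hT).2 ⟨hφ.congr (isOptional_portfolioOf hS hN) hport, fun η hη ↦ ?_⟩
    rw [← expLoss_congr hT hport]
    exact hmin η hη
  · intro ψ hψ
    obtain ⟨hψ1, hψ2⟩ := (isOptimal_iff hT).1 hψ
    filter_upwards [ae_eq_of_isMinimal hT hW hS hΛ hα hφ hψ1 hfin hmin (hψ2 φ hφ), hport]
      with p hp hp'
    rw [← hp, hp']
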